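/- **Setting.** Let $p\ge 1$, $n_0>p$, $M\ge 1$, $0<\alpha<1$, $\beta_0\in\mathbb R^p$ and $\sigma>0$. For $j=1,\dots,M$ and $i\ge 1$ let $y_{ji}=x_{ji}^\top\beta_0+\epsilon_{ji}$, where the errors $\epsilon_{ji}$ are i.i.d. over all $(j,i)$ with mean $0$ and variance $\sigma^2$, and the covariates $x_{ji}\in\mathbb R^p$ are nonrandom or, more generally, random with $(x_{ji})_{j,i}$ independent of $(\epsilon_{ji})_{j,i}$. Write $X_{jn}X_{jn}^\top=\sum_{i=1}^n x_{ji}x_{ji}^\top$, and assume that each $X_{jn_0}X_{jn_0}^\top$ is (almost surely) nonsingular. Assume (A1) for each $j$, $\lim_{n\to\infty} X_{jn}X_{jn}^\top/n=\Sigma$ (almost surely), where $\Sigma$ is a nonrandom positive definite matrix. For $n\ge n_0$ let $\hat\beta_{jn}=(X_{jn}X_{jn}^\top)^{-1}\sum_{i=1}^n x_{ji}y_{ji}$ be the least squares estimate, $\hat\sigma_{jn}^2=\frac1{n-p}\sum_{i=1}^n(y_{ji}-x_{ji}^\top\hat\beta_{jn})^2$, $\mu_{jn}=\lambda_{\min}(X_{jn}X_{jn}^\top/n)$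 and $\mu=\lambda_{\min}(\Sigma)$. Let $a^2$ be the $1-\alpha$ quantile of the chi-square distribution with $p$ degrees of freedom, and let $\tilde a_j>0$ with $\sum_{j=1}^M\tilde a_j^2=a^2$. For $d>0$ put $$N_j=\inf\Big\{n\ge n_0:\ \hat\sigma_{jn}^2+\frac1n\le\frac{d^2n}{\tilde a_j^2\mu_{jn}}\Big\},\qquad N^*=\sum_{j=1}^M N_j,\qquad \rho_j=\frac{N_j}{N^*},$$ $\hat\beta=\sum_j\rho_j\hat\beta_{jN_j}$, $\mu_{N^*}=\sum_j\rho_j\mu_{jN_j}$, and $$R_{N^*}=\Big\{z\in\mathbb R^p:\ (z-\hat\beta)^\top\Big\{\sum_{j=1}^M\rho_j^2(X_{jN_j}X_{jN_j}^\top)^{-1}\Big\}^{-1}(z-\hat\beta)\le\frac{N^*d^2}{\mu_{N^*}}\Big\}.$$ **Theorem 1.** Almost surely all $N_j$ are finite for every $d>0$, and 1. $\displaystyle\lim_{d\to0}\frac{d^2N^*}{a^2\sigma^2\mu}=1$ almost surely; 2. $\displaystyle\lim_{d\to0}P(\beta_0\in R_{N^*})=1-\alpha$; 3. $E(N^*)<\infty$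 for every $d>0$ and $\displaystyle\lim_{d\to0}\frac{d^2E(N^*)}{a^2\sigma^2\mu}=1$, provided, if the covariates are random, that $E\big(\sup_{n\ge n_0}\mu_{jn}\big)<\infty$ for each $j$ (for nonrandom covariates this holds automatically by (A1)). -/

import Mathlib

open MeasureTheory ProbabilityTheory Filter Topology
open scoped Matrix

namespace DistSeq

noncomputable section

/-- The chi-square distribution with `p` degrees of freedom: the law of the sum of squares of
`p` independent standard normal variables. -/
def chiSquare (p : ℕ) : Measure ℝ :=
  (Measure.pi (fun _ : Fin p => gaussianReal 0 1)).map (fun z => ∑ k, z k ^ 2)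

/-- The minimum eigenvalue of a symmetric real matrix. -/
def minEig {p : ℕ} (A : Matrix (Fin p) (Fin p) ℝ) : ℝ := sInf (spectrum ℝ A)

/-! ### One procedure

`x i` and `y i` (`i = 0, 1, 2, …`) are the successively recruited covariate vectors and
responses; stage `n` uses the first `n` of them. -/

/-- `X_n X_nᵀ = ∑_{i ≤ n} x_i x_iᵀ`. -/
def gram {p : ℕ} (x : ℕ → Fin p → ℝ) (n : ℕ) : Matrix (Fin p) (Fin p) ℝ :=
  ∑ i ∈ Finset.range n, Matrix.vecMulVec (x i) (x i)

/-- The least squares estimate at stage `n` (for nonsingular `X_n X_nᵀ`). -/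
def lse {p : ℕ} (x : ℕ → Fin p → ℝ) (y : ℕ → ℝ) (n : ℕ) : Fin p → ℝ :=
  (gram x n)⁻¹ *ᵥ (∑ i ∈ Finset.range n, y i • x i)

/-- The estimate `σ̂_n²` of the error variance at stage `n > p`. -/
def varEst {p : ℕ} (x : ℕ → Fin p → ℝ) (y : ℕ → ℝ) (n : ℕ) : ℝ :=
  (∑ i ∈ Finset.range n, (y i - x i ⬝ᵥ lse x y n) ^ 2) / ((n : ℝ) - (p : ℝ))

/-- `μ_n = λ_min (X_n X_nᵀ / n)`. -/
def designMinEig {p : ℕ} (x : ℕ → Fin p → ℝ) (n : ℕ) : ℝ :=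
  minEig ((n : ℝ)⁻¹ • gram x n)

/-- The stages `n ≥ n₀` at which the stopping inequality holds. -/
def stopSet {p : ℕ} (n₀ : ℕ) (a d : ℝ) (x : ℕ → Fin p → ℝ) (y : ℕ → ℝ) : Set ℕ :=
  {n | n₀ ≤ n ∧ varEst x y n + 1 / (n : ℝ) ≤ d ^ 2 * n / (a ^ 2 * designMinEig x n)}

/-- The stopping time: the first stage in `stopSet`. -/
def stopTime {p : ℕ} (n₀ : ℕ) (a d : ℝ) (x : ℕ → Fin p → ℝ) (y : ℕ → ℝ) : ℕ :=
  sInf (stopSet n₀ a d x y)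

/-! ### Combining `M` procedures -/

/-- The total sample size `N* = ∑_j N_j`. -/
def totalSize {p M : ℕ} (n₀ : ℕ) (a : Fin M → ℝ) (d : ℝ)
    (x : Fin M → ℕ → Fin p → ℝ) (y : Fin M → ℕ → ℝ) : ℕ :=
  ∑ j, stopTime n₀ (a j) d (x j) (y j)

/-- The weight `ρ_j = N_j / N*`. -/
def weight {p M : ℕ} (n₀ : ℕ) (a : Fin M → ℝ) (d : ℝ)
    (x : Fin M → ℕ → Fin p → ℝ) (y : Fin M → ℕ → ℝ) (j : Fin M) : ℝ :=
  (stopTime n₀ (a j) d (x j) (y j) : ℝ) / (totalSize n₀ a d x y : ℝ)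

/-- The combined estimate `∑_j ρ_j β̂_{j N_j}`. -/
def combinedEst {p M : ℕ} (n₀ : ℕ) (a : Fin M → ℝ) (d : ℝ)
    (x : Fin M → ℕ → Fin p → ℝ) (y : Fin M → ℕ → ℝ) : Fin p → ℝ :=
  ∑ j, weight n₀ a d x y j • lse (x j) (y j) (stopTime n₀ (a j) d (x j) (y j))

/-- `μ_{N*} = ∑_j ρ_j μ_{j N_j}`. -/
def combinedMinEig {p M : ℕ} (n₀ : ℕ) (a : Fin M → ℝ) (d : ℝ)
    (x : Fin M → ℕ → Fin p → ℝ) (y : Fin M → ℕ → ℝ) : ℝ :=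
  ∑ j, weight n₀ a d x y j * designMinEig (x j) (stopTime n₀ (a j) d (x j) (y j))

/-- `∑_j ρ_j² (X_{j N_j} X_{j N_j}ᵀ)⁻¹`. -/
def combinedCov {p M : ℕ} (n₀ : ℕ) (a : Fin M → ℝ) (d : ℝ)
    (x : Fin M → ℕ → Fin p → ℝ) (y : Fin M → ℕ → ℝ) : Matrix (Fin p) (Fin p) ℝ :=
  ∑ j, weight n₀ a d x y j ^ 2 • (gram (x j) (stopTime n₀ (a j) d (x j) (y j)))⁻¹

/-- The combined confidence ellipsoid `R_{N*}`. -/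
def confSet {p M : ℕ} (n₀ : ℕ) (a : Fin M → ℝ) (d : ℝ)
    (x : Fin M → ℕ → Fin p → ℝ) (y : Fin M → ℕ → ℝ) : Set (Fin p → ℝ) :=
  {z | (z - combinedEst n₀ a d x y) ⬝ᵥ
        ((combinedCov n₀ a d x y)⁻¹ *ᵥ (z - combinedEst n₀ a d x y))
      ≤ (totalSize n₀ a d x y : ℝ) * d ^ 2 / combinedMinEig n₀ a d x y}

end

end DistSeq

namespace DistSeq

/-! ### Maximal inequality and strong law for independent, not identically distributed variables -/

section Maximal

variable {Ω : Type*} [mΩ : MeasurableSpace Ω] {P : Measure Ω}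

/-! Fix the covariates first. The residual sum of squares is `∑ e_i²` minus a quadratic form in the
noise vector `∑ e_i x_i`; a strong law for independent summands makes the noise divided by `n`
vanish, so the variance estimate tends to `σ²` almost surely. The stopping rule compares `a_j² μ_n
(σ̂_n² + 1/n)`, which converges, with `d² n`; hence `d² N_j → c_j = a_j² μ σ²` along almost every
path (`sInf_stop_tendsto`), and summing over `j` gives the size of `N*`.

For the coverage, the combined error divided by `d` is `∑_j ρ_j (d² G_j)⁻¹ (d · noise_j(N_j))`,
where `G_j` is the Gram matrix at stopping. Put `κ = ∑ c_j`. Since `ρ_j → c_j / κ` and `(d² G_j)⁻¹ →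
c_j⁻¹ S⁻¹`, every procedure receives the same limiting coefficient `κ⁻¹ S⁻¹`, so only the total
noise matters. Anscombe's argument (`tendstoInMeasure_sum_random_index`, resting on
`kolmogorov_maximal`) replaces `N_j` by a deterministic index, and
`tendstoInDistribution_weighted_sum` makes the total noise asymptotically normal with covariance `σ²
κ S`. The quadratic form of the confidence set then tends in law to `σ² ‖Z‖²` with `Z` standard
normal, while the threshold tends to `κ / μ = a² σ²`.

For the means, not having stopped one stage earlier bounds `d² N_j²` by a multiple of the sum of
squared errors up to `N_j` plus constants. Wald's identity turns this into a quadratic inequality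
that bounds the second moment of `d² N_j`, and bounded second moments upgrade almost sure
convergence to convergence of means.

Random covariates are frozen by Tonelli's theorem (`lintegral_mixedData`), and dominated convergence
integrates the conditional statements. The bound on the conditional mean is affine in the bound `T`
on the minimum eigenvalues, so integrability of `T` suffices. -/

lemma memLp_two_sum {X : ℕ → Ω → ℝ} (hL : ∀ i, MemLp (X i) 2 P) (n : ℕ) :
    MemLp (fun ω => ∑ i ∈ Finset.range n, X i ω) 2 P :=
  memLp_finsetSum _ fun i _ => hL i

lemma integral_sq_sum_range {X : ℕ → Ω → ℝ} [IsProbabilityMeasure P]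
    (hi : iIndepFun X P) (hL : ∀ i, MemLp (X i) 2 P) (h0 : ∀ i, ∫ ω, X i ω ∂P = 0) (n : ℕ) :
    ∫ ω, (∑ i ∈ Finset.range n, X i ω) ^ 2 ∂P = ∑ i ∈ Finset.range n, ∫ ω, X i ω ^ 2 ∂P := by
  have hs0 : ∫ ω, (∑ i ∈ Finset.range n, X i ω) ∂P = 0 := by
    rw [integral_finsetSum _ fun i _ => (hL i).integrable one_le_two]
    simp [h0]
  have h1 := IndepFun.variance_sum (X := X) (s := Finset.range n) (μ := P) (fun i _ => hL i)
    (fun i _ j _ hij => hi.indepFun hij)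
  have e1 : (∑ i ∈ Finset.range n, X i) = fun ω => ∑ i ∈ Finset.range n, X i ω := by
    ext ω; simp
  rw [e1, variance_of_integral_eq_zero (memLp_two_sum hL n).aemeasurable hs0] at h1
  rw [h1]
  exact Finset.sum_congr rfl fun i _ => variance_of_integral_eq_zero (hL i).aemeasurable (h0 i)

/-- **Kolmogorov's maximal inequality.** -/
theorem kolmogorov_maximal [IsProbabilityMeasure P] {X : ℕ → Ω → ℝ}
    (hm : ∀ i, Measurable (X i)) (hi : iIndepFun X P) (hL : ∀ i, MemLp (X i) 2 P)
    (h0 : ∀ i, ∫ ω, X i ω ∂P = 0) {η : ℝ} (hη : 0 < η) (n : ℕ) :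
    P {ω | ∃ k ≤ n, η ≤ |∑ i ∈ Finset.range k, X i ω|} ≤
      ENNReal.ofReal ((∑ i ∈ Finset.range n, ∫ ω, X i ω ^ 2 ∂P) / η ^ 2) := by
  have hsm : ∀ i, StronglyMeasurable (X i) := fun i => (hm i).stronglyMeasurable
  set 𝒢 := Filtration.natural X hsm
  -- The shift by one matches the natural filtration, whose `n`-th σ-algebra already knows `X n`.
  -- The squared partial sums form a submartingale, to which Doob's maximal inequality applies.
  set f : ℕ → Ω → ℝ := fun n ω => (∑ i ∈ Finset.range (n + 1), X i ω) ^ 2 with hf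
  have hadX : ∀ n, ∀ i ≤ n, Measurable[𝒢 n] (X i) := fun n i hin =>
    ((Filtration.stronglyAdapted_natural hsm i).mono (𝒢.mono hin)).measurable
  have hSm : ∀ n, Measurable[𝒢 n] (fun ω => ∑ i ∈ Finset.range (n + 1), X i ω) := fun n =>
    Finset.measurable_sum _ fun i hi => hadX n i (by simp at hi; omega)
  have hint : ∀ n, Integrable (f n) P := fun n => (memLp_two_sum hL (n + 1)).integrable_sq
  have hsub : Submartingale f 𝒢 P := by
    refine submartingale_of_setIntegral_le_succ (fun n => ((hSm n).pow_const 2).stronglyMeasurable)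
      hint fun n s hs => ?_
    have hs' : MeasurableSet s := 𝒢.le n s hs
    set g : Ω → ℝ := s.indicator (fun ω => ∑ i ∈ Finset.range (n + 1), X i ω)
    have hgm : Measurable[𝒢 n] g := (hSm n).indicator hs
    have hind : IndepFun g (X (n + 1)) P := by
      have := (hi.indep_comap_natural_of_lt hsm (Nat.lt_succ_self n)).symm
      rw [IndepFun_iff_Indep]
      exact indep_of_indep_of_le_left this hgm.comap_le
    have hgL : MemLp g 2 P := (memLp_two_sum hL (n + 1)).indicator hs'
    -- The new summand is centered and independent of the past, so the cross term of the expanded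
    -- square integrates to zero and only a nonnegative square remains.
    have hcross : ∫ ω, g ω * X (n + 1) ω ∂P = 0 := by
      rw [hind.integral_fun_mul_eq_mul_integral hgL.aestronglyMeasurable
        (hsm _).aestronglyMeasurable, h0, mul_zero]
    have hgi : Integrable (fun ω => g ω * X (n + 1) ω) P := hgL.integrable_mul (hL (n + 1))
    have hXi : Integrable (fun ω => s.indicator (fun ω => X (n + 1) ω ^ 2) ω) P :=
      (hL (n + 1)).integrable_sq.indicator hs'
    rw [← integral_indicator hs', ← integral_indicator hs']
    have hdec : s.indicator (f (n + 1)) = fun ω => s.indicator (f n) ω +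
        (2 * (g ω * X (n + 1) ω) + s.indicator (fun ω => X (n + 1) ω ^ 2) ω) := by
      ext ω
      by_cases h : ω ∈ s
      · simp only [Set.indicator_of_mem h, hf, g]
        rw [Finset.sum_range_succ _ (n + 1)]; ring
      · simp [Set.indicator_of_notMem h, g]
    have hadd : ∫ ω, (2 * (g ω * X (n + 1) ω) + s.indicator (fun ω => X (n + 1) ω ^ 2) ω) ∂P =
        2 * ∫ ω, g ω * X (n + 1) ω ∂P + ∫ ω, s.indicator (fun ω => X (n + 1) ω ^ 2) ω ∂P := by
      rw [integral_add (hgi.const_mul 2) hXi, integral_const_mul]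
    have hadd' := integral_add (μ := P) ((hint n).indicator hs')
      (g := fun ω => 2 * (g ω * X (n + 1) ω) + s.indicator (fun ω => X (n + 1) ω ^ 2) ω)
      ((hgi.const_mul 2).add hXi)
    rw [hdec, hadd', hadd, hcross]
    have : 0 ≤ ∫ ω, s.indicator (fun ω => X (n + 1) ω ^ 2) ω ∂P :=
      integral_nonneg fun ω => Set.indicator_nonneg (fun _ _ => sq_nonneg _) _
    linarith
  rcases n with _ | n
  · have : {ω : Ω | ∃ k ≤ 0, η ≤ |∑ i ∈ Finset.range k, X i ω|} = ∅ := by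
      ext ω
      simp [hη]
    rw [this]; simp
  have hη2 : 0 < η ^ 2 := by positivity
  have key := maximal_ineq hsub (fun n ω => sq_nonneg _) (ε := (η ^ 2).toNNReal) n
  rw [Real.coe_toNNReal _ hη2.le] at key
  set A := {ω | η ^ 2 ≤ (Finset.range (n + 1)).sup' Finset.nonempty_range_add_one fun k => f k ω}
  have hsubset : {ω | ∃ k ≤ n + 1, η ≤ |∑ i ∈ Finset.range k, X i ω|} ⊆ A := by
    rintro ω ⟨k, hk, hle⟩
    rcases k with _ | k
    · simp at hle; linarith
    · refine le_trans ?_ (Finset.le_sup' (fun k => f k ω) (b := k) (by simp; omega))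
      calc η ^ 2 ≤ |∑ i ∈ Finset.range (k + 1), X i ω| ^ 2 := pow_le_pow_left₀ hη.le hle 2
        _ = f k ω := sq_abs _
  have h2 : ∫ ω in A, f n ω ∂P ≤ ∑ i ∈ Finset.range (n + 1), ∫ ω, X i ω ^ 2 ∂P := by
    rw [← integral_sq_sum_range hi hL h0]
    exact setIntegral_le_integral (hint n) (ae_of_all _ fun ω => sq_nonneg _)
  have h3 := key.trans (ENNReal.ofReal_le_ofReal h2)
  rw [ENNReal.ofReal_div_of_pos hη2]
  rw [ENNReal.le_div_iff_mul_le (Or.inl (by simpa using hη.ne')) (Or.inl ENNReal.ofReal_ne_top),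
    mul_comm]
  refine le_trans ?_ h3
  rw [← ENNReal.ofReal]
  gcongr

/-- Strong law for independent centered variables whose accumulated variance grows linearly. -/
theorem strong_law_of_sum_variance_le [IsProbabilityMeasure P] {X : ℕ → Ω → ℝ}
    (hm : ∀ i, Measurable (X i)) (hi : iIndepFun X P) (hL : ∀ i, MemLp (X i) 2 P)
    (h0 : ∀ i, ∫ ω, X i ω ∂P = 0) {C : ℝ}
    (hC : ∀ n : ℕ, ∑ i ∈ Finset.range n, ∫ ω, X i ω ^ 2 ∂P ≤ C * n) :
    ∀ᵐ ω ∂P, Tendsto (fun n : ℕ => (∑ i ∈ Finset.range n, X i ω) / n) atTop (𝓝 0) := by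
  have hC0 : 0 ≤ C := by
    have := hC 1
    simp only [Nat.cast_one, mul_one] at this
    exact le_trans (Finset.sum_nonneg fun i _ => integral_nonneg fun ω => sq_nonneg _) this
  have main : ∀ δ : ℝ, 0 < δ → ∀ᵐ ω ∂P, ∀ᶠ n : ℕ in atTop,
      |∑ i ∈ Finset.range n, X i ω| ≤ δ * n := by
    intro δ hδ
    -- Dyadic blocks: a deviation `δ 2^k` before time `2^(k+1)` has probability at most `C 2^(k+1) /
    -- (δ 2^k)²`, which is geometric in `k`. Borel–Cantelli leaves finitely many bad blocks, and `n`
    -- belongs to block `Nat.log 2 n`.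
    set A : ℕ → Set Ω := fun k =>
      {ω | ∃ m ≤ 2 ^ (k + 1), δ * 2 ^ k ≤ |∑ i ∈ Finset.range m, X i ω|}
    have hA : ∀ k, P (A k) ≤ ENNReal.ofReal (2 * C / δ ^ 2 * (1 / 2) ^ k) := by
      intro k
      refine (kolmogorov_maximal hm hi hL h0 (by positivity : 0 < δ * 2 ^ k) _).trans
        (ENNReal.ofReal_le_ofReal ?_)
      rw [div_le_iff₀ (by positivity)]
      refine (hC _).trans (le_of_eq ?_)
      have h2 : (1 / 2 : ℝ) ^ k * 2 ^ k = 1 := by rw [← mul_pow]; norm_num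
      push_cast
      calc C * 2 ^ (k + 1) = 2 * C * 2 ^ k * ((1 / 2 : ℝ) ^ k * 2 ^ k) := by rw [h2]; ring
        _ = _ := by field_simp
    have hsum : ∑' k, P (A k) ≠ ⊤ := by
      have hs : Summable fun k : ℕ => 2 * C / δ ^ 2 * (1 / 2 : ℝ) ^ k :=
        (summable_geometric_of_lt_one (by norm_num) (by norm_num)).mul_left _
      refine ne_top_of_le_ne_top ?_ (ENNReal.tsum_le_tsum hA)
      rw [← ENNReal.ofReal_tsum_of_nonneg (fun k => by positivity) hs]
      exact ENNReal.ofReal_ne_top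
    filter_upwards [ae_eventually_notMem hsum] with ω hω
    obtain ⟨K, hK⟩ := eventually_atTop.1 hω
    filter_upwards [eventually_ge_atTop (2 ^ K)] with n hn
    have hn0 : n ≠ 0 := by have := Nat.two_pow_pos K; omega
    have hlog : K ≤ Nat.log 2 n := (Nat.le_log_iff_pow_le (by norm_num) hn0).2 hn
    have hnot := hK _ hlog
    simp only [A, Set.mem_ofPred_eq, not_exists, not_and, not_le] at hnot
    have h1 := hnot n (Nat.lt_pow_succ_log_self (by norm_num) n).le
    refine h1.le.trans ?_
    gcongr
    exact_mod_cast Nat.pow_log_le_self 2 hn0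
  have hall : ∀ᵐ ω ∂P, ∀ q : ℕ, ∀ᶠ n : ℕ in atTop,
      |∑ i ∈ Finset.range n, X i ω| ≤ (1 / ((q : ℝ) + 1)) * n :=
    ae_all_iff.2 fun q => main _ (by positivity)
  filter_upwards [hall] with ω hω
  rw [Metric.tendsto_atTop']
  intro ε hε
  obtain ⟨q, hq⟩ := exists_nat_one_div_lt hε
  obtain ⟨N, hN⟩ := eventually_atTop.1 (hω q)
  refine ⟨N, fun n hn => ?_⟩
  have hn0 : (0 : ℝ) < n := by exact_mod_cast (by omega : 0 < n)
  rw [Real.dist_eq, sub_zero, abs_div, abs_of_pos hn0, div_lt_iff₀ hn0]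
  refine (hN n hn.le).trans_lt ?_
  gcongr

end Maximal

/-! ### Convergence in probability -/

section InMeasure

variable {Ω ι : Type*} [mΩ : MeasurableSpace Ω] {P : Measure Ω} {l : Filter ι}

/-- Boundedness in probability along a filter. -/
def BoundedInProb (P : Measure Ω) (Y : ι → Ω → ℝ) (l : Filter ι) : Prop :=
  ∀ ε : ENNReal, 0 < ε → ∃ C : ℝ, 0 < C ∧ ∀ᶠ i in l, P {ω | C ≤ |Y i ω|} ≤ ε

lemma tendstoInMeasure_zero_iff {X : ι → Ω → ℝ} :
    TendstoInMeasure P X l (fun _ => 0) ↔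
      ∀ η : ℝ, 0 < η → Tendsto (fun i => P {ω | η ≤ |X i ω|}) l (𝓝 0) := by
  simp [tendstoInMeasure_iff_norm]

/-- Where `|Y| < C`, a product of size `η` forces `|X| ≥ η / C`; the event `|Y| ≥ C` has small
probability, eventually uniformly. -/
lemma tendstoInMeasure_zero_mul {X Y : ι → Ω → ℝ}
    (hX : TendstoInMeasure P X l (fun _ => 0)) (hY : BoundedInProb P Y l) :
    TendstoInMeasure P (fun i ω => X i ω * Y i ω) l (fun _ => 0) := by
  rw [tendstoInMeasure_zero_iff] at hX ⊢
  intro η hη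
  rw [ENNReal.tendsto_nhds_zero]
  intro ε hε
  obtain ⟨C, hC, hYC⟩ := hY (ε / 2) (ENNReal.half_pos hε.ne')
  have h1 := (ENNReal.tendsto_nhds_zero.1 (hX (η / C) (by positivity))) (ε / 2)
    (ENNReal.half_pos hε.ne')
  filter_upwards [hYC, h1] with i h2 h3
  calc P {ω | η ≤ |X i ω * Y i ω|} ≤ P ({ω | η / C ≤ |X i ω|} ∪ {ω | C ≤ |Y i ω|}) := by
        refine measure_mono fun ω hω => ?_
        by_contra hcon
        simp only [Set.mem_union, Set.mem_ofPred_eq, not_or, not_le] at hcon hω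
        rw [abs_mul] at hω
        have : |X i ω| * |Y i ω| ≤ |X i ω| * C :=
          mul_le_mul_of_nonneg_left hcon.2.le (abs_nonneg _)
        have h4 := hcon.1
        rw [lt_div_iff₀ hC] at h4
        linarith
    _ ≤ ε / 2 + ε / 2 := (measure_union_le _ _).trans (add_le_add h3 h2)
    _ = ε := ENNReal.add_halves ε

lemma tendstoInMeasure_zero_add {X Y : ι → Ω → ℝ}
    (hX : TendstoInMeasure P X l (fun _ => 0)) (hY : TendstoInMeasure P Y l (fun _ => 0)) :
    TendstoInMeasure P (fun i ω => X i ω + Y i ω) l (fun _ => 0) := by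
  rw [tendstoInMeasure_zero_iff] at hX hY ⊢
  intro η hη
  have h := (hX (η / 2) (by positivity)).add (hY (η / 2) (by positivity))
  rw [add_zero] at h
  refine tendsto_of_tendsto_of_tendsto_of_le_of_le tendsto_const_nhds h (fun _ => zero_le) ?_
  intro i
  refine (measure_mono ?_).trans (measure_union_le _ _)
  intro ω hω
  by_contra hcon
  simp only [Set.mem_union, Set.mem_ofPred_eq, not_or, not_le] at hcon hω
  have := abs_add_le (X i ω) (Y i ω)
  linarith [hcon.1, hcon.2]

lemma tendstoInMeasure_zero_sum {κ : Type*} (s : Finset κ) {X : κ → ι → Ω → ℝ}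
    (hX : ∀ k ∈ s, TendstoInMeasure P (X k) l (fun _ => 0)) :
    TendstoInMeasure P (fun i ω => ∑ k ∈ s, X k i ω) l (fun _ => 0) := by
  classical
  induction s using Finset.induction_on with
  | empty =>
    rw [tendstoInMeasure_zero_iff]
    intro η hη
    simp [not_le.2 hη, tendsto_const_nhds]
  | insert k s hk ih =>
    simp only [Finset.sum_insert hk]
    exact tendstoInMeasure_zero_add (hX k (Finset.mem_insert_self _ _))
      (ih fun k' hk' => hX k' (Finset.mem_insert_of_mem hk'))

lemma tendstoInMeasure_pi {κ : Type*} [Fintype κ] {X : ι → Ω → κ → ℝ} {c : κ → ℝ}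
    (hX : ∀ k, TendstoInMeasure P (fun i ω => X i ω k) l (fun _ => c k)) :
    TendstoInMeasure P X l (fun _ => c) := by
  simp only [tendstoInMeasure_iff_dist] at hX ⊢
  intro η hη
  have h := tendsto_finsetSum Finset.univ fun k _ => hX k η hη
  simp only [Finset.sum_const_zero] at h
  refine tendsto_of_tendsto_of_tendsto_of_le_of_le tendsto_const_nhds h (fun _ => zero_le) ?_
  intro i
  refine (measure_mono ?_).trans (measure_biUnion_finset_le _ _)
  intro ω hω
  by_contra hcon
  simp only [Set.mem_iUnion, Set.mem_ofPred_eq, Finset.mem_univ, exists_prop, true_and, not_exists,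
    not_le] at hcon hω
  exact absurd hω (not_le.2 ((dist_pi_lt_iff hη).2 hcon))

lemma tendstoInMeasure_prodMk {E F : Type*} [PseudoMetricSpace E] [PseudoMetricSpace F]
    {X : ι → Ω → E} {Y : ι → Ω → F} {c : E} {e : F}
    (hX : TendstoInMeasure P X l (fun _ => c)) (hY : TendstoInMeasure P Y l (fun _ => e)) :
    TendstoInMeasure P (fun i ω => (X i ω, Y i ω)) l (fun _ => (c, e)) := by
  simp only [tendstoInMeasure_iff_dist] at hX hY ⊢
  intro η hη
  have h := (hX η hη).add (hY η hη)
  rw [add_zero] at h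
  refine tendsto_of_tendsto_of_tendsto_of_le_of_le tendsto_const_nhds h (fun _ => zero_le) ?_
  intro i
  refine (measure_mono ?_).trans (measure_union_le _ _)
  intro ω hω
  simpa [Prod.dist_eq] using hω

lemma BoundedInProb.of_tendstoInMeasure_zero {X : ι → Ω → ℝ}
    (hX : TendstoInMeasure P X l (fun _ => 0)) : BoundedInProb P X l := by
  intro ε hε
  exact ⟨1, one_pos, (ENNReal.tendsto_nhds_zero.1 (tendstoInMeasure_zero_iff.1 hX 1 one_pos)) ε hε⟩

lemma BoundedInProb.const (c : ℝ) : BoundedInProb P (fun (_ : ι) _ => c) l := by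
  intro ε hε
  refine ⟨|c| + 1, by positivity, Eventually.of_forall fun i => ?_⟩
  have : {ω : Ω | |c| + 1 ≤ |c|} = ∅ := by ext; simp
  rw [this]; simp

lemma BoundedInProb.add {X Y : ι → Ω → ℝ} (hX : BoundedInProb P X l) (hY : BoundedInProb P Y l) :
    BoundedInProb P (fun i ω => X i ω + Y i ω) l := by
  intro ε hε
  obtain ⟨C, hC, h1⟩ := hX (ε / 2) (ENNReal.half_pos hε.ne')
  obtain ⟨D, hD, h2⟩ := hY (ε / 2) (ENNReal.half_pos hε.ne')
  refine ⟨C + D, by positivity, ?_⟩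
  filter_upwards [h1, h2] with i h1 h2
  calc P {ω | C + D ≤ |X i ω + Y i ω|} ≤ P ({ω | C ≤ |X i ω|} ∪ {ω | D ≤ |Y i ω|}) := by
        refine measure_mono fun ω hω => ?_
        by_contra hcon
        simp only [Set.mem_union, Set.mem_ofPred_eq, not_or, not_le] at hcon hω
        have := abs_add_le (X i ω) (Y i ω)
        linarith [hcon.1, hcon.2]
    _ ≤ ε / 2 + ε / 2 := (measure_union_le _ _).trans (add_le_add h1 h2)
    _ = ε := ENNReal.add_halves ε

/-- Chebyshev's inequality. -/
lemma measure_abs_ge_le_of_sq [IsFiniteMeasure P] {Y : Ω → ℝ}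
    (hY : Integrable (fun ω => Y ω ^ 2) P) {K : ℝ} (hK : 0 < K) :
    P {ω | K ≤ |Y ω|} ≤ ENNReal.ofReal ((∫ ω, Y ω ^ 2 ∂P) / K ^ 2) := by
  have h := mul_meas_ge_le_integral_of_nonneg (ae_of_all _ fun ω => sq_nonneg (Y ω)) hY (K ^ 2)
  have hset : {ω | K ^ 2 ≤ Y ω ^ 2} = {ω | K ≤ |Y ω|} := by
    ext ω
    simp only [Set.mem_ofPred_eq]
    rw [← sq_abs (Y ω), sq_le_sq₀ hK.le (abs_nonneg _)]
  rw [hset] at h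
  rw [← ENNReal.ofReal_toReal (measure_ne_top P {ω | K ≤ |Y ω|})]
  refine ENNReal.ofReal_le_ofReal ?_
  rw [le_div_iff₀ (by positivity), mul_comm]
  exact h

lemma BoundedInProb.of_integral_sq_le [IsFiniteMeasure P] {Y : ι → Ω → ℝ} {B : ℝ}
    (hY : ∀ i, Integrable (fun ω => Y i ω ^ 2) P)
    (hB : ∀ᶠ i in l, ∫ ω, Y i ω ^ 2 ∂P ≤ B) : BoundedInProb P Y l := by
  intro ε hε
  have hlim : Tendsto (fun K : ℝ => ENNReal.ofReal (B / K ^ 2)) atTop (𝓝 0) := by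
    rw [← ENNReal.ofReal_zero]
    refine ENNReal.tendsto_ofReal ?_
    exact Tendsto.div_atTop tendsto_const_nhds (tendsto_pow_atTop (by norm_num))
  obtain ⟨K, hK, hK0⟩ := ((ENNReal.tendsto_nhds_zero.1 hlim ε hε).and
    (eventually_gt_atTop (0 : ℝ))).exists
  refine ⟨K, hK0, ?_⟩
  filter_upwards [hB] with i hi
  refine (measure_abs_ge_le_of_sq (hY i) hK0).trans (le_trans ?_ hK)
  exact ENNReal.ofReal_le_ofReal (by gcongr)

end InMeasure

/-! ### Random indices -/

section RandomIndex

variable {Ω ι : Type*} [mΩ : MeasurableSpace Ω] {P : Measure Ω} {l : Filter ι}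

lemma tendsto_sq_nhdsGT_zero {d : ι → ℝ} (hd : Tendsto d l (𝓝[>] 0)) :
    Tendsto (fun i => d i ^ 2) l (𝓝[>] 0) := by
  rw [tendsto_nhdsWithin_iff] at hd ⊢
  refine ⟨by simpa using hd.1.pow 2, ?_⟩
  filter_upwards [hd.2] with i hi
  exact pow_pos (Set.mem_Ioi.1 hi) 2

lemma tendsto_index_atTop {d : ι → ℝ} {m : ι → ℕ} {c : ℝ} (hc : 0 < c)
    (hd : Tendsto d l (𝓝[>] 0)) (hm : Tendsto (fun i => d i ^ 2 * m i) l (𝓝 c)) :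
    Tendsto m l atTop := by
  have hd2 := tendsto_sq_nhdsGT_zero hd
  rw [← tendsto_natCast_atTop_iff (R := ℝ)]
  refine (Tendsto.pos_mul_atTop hc hm (tendsto_inv_nhdsGT_zero.comp hd2)) |>.congr' ?_
  have hne : ∀ᶠ i in l, d i ^ 2 ∈ Set.Ioi (0 : ℝ) := (tendsto_nhdsWithin_iff.1 hd2).2
  filter_upwards [hne] with i hi
  have : d i ^ 2 ≠ 0 := ne_of_gt hi
  simp only [Function.comp_apply]
  rw [mul_comm (d i ^ 2), mul_assoc, mul_inv_cancel₀ this, mul_one]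

/-- Writing `d² V_m` as `(d² m) · (V_m / m)` turns limits of averages into limits on the scale `d²`.
The values lie in a module so that the lemma serves Gram matrices and accumulated variances alike.
-/
lemma tendsto_sq_smul_of_average {E : Type*} [AddCommGroup E] [Module ℝ E] [TopologicalSpace E]
    [ContinuousSMul ℝ E] {V : ℕ → E} {s : E}
    (hV : Tendsto (fun n : ℕ => (n : ℝ)⁻¹ • V n) atTop (𝓝 s)) {d : ι → ℝ} {m : ι → ℕ} {c : ℝ}
    (hc : 0 < c) (hd : Tendsto d l (𝓝[>] 0)) (hm : Tendsto (fun i => d i ^ 2 * m i) l (𝓝 c)) :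
    Tendsto (fun i => d i ^ 2 • V (m i)) l (𝓝 (c • s)) := by
  have hmt := tendsto_index_atTop hc hd hm
  refine (hm.smul (hV.comp hmt)).congr' ?_
  filter_upwards [hmt.eventually_ge_atTop 1] with i hi
  have : (m i : ℝ) ≠ 0 := by positivity
  simp only [Function.comp_apply, smul_smul]
  congr 1
  field_simp

lemma tendsto_inv_sq_atTop {d : ι → ℝ} (hd : Tendsto d l (𝓝[>] 0)) :
    Tendsto (fun i => (d i ^ 2)⁻¹) l atTop := by
  have hd2 := tendsto_sq_nhdsGT_zero hd
  exact tendsto_inv_nhdsGT_zero.comp hd2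

lemma tendsto_sq_mul_floor {d : ι → ℝ} (hd : Tendsto d l (𝓝[>] 0)) {c : ℝ} (hc : 0 ≤ c) :
    Tendsto (fun i => d i ^ 2 * (⌊c * (d i ^ 2)⁻¹⌋₊ : ℝ)) l (𝓝 c) := by
  refine ((tendsto_nat_floor_mul_div_atTop hc).comp (tendsto_inv_sq_atTop hd)).congr fun i => ?_
  simp only [Function.comp_apply]
  rw [div_inv_eq_mul, mul_comm]

lemma tendsto_sq_mul_ceil {d : ι → ℝ} (hd : Tendsto d l (𝓝[>] 0)) {c : ℝ} (hc : 0 ≤ c) :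
    Tendsto (fun i => d i ^ 2 * (⌈c * (d i ^ 2)⁻¹⌉₊ : ℝ)) l (𝓝 c) := by
  refine ((tendsto_nat_ceil_mul_div_atTop hc).comp (tendsto_inv_sq_atTop hd)).congr fun i => ?_
  simp only [Function.comp_apply]
  rw [div_inv_eq_mul, mul_comm]

/-- **Anscombe's condition** for sums of independent centered variables: a random index
asymptotic to a deterministic one can be replaced by it. -/
theorem tendstoInMeasure_sum_random_index [IsProbabilityMeasure P] {X : ℕ → Ω → ℝ}
    (hm : ∀ i, Measurable (X i)) (hi : iIndepFun X P) (hL : ∀ i, MemLp (X i) 2 P)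
    (h0 : ∀ i, ∫ ω, X i ω ∂P = 0) {s : ℝ}
    (hs : Tendsto (fun n : ℕ => (n : ℝ)⁻¹ • ∑ i ∈ Finset.range n, ∫ ω, X i ω ^ 2 ∂P) atTop (𝓝 s))
    {d : ι → ℝ} (hd : Tendsto d l (𝓝[>] 0)) {c : ℝ} (hc : 0 < c) {N : ι → Ω → ℕ} {n : ι → ℕ}
    (hN : TendstoInMeasure P (fun i ω => d i ^ 2 * (N i ω : ℝ)) l (fun _ => c))
    (hn : Tendsto (fun i => d i ^ 2 * (n i : ℝ)) l (𝓝 c)) :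
    TendstoInMeasure P (fun i ω => d i *
      (∑ k ∈ Finset.range (N i ω), X k ω - ∑ k ∈ Finset.range (n i), X k ω)) l (fun _ => 0) := by
  rw [tendstoInMeasure_zero_iff]
  intro η hη
  rw [ENNReal.tendsto_nhds_zero]
  intro ε hε
  have hs0 : 0 ≤ s := ge_of_tendsto' hs fun n => smul_nonneg (by positivity)
    (Finset.sum_nonneg fun i _ => integral_nonneg fun ω => sq_nonneg _)
  set V : ℕ → ℝ := fun n => ∑ i ∈ Finset.range n, ∫ ω, X i ω ^ 2 ∂P with hV
  -- the half-width of the window around the deterministic index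
  obtain ⟨δ, hδ, hδc, hδε⟩ : ∃ δ : ℝ, 0 < δ ∧ δ < c ∧
      ENNReal.ofReal ((4 * (2 * δ * s) + δ) / η ^ 2) ≤ ε / 2 := by
    have hlim : Tendsto (fun δ : ℝ => ENNReal.ofReal ((4 * (2 * δ * s) + δ) / η ^ 2)) (𝓝[>] 0)
        (𝓝 0) := by
      have : Continuous fun δ : ℝ => ENNReal.ofReal ((4 * (2 * δ * s) + δ) / η ^ 2) :=
        ENNReal.continuous_ofReal.comp (by fun_prop)
      simpa using (this.tendsto 0).mono_left nhdsWithin_le_nhds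
    obtain ⟨δ, h1, h2⟩ := ((ENNReal.tendsto_nhds_zero.1 hlim (ε / 2)
      (ENNReal.half_pos hε.ne')).and (Ioo_mem_nhdsGT hc)).exists
    exact ⟨δ, h2.1, h2.2, h1⟩
  -- The random index lies between `lo` and `hi'` with high probability, and the deterministic one
  -- does so eventually.
  set lo : ι → ℕ := fun i => ⌊(c - δ) * (d i ^ 2)⁻¹⌋₊ with hlo
  set hi' : ι → ℕ := fun i => ⌈(c + δ) * (d i ^ 2)⁻¹⌉₊ with hhi
  have hVlo := tendsto_sq_smul_of_average hs (by linarith : 0 < c - δ) hd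
    (tendsto_sq_mul_floor hd (by linarith : 0 ≤ c - δ))
  have hVhi := tendsto_sq_smul_of_average hs (by linarith : 0 < c + δ) hd
    (tendsto_sq_mul_ceil hd (by linarith : 0 ≤ c + δ))
  have hdiff : Tendsto (fun i => 4 * (d i ^ 2 * (V (hi' i) - V (lo i)))) l
      (𝓝 (4 * (2 * δ * s))) := by
    have := (hVhi.sub hVlo).const_mul 4
    simp only [smul_eq_mul] at this
    convert this using 2
    · ring
    · ring
  have hev1 : ∀ᶠ i in l, 4 * (d i ^ 2 * (V (hi' i) - V (lo i))) ≤ 4 * (2 * δ * s) + δ :=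
    (hdiff.eventually_lt_const (by linarith)).mono fun i h => h.le
  have hev2 : ∀ᶠ i in l, P {ω | δ ≤ |d i ^ 2 * (N i ω : ℝ) - c|} ≤ ε / 2 :=
    (ENNReal.tendsto_nhds_zero.1 (tendstoInMeasure_iff_norm.1 hN δ hδ)) _
      (ENNReal.half_pos hε.ne')
  have hev3 : ∀ᶠ i in l, |d i ^ 2 * (n i : ℝ) - c| < δ := by
    have := Metric.tendsto_nhds.1 hn δ hδ
    simpa [Real.dist_eq] using this
  have hev4 : ∀ᶠ i in l, 0 < d i := (tendsto_nhdsWithin_iff.1 hd).2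
  filter_upwards [hev1, hev2, hev3, hev4] with i h1 h2 h3 h4
  have hd2 : 0 < d i ^ 2 := by positivity
  have hwin : ∀ k : ℕ, |d i ^ 2 * (k : ℝ) - c| < δ → lo i ≤ k ∧ k ≤ hi' i := by
    intro k hk
    rw [abs_lt] at hk
    constructor
    · have : (lo i : ℝ) ≤ k := by
        refine (Nat.floor_le (mul_nonneg (by linarith) (by positivity))).trans ?_
        rw [← div_eq_mul_inv, div_le_iff₀ hd2]
        linarith
      exact_mod_cast this
    · have : (k : ℝ) ≤ hi' i := by
        refine le_trans ?_ (Nat.le_ceil _)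
        rw [← div_eq_mul_inv, le_div_iff₀ hd2]
        linarith
      exact_mod_cast this
  have hlohi : lo i ≤ hi' i := (hwin _ h3).1.trans (hwin _ h3).2
  set Y : ℕ → Ω → ℝ := fun k => X (lo i + k) with hY
  -- Two partial sums within the window differ by `η / d` only if one of them reaches `η / (2 d)`.
  -- By the maximal inequality this has probability at most `4 d² (V hi' - V lo) / η²`, with limit
  -- `4 (2 δ s) / η²`; hence the choice of `δ`, whose additional summand is slack.
  set A := {ω | ∃ k ≤ hi' i - lo i, η / (2 * d i) ≤ |∑ q ∈ Finset.range k, Y q ω|} with hA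
  have hsplit : ∀ k, lo i ≤ k → ∀ ω, ∑ q ∈ Finset.range k, X q ω =
      ∑ q ∈ Finset.range (lo i), X q ω + ∑ q ∈ Finset.range (k - lo i), Y q ω := by
    intro k hk ω
    conv_lhs => rw [← Nat.add_sub_cancel' hk, Finset.sum_range_add]
  have hPA : P A ≤ ε / 2 := by
    refine (kolmogorov_maximal (X := Y) (fun k => hm _)
      (hi.precomp (g := fun k => lo i + k) (add_right_injective _)) (fun k => hL _)
      (fun k => h0 _) (by positivity) _).trans
      (le_trans (ENNReal.ofReal_le_ofReal ?_) hδε)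
    have hsum : ∑ q ∈ Finset.range (hi' i - lo i), ∫ ω, Y q ω ^ 2 ∂P = V (hi' i) - V (lo i) := by
      have := Finset.sum_range_add (fun q => ∫ ω, X q ω ^ 2 ∂P) (lo i) (hi' i - lo i)
      rw [Nat.add_sub_cancel' hlohi] at this
      simp only [hV, hY]
      linarith
    rw [hsum]
    calc (V (hi' i) - V (lo i)) / (η / (2 * d i)) ^ 2
        = 4 * (d i ^ 2 * (V (hi' i) - V (lo i))) / η ^ 2 := by field_simp; ring
      _ ≤ _ := by gcongr
  calc P {ω | η ≤ |d i * (∑ k ∈ Finset.range (N i ω), X k ω - ∑ k ∈ Finset.range (n i), X k ω)|}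
      ≤ P (A ∪ {ω | δ ≤ |d i ^ 2 * (N i ω : ℝ) - c|}) := by
        refine measure_mono fun ω hω => ?_
        by_contra hcon
        simp only [Set.mem_union, not_or, hA, Set.mem_ofPred_eq, not_exists, not_and, not_le]
          at hcon hω
        obtain ⟨w1, w2⟩ := hwin _ hcon.2
        obtain ⟨w3, w4⟩ := hwin _ h3
        have b1 := hcon.1 (N i ω - lo i) (by omega)
        have b2 := hcon.1 (n i - lo i) (by omega)
        rw [hsplit _ w1, hsplit _ w3, abs_mul, abs_of_pos h4, add_sub_add_left_eq_sub] at hω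
        have b3 := abs_sub (∑ q ∈ Finset.range (N i ω - lo i), Y q ω)
          (∑ q ∈ Finset.range (n i - lo i), Y q ω)
        have b4 : |∑ q ∈ Finset.range (N i ω - lo i), Y q ω -
          ∑ q ∈ Finset.range (n i - lo i), Y q ω| < η / d i := by
            have : η / d i = η / (2 * d i) + η / (2 * d i) := by field_simp; ring
            linarith
        rw [lt_div_iff₀ h4] at b4
        linarith
    _ ≤ ε / 2 + ε / 2 := (measure_union_le _ _).trans (add_le_add hPA h2)
    _ = ε := ENNReal.add_halves ε

end RandomIndex

/-! ### A central limit theorem for weighted sums of i.i.d. errors -/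

/-- Independent identically distributed centered errors with variance `σ ^ 2`. -/
structure IsErrorFamily {Ω ι : Type*} [MeasurableSpace Ω] (P : Measure Ω) (σ : ℝ)
    (e : ι → Ω → ℝ) : Prop where
  meas : ∀ k, Measurable (e k)
  indep : iIndepFun e P
  ident : ∀ k k', IdentDistrib (e k) (e k') P P
  memLp : ∀ k, MemLp (e k) 2 P
  mean : ∀ k, ∫ ω, e k ω ∂P = 0
  var : ∀ k, ∫ ω, e k ω ^ 2 ∂P = σ ^ 2

section CLT

/-- Telescoping: the factors are exchanged one at a time, and the untouched ones have norm at most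
one. -/
lemma norm_prod_sub_prod_le_sum {κ : Type*} (s : Finset κ) (f g : κ → ℂ)
    (hf : ∀ i ∈ s, ‖f i‖ ≤ 1) (hg : ∀ i ∈ s, ‖g i‖ ≤ 1) :
    ‖∏ i ∈ s, f i - ∏ i ∈ s, g i‖ ≤ ∑ i ∈ s, ‖f i - g i‖ := by
  classical
  induction s using Finset.induction_on with
  | empty => simp
  | insert k s hk ih =>
    simp only [Finset.prod_insert hk, Finset.sum_insert hk]
    have h1 : ‖∏ i ∈ s, f i‖ ≤ 1 := by
      rw [norm_prod]
      exact Finset.prod_le_one (fun _ _ => norm_nonneg _)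
        fun i hi => hf i (Finset.mem_insert_of_mem hi)
    have h2 := ih (fun i hi => hf i (Finset.mem_insert_of_mem hi))
      (fun i hi => hg i (Finset.mem_insert_of_mem hi))
    have h3 := hg k (Finset.mem_insert_self _ _)
    calc ‖f k * ∏ i ∈ s, f i - g k * ∏ i ∈ s, g i‖
        = ‖(f k - g k) * ∏ i ∈ s, f i + g k * (∏ i ∈ s, f i - ∏ i ∈ s, g i)‖ := by
          congr 1; ring
      _ ≤ ‖f k - g k‖ * ‖∏ i ∈ s, f i‖ + ‖g k‖ * ‖∏ i ∈ s, f i - ∏ i ∈ s, g i‖ := by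
          refine (norm_add_le _ _).trans ?_
          rw [norm_mul, norm_mul]
      _ ≤ ‖f k - g k‖ * 1 + 1 * ‖∏ i ∈ s, f i - ∏ i ∈ s, g i‖ := by gcongr
      _ ≤ _ := by linarith

/-- Products of characteristic functions of a standardized law at asymptotically negligible
arguments. -/
lemma tendsto_prod_of_isLittleO {ι κ : Type*} {l : Filter ι} {ψ : ℝ → ℂ} (hψ : ∀ t, ‖ψ t‖ ≤ 1)
    (ho : (fun t : ℝ => ψ t - Complex.exp (-(t : ℂ) ^ 2 / 2)) =o[𝓝 0] fun t => t ^ 2)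
    {s : ι → Finset κ} {u : ι → κ → ℝ} {L : ℝ}
    (hsum : Tendsto (fun i => ∑ k ∈ s i, u i k ^ 2) l (𝓝 L))
    (hmax : ∀ δ : ℝ, 0 < δ → ∀ᶠ i in l, ∀ k ∈ s i, |u i k| < δ) :
    Tendsto (fun i => ∏ k ∈ s i, ψ (u i k)) l (𝓝 (Complex.exp (-(L : ℂ) / 2))) := by
  have hgauss : Tendsto (fun i => ∏ k ∈ s i, Complex.exp (-(u i k : ℂ) ^ 2 / 2)) l
      (𝓝 (Complex.exp (-(L : ℂ) / 2))) := by
    simp_rw [← Complex.exp_sum]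
    have h1 : Tendsto (fun i => ((∑ k ∈ s i, u i k ^ 2 : ℝ) : ℂ)) l (𝓝 (L : ℂ)) :=
      (Complex.continuous_ofReal.tendsto _).comp hsum
    have h2 : Continuous fun z : ℂ => Complex.exp (-z / 2) := by fun_prop
    refine ((h2.tendsto _).comp h1).congr fun i => ?_
    simp only [Function.comp_apply]
    congr 1
    push_cast
    rw [← Finset.sum_neg_distrib, Finset.sum_div]
  have hexp : ∀ t : ℝ, ‖Complex.exp (-(t : ℂ) ^ 2 / 2)‖ ≤ 1 := by
    intro t
    have : (-(t : ℂ) ^ 2 / 2) = ((-t ^ 2 / 2 : ℝ) : ℂ) := by push_cast; ring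
    rw [this, ← Complex.ofReal_exp, Complex.norm_real, Real.norm_eq_abs, Real.abs_exp]
    exact Real.exp_le_one_iff.2 (by nlinarith [sq_nonneg t])
  -- A limit of sums of squares is nonnegative unless the filter is trivial; this makes the
  -- tolerance `ε / (2 (L + 1))` below positive.
  have hL : 0 ≤ L ∨ l = ⊥ := by
    rcases eq_or_neBot l with h | h
    · exact Or.inr h
    · exact Or.inl (ge_of_tendsto' hsum fun i => Finset.sum_nonneg fun k _ => sq_nonneg _)
  rcases hL with hL | rfl
  swap
  · exact tendsto_bot
  have hdiff : Tendsto (fun i => ∏ k ∈ s i, ψ (u i k) -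
      ∏ k ∈ s i, Complex.exp (-(u i k : ℂ) ^ 2 / 2)) l (𝓝 0) := by
    rw [Metric.tendsto_nhds]
    intro ε hε
    have hc : 0 < ε / (2 * (L + 1)) := by positivity
    have ho' := ho.def hc
    rw [Metric.eventually_nhds_iff] at ho'
    obtain ⟨δ, hδ, hball⟩ := ho'
    filter_upwards [hmax δ hδ, hsum.eventually_lt_const (lt_add_one L)] with i h1 h2
    rw [dist_zero_right]
    calc _ ≤ ∑ k ∈ s i, ‖ψ (u i k) - Complex.exp (-(u i k : ℂ) ^ 2 / 2)‖ :=
          norm_prod_sub_prod_le_sum _ _ _ (fun _ _ => hψ _) (fun _ _ => hexp _)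
      _ ≤ ∑ k ∈ s i, ε / (2 * (L + 1)) * u i k ^ 2 := by
          refine Finset.sum_le_sum fun k hk => ?_
          have := hball (y := u i k) (by simpa using h1 k hk)
          simpa using this
      _ = ε / (2 * (L + 1)) * ∑ k ∈ s i, u i k ^ 2 := by rw [Finset.mul_sum]
      _ ≤ ε / (2 * (L + 1)) * (L + 1) := by gcongr
      _ < ε := by
          have : ε / (2 * (L + 1)) * (L + 1) = ε / 2 := by field_simp
          linarith
  simpa using hdiff.add hgauss

/-- The Taylor expansion of a standardized characteristic function, applied to the Gaussian itself.
It lets the polynomial `1 - t²/2` be traded for the exponential. -/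
lemma gaussian_charFun_isLittleO :
    (fun t : ℝ => ((1 : ℂ) - (t : ℂ) ^ 2 / 2) - Complex.exp (-(t : ℂ) ^ 2 / 2)) =o[𝓝 0]
      fun t => t ^ 2 := by
  have h := taylor_charFun_two (P := gaussianReal 0 1) (X := id) aemeasurable_id
    (by simp) (by simpa [variance_eq_sub IsGaussian.memLp_two_id] using
      (variance_id_gaussianReal (μ := 0) (v := 1)))
  rw [Measure.map_id] at h
  refine h.neg_left.congr_left fun t => ?_
  rw [charFun_gaussianReal]
  simp
  ring_nf

variable {Ω : Type*} [mΩ : MeasurableSpace Ω] {P : Measure Ω} [IsProbabilityMeasure P]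

/-- Weighted sums of i.i.d. errors with asymptotically negligible weights are asymptotically
normal. -/
theorem tendstoInDistribution_weighted_sum {κ E : Type*} [NormedAddCommGroup E]
    [InnerProductSpace ℝ E] [FiniteDimensional ℝ E] [MeasurableSpace E] [BorelSpace E] {σ : ℝ}
    (hσ : 0 < σ) {e : κ → Ω → ℝ} (he : IsErrorFamily P σ e) {s : ℕ → Finset κ}
    {w : ℕ → κ → E}
    (hsum : ∀ t : E, Tendsto (fun i => ∑ k ∈ s i, (inner ℝ (w i k) t) ^ 2) atTop
      (𝓝 (‖t‖ ^ 2 / σ ^ 2)))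
    (hmax : ∀ t : E, ∀ δ : ℝ, 0 < δ → ∀ᶠ i in atTop, ∀ k ∈ s i, |inner ℝ (w i k) t| < δ) :
    TendstoInDistribution (fun i ω => ∑ k ∈ s i, e k ω • w i k) atTop (id : E → E)
      (fun _ => P) (stdGaussian E) where
  forall_aemeasurable i :=
    (Finset.measurable_sum _ fun k _ => (he.meas k).smul_const _).aemeasurable
  aemeasurable_limit := aemeasurable_id
  tendsto := by
    refine ProbabilityMeasure.tendsto_iff_tendsto_charFun.2 fun t => ?_
    simp only [ProbabilityMeasure.coe_mk, Measure.map_id]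
    rw [charFun_stdGaussian]
    -- Without any errors the variance condition forces `t = 0`, where both characteristic functions
    -- equal `1`.
    rcases isEmpty_or_nonempty κ with hκ | ⟨⟨k₀⟩⟩
    · have h0 : ‖t‖ ^ 2 / σ ^ 2 = 0 := by
        refine tendsto_nhds_unique (hsum t) ?_
        have : ∀ i, s i = ∅ := fun i => Finset.eq_empty_of_isEmpty _
        simp [this]
      have ht : ‖t‖ = 0 := by
        rw [div_eq_zero_iff] at h0
        rcases h0 with h0 | h0
        · exact pow_eq_zero_iff (two_ne_zero) |>.1 h0
        · exact absurd h0 (by positivity)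
      have hs0 : ∀ i, s i = ∅ := fun i => Finset.eq_empty_of_isEmpty _
      have htz : t = 0 := norm_eq_zero.1 ht
      subst htz
      have : ∀ i, IsProbabilityMeasure (P.map fun ω => ∑ k ∈ s i, e k ω • w i k) := fun i =>
        Measure.isProbabilityMeasure_map
          (Finset.measurable_sum _ fun k _ => (he.meas k).smul_const _).aemeasurable
      simp
    -- By identical distribution one function `ψ`, that of a standardized error, serves all indices;
    -- the weights enter only through its argument.
    set ψ : ℝ → ℂ := charFun (P.map fun ω => σ⁻¹ * e k₀ ω) with hψ
    have hXm : AEMeasurable (fun ω => σ⁻¹ * e k₀ ω) P := ((he.meas k₀).const_mul _).aemeasurable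
    have : IsProbabilityMeasure (P.map fun ω => σ⁻¹ * e k₀ ω) :=
      Measure.isProbabilityMeasure_map hXm
    have hψo : (fun t : ℝ => ψ t - Complex.exp (-(t : ℂ) ^ 2 / 2)) =o[𝓝 0] fun t => t ^ 2 := by
      have h1 := taylor_charFun_two (P := P) hXm
        (by rw [integral_const_mul, he.mean, mul_zero])
        (by
          simp only [Pi.pow_apply, mul_pow]
          rw [integral_const_mul, he.var]
          field_simp)
      refine (h1.add gaussian_charFun_isLittleO).congr_left fun t => ?_
      ring
    have hchar : ∀ i, charFun (P.map fun ω => ∑ k ∈ s i, e k ω • w i k) t =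
        ∏ k ∈ s i, ψ (σ * inner ℝ (w i k) t) := by
      intro i
      have hind : iIndepFun (fun k ω => e k ω • w i k) P :=
        he.indep.comp (fun k (r : ℝ) => r • w i k) fun k => by fun_prop
      rw [iIndepFun.charFun_map_fun_finsetSum_eq_prod
        (X := fun k ω => e k ω • w i k) (fun k _ => ((he.meas k).smul_const _).aemeasurable)
        (hind.restrict _), Finset.prod_apply]
      refine Finset.prod_congr rfl fun k _ => ?_
      have hlaw : P.map (e k) = P.map (e k₀) := (he.ident k k₀).map_eq
      rw [charFun_apply, integral_map ((he.meas k).smul_const _).aemeasurable (by fun_prop),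
        hψ, charFun_apply_real, integral_map hXm (by fun_prop)]
      have e1 := integral_map (μ := P) (he.meas k).aemeasurable
        (f := fun r : ℝ => Complex.exp ((r * inner ℝ (w i k) t : ℝ) * Complex.I)) (by fun_prop)
      have e2 := integral_map (μ := P) (he.meas k₀).aemeasurable
        (f := fun r : ℝ => Complex.exp ((r * inner ℝ (w i k) t : ℝ) * Complex.I)) (by fun_prop)
      rw [hlaw, e2] at e1
      simp only [real_inner_smul_left]
      rw [← e1]
      congr 1
      ext ω
      congr 2
      push_cast
      have : (σ : ℂ) ≠ 0 := by exact_mod_cast hσ.ne'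
      field_simp
    simp_rw [hchar]
    have hlim := tendsto_prod_of_isLittleO (l := atTop) (s := s) (ψ := ψ)
      (u := fun i k => σ * inner ℝ (w i k) t) (L := ‖t‖ ^ 2)
      (fun t => norm_charFun_le_one t) hψo ?_ ?_
    · simpa using hlim
    · have := (hsum t).const_mul (σ ^ 2)
      rw [mul_div_cancel₀ _ (by positivity)] at this
      refine this.congr fun i => ?_
      rw [Finset.mul_sum]
      simp only [mul_pow]
    · intro δ hδ
      filter_upwards [hmax t (δ / σ) (by positivity)] with i hi k hk
      rw [abs_mul, abs_of_pos hσ, mul_comm, ← lt_div_iff₀ hσ]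
      exact hi k hk

end CLT

/-! ### The minimum eigenvalue -/

section MinEig

variable {p : ℕ}

/-- Each `|v i| |v j|` is at most `v ⬝ᵥ v`. This crude entrywise bound is enough for the continuity
of `minEig`. -/
lemma abs_dotProduct_mulVec_le (A : Matrix (Fin p) (Fin p) ℝ) (v : Fin p → ℝ) :
    |v ⬝ᵥ A *ᵥ v| ≤ (∑ i, ∑ j, |A i j|) * (v ⬝ᵥ v) := by
  have hle : ∀ i j, |v i| * |v j| ≤ v ⬝ᵥ v := by
    intro i j
    have h1 : ∀ k, v k ^ 2 ≤ v ⬝ᵥ v := fun k => by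
      rw [pow_two]
      exact Finset.single_le_sum (f := fun k => v k * v k) (fun k _ => mul_self_nonneg _)
        (Finset.mem_univ k)
    nlinarith [h1 i, h1 j, sq_nonneg (|v i| - |v j|), sq_abs (v i), sq_abs (v j)]
  calc |v ⬝ᵥ A *ᵥ v| = |∑ i, ∑ j, v i * (A i j * v j)| := by
        simp only [dotProduct, Matrix.mulVec, Finset.mul_sum]
    _ ≤ ∑ i, ∑ j, |v i * (A i j * v j)| :=
        (Finset.abs_sum_le_sum_abs _ _).trans
          (Finset.sum_le_sum fun i _ => Finset.abs_sum_le_sum_abs _ _)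
    _ ≤ ∑ i, ∑ j, |A i j| * (v ⬝ᵥ v) := by
        refine Finset.sum_le_sum fun i _ => Finset.sum_le_sum fun j _ => ?_
        rw [abs_mul, abs_mul, mul_left_comm]
        exact mul_le_mul_of_nonneg_left (hle i j) (abs_nonneg _)
    _ = _ := by simp only [Finset.sum_mul]

/-- The variational characterization of the minimum eigenvalue. -/
theorem le_minEig_iff (hp : 0 < p) {A : Matrix (Fin p) (Fin p) ℝ} (hA : A.IsHermitian) (c : ℝ) :
    c ≤ minEig A ↔ ∀ v : Fin p → ℝ, c * (v ⬝ᵥ v) ≤ v ⬝ᵥ A *ᵥ v := by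
  have : Nonempty (Fin p) := ⟨⟨0, hp⟩⟩
  have hmin : c ≤ minEig A ↔ ∀ i, c ≤ hA.eigenvalues i := by
    rw [minEig, hA.spectrum_real_eq_range_eigenvalues]
    exact le_ciInf_iff (Set.finite_range _).bddBelow
  rw [hmin]
  constructor
  · intro h v
    have hB : (A - c • (1 : Matrix (Fin p) (Fin p) ℝ)).IsHermitian :=
      hA.sub (by simp [Matrix.IsHermitian])
    have hpsd : (A - c • (1 : Matrix (Fin p) (Fin p) ℝ)).PosSemidef := by
      rw [hB.posSemidef_iff_eigenvalues_nonneg]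
      intro i
      -- The spectrum of `A - c • 1` is that of `A` shifted by `-c`.
      have hmem : hB.eigenvalues i ∈ spectrum ℝ (A - c • (1 : Matrix (Fin p) (Fin p) ℝ)) := by
        rw [hB.spectrum_real_eq_range_eigenvalues]; exact ⟨i, rfl⟩
      simp only [Pi.zero_apply]
      generalize hB.eigenvalues i = r at hmem ⊢
      rw [← Algebra.algebraMap_eq_smul_one, ← spectrum.sub_singleton_eq,
        hA.spectrum_real_eq_range_eigenvalues] at hmem
      obtain ⟨a, ⟨k, rfl⟩, b, hb, hab⟩ := Set.mem_sub.1 hmem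
      rw [Set.mem_singleton_iff] at hb
      have := h k
      rw [← hab, hb]
      linarith
    have := hpsd.dotProduct_mulVec_nonneg v
    simp only [star_trivial, Matrix.sub_mulVec, dotProduct_sub, Matrix.smul_mulVec,
      Matrix.one_mulVec, dotProduct_smul, smul_eq_mul] at this
    linarith
  · intro h i
    set v : Fin p → ℝ := ⇑(hA.eigenvectorBasis i) with hv
    have hvv : v ⬝ᵥ v = 1 := by
      have h1 := hA.eigenvectorBasis.orthonormal.1 i
      have h2 := real_inner_self_eq_norm_sq (hA.eigenvectorBasis i)
      rw [h1, EuclideanSpace.inner_eq_star_dotProduct] at h2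
      simpa using h2
    have h1 := h v
    rw [hA.mulVec_eigenvectorBasis i, dotProduct_smul, hvv] at h1
    simpa using h1

lemma minEig_pos (hp : 0 < p) {A : Matrix (Fin p) (Fin p) ℝ} (hA : A.PosDef) : 0 < minEig A := by
  have : Nonempty (Fin p) := ⟨⟨0, hp⟩⟩
  rw [minEig, hA.1.spectrum_real_eq_range_eigenvalues]
  obtain ⟨i, hi⟩ := (Set.range_nonempty hA.1.eigenvalues).csInf_mem (Set.finite_range _)
  rw [← hi]
  exact hA.eigenvalues_pos i

/-- Passing from `A` to `B` changes the quadratic form by at most the entrywise distance times `v ⬝ᵥ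
v`, so the variational characterization applies. Used in both directions it gives continuity. -/
lemma minEig_sub_le (hp : 0 < p) {A B : Matrix (Fin p) (Fin p) ℝ} (hA : A.IsHermitian)
    (hB : B.IsHermitian) : minEig A - minEig B ≤ ∑ i, ∑ j, |A i j - B i j| := by
  suffices h : minEig A - ∑ i, ∑ j, |A i j - B i j| ≤ minEig B by linarith
  rw [le_minEig_iff hp hB]
  intro v
  have h1 := (le_minEig_iff hp hA _).1 le_rfl v
  have h2 := abs_dotProduct_mulVec_le (A - B) v
  rw [Matrix.sub_mulVec, dotProduct_sub] at h2
  have h3 := (abs_le.1 h2).2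
  simp only [Matrix.sub_apply] at h3
  linarith

lemma tendsto_minEig (hp : 0 < p) {ι : Type*} {l : Filter ι}
    {A : ι → Matrix (Fin p) (Fin p) ℝ} {S : Matrix (Fin p) (Fin p) ℝ}
    (hA : ∀ i, (A i).IsHermitian) (hS : S.IsHermitian) (h : Tendsto A l (𝓝 S)) :
    Tendsto (fun i => minEig (A i)) l (𝓝 (minEig S)) := by
  have hent : ∀ i j, Tendsto (fun k => A k i j) l (𝓝 (S i j)) := fun i j =>
    (continuous_apply_apply i j).continuousAt.tendsto.comp h
  have h0 : Tendsto (fun k => ∑ i, ∑ j, |A k i j - S i j|) l (𝓝 0) := by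
    have := tendsto_finsetSum Finset.univ fun i _ => tendsto_finsetSum Finset.univ fun j _ =>
      ((hent i j).sub_const (S i j)).abs
    simpa using this
  rw [tendsto_iff_norm_sub_tendsto_zero]
  refine squeeze_zero (fun _ => norm_nonneg _) (fun k => ?_) h0
  rw [Real.norm_eq_abs, abs_sub_le_iff]
  refine ⟨minEig_sub_le hp (hA k) hS, (minEig_sub_le hp hS (hA k)).trans (le_of_eq ?_)⟩
  simp only [abs_sub_comm]

end MinEig

/-! ### Algebra of least squares -/

section LeastSquares

variable {p : ℕ} {x : ℕ → Fin p → ℝ}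

lemma gram_isHermitian (x : ℕ → Fin p → ℝ) (n : ℕ) : (gram x n).IsHermitian := by
  rw [Matrix.IsHermitian, Matrix.conjTranspose_eq_transpose_of_trivial, gram,
    Matrix.transpose_sum]
  exact Finset.sum_congr rfl fun i _ => Matrix.transpose_vecMulVec _ _

lemma dotProduct_gram_mulVec (x : ℕ → Fin p → ℝ) (n : ℕ) (v w : Fin p → ℝ) :
    v ⬝ᵥ gram x n *ᵥ w = ∑ i ∈ Finset.range n, (v ⬝ᵥ x i) * (x i ⬝ᵥ w) := by
  rw [gram, Matrix.sum_mulVec, dotProduct_sum]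
  refine Finset.sum_congr rfl fun i _ => ?_
  rw [Matrix.vecMulVec_mulVec, dotProduct_smul]
  simp

lemma dotProduct_gram_mulVec_self (x : ℕ → Fin p → ℝ) (n : ℕ) (v : Fin p → ℝ) :
    v ⬝ᵥ gram x n *ᵥ v = ∑ i ∈ Finset.range n, (x i ⬝ᵥ v) ^ 2 := by
  rw [dotProduct_gram_mulVec]
  refine Finset.sum_congr rfl fun i _ => ?_
  rw [dotProduct_comm v, pow_two]

lemma gram_posSemidef (x : ℕ → Fin p → ℝ) (n : ℕ) : (gram x n).PosSemidef := by
  refine .of_dotProduct_mulVec_nonneg (gram_isHermitian x n) fun v => ?_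
  rw [star_trivial, dotProduct_gram_mulVec_self]
  exact Finset.sum_nonneg fun _ _ => sq_nonneg _

/-- Later stages add positive semidefinite rank-one terms, so definiteness at `n₀` persists. -/
lemma gram_posDef {n₀ n : ℕ} (h : IsUnit (gram x n₀).det) (hn : n₀ ≤ n) : (gram x n).PosDef := by
  have h0 : (gram x n₀).PosDef :=
    (gram_posSemidef x n₀).posDef_iff_det_ne_zero.2 h.ne_zero
  refine .of_dotProduct_mulVec_pos (gram_isHermitian x n) fun v hv => ?_
  have h1 := h0.dotProduct_mulVec_pos hv
  rw [star_trivial, dotProduct_gram_mulVec_self] at h1 ⊢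
  refine h1.trans_le (Finset.sum_le_sum_of_subset_of_nonneg ?_ fun _ _ _ => sq_nonneg _)
  exact Finset.range_mono hn

lemma smul_gram_isHermitian (x : ℕ → Fin p → ℝ) (n : ℕ) (r : ℝ) :
    (r • gram x n).IsHermitian := by
  rw [Matrix.IsHermitian, Matrix.conjTranspose_smul, gram_isHermitian x n]
  simp

lemma designMinEig_pos (hp : 0 < p) {n₀ n : ℕ} (h : IsUnit (gram x n₀).det) (hn : n₀ ≤ n)
    (hn0 : 0 < n) : 0 < designMinEig x n :=
  minEig_pos hp ((gram_posDef h hn).smul (by positivity))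

/-- The noise vector `∑_{i < n} e_i x_i`. -/
noncomputable def noise (x : ℕ → Fin p → ℝ) (e : ℕ → ℝ) (n : ℕ) : Fin p → ℝ :=
  ∑ i ∈ Finset.range n, e i • x i

variable {y e : ℕ → ℝ} {β₀ : Fin p → ℝ}

lemma lse_eq (hy : ∀ i, y i = x i ⬝ᵥ β₀ + e i) {n : ℕ} (h : IsUnit (gram x n).det) :
    lse x y n = β₀ + (gram x n)⁻¹ *ᵥ noise x e n := by
  have h1 : ∑ i ∈ Finset.range n, y i • x i = gram x n *ᵥ β₀ + noise x e n := by
    rw [gram, Matrix.sum_mulVec, noise, ← Finset.sum_add_distrib]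
    refine Finset.sum_congr rfl fun i _ => ?_
    rw [Matrix.vecMulVec_mulVec, hy, add_smul]
    simp
  rw [lse, h1, Matrix.mulVec_add, Matrix.mulVec_mulVec, Matrix.nonsing_inv_mul _ h,
    Matrix.one_mulVec]

lemma dotProduct_noise (e : ℕ → ℝ) (n : ℕ) (v : Fin p → ℝ) :
    v ⬝ᵥ noise x e n = ∑ i ∈ Finset.range n, (v ⬝ᵥ x i) * e i := by
  rw [noise, dotProduct_sum]
  refine Finset.sum_congr rfl fun i _ => ?_
  rw [dotProduct_smul, smul_eq_mul, mul_comm]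

/-- The residual is `e i - x i ⬝ᵥ v` with `v = G⁻¹ noise`. On expanding, the sum of `(x i ⬝ᵥ v)²` is
`noise ⬝ᵥ v`, and the cross term is minus twice that. -/
lemma sum_sq_residual (hy : ∀ i, y i = x i ⬝ᵥ β₀ + e i) {n : ℕ} (h : IsUnit (gram x n).det) :
    ∑ i ∈ Finset.range n, (y i - x i ⬝ᵥ lse x y n) ^ 2 =
      ∑ i ∈ Finset.range n, e i ^ 2 - noise x e n ⬝ᵥ (gram x n)⁻¹ *ᵥ noise x e n := by
  set v := (gram x n)⁻¹ *ᵥ noise x e n with hv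
  have hGv : gram x n *ᵥ v = noise x e n := by
    rw [hv, Matrix.mulVec_mulVec, Matrix.mul_nonsing_inv _ h, Matrix.one_mulVec]
  have h1 : ∑ i ∈ Finset.range n, (x i ⬝ᵥ v) ^ 2 = noise x e n ⬝ᵥ v := by
    rw [← dotProduct_gram_mulVec_self, hGv, dotProduct_comm]
  have h2 : ∑ i ∈ Finset.range n, (x i ⬝ᵥ v) * e i = noise x e n ⬝ᵥ v := by
    rw [dotProduct_comm, dotProduct_noise]
    simp only [dotProduct_comm]
  have h3 : ∀ i, (y i - x i ⬝ᵥ lse x y n) ^ 2 =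
      e i ^ 2 - 2 * ((x i ⬝ᵥ v) * e i) + (x i ⬝ᵥ v) ^ 2 := by
    intro i
    rw [lse_eq hy h, hy, dotProduct_add, ← hv]
    ring
  simp only [h3, Finset.sum_add_distrib, Finset.sum_sub_distrib, ← Finset.mul_sum, h1, h2]
  ring

lemma varEst_nonneg {n : ℕ} (hn : p ≤ n) : 0 ≤ varEst x y n :=
  div_nonneg (Finset.sum_nonneg fun _ _ => sq_nonneg _)
    (sub_nonneg.2 (by exact_mod_cast hn))

lemma varEst_le (hy : ∀ i, y i = x i ⬝ᵥ β₀ + e i) {n : ℕ} (h : IsUnit (gram x n).det)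
    (hn : p < n) : varEst x y n ≤ (∑ i ∈ Finset.range n, e i ^ 2) / ((n : ℝ) - p) := by
  have hnp : (0 : ℝ) < (n : ℝ) - p := sub_pos.2 (by exact_mod_cast hn)
  rw [varEst, sum_sq_residual hy h]
  gcongr
  have := ((gram_posSemidef x n).inv).dotProduct_mulVec_nonneg (noise x e n)
  rw [star_trivial] at this
  linarith

end LeastSquares

/-! ### Designs satisfying the limit assumption -/

/-- A nonrandom design whose normalized Gram matrices converge, nonsingular from `n₀` on. -/
structure GoodDesign {p : ℕ} (n₀ : ℕ) (S : Matrix (Fin p) (Fin p) ℝ) (x : ℕ → Fin p → ℝ) :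
    Prop where
  tendsto : Tendsto (fun n : ℕ => (n : ℝ)⁻¹ • gram x n) atTop (𝓝 S)
  isUnit : IsUnit (gram x n₀).det

section Design

variable {p n₀ : ℕ} {S : Matrix (Fin p) (Fin p) ℝ} {x : ℕ → Fin p → ℝ}

lemma GoodDesign.isUnit_of_le (h : GoodDesign n₀ S x) {n : ℕ} (hn : n₀ ≤ n) :
    IsUnit (gram x n).det :=
  ((gram_posDef h.isUnit hn).det_pos.ne').isUnit

lemma GoodDesign.tendsto_designMinEig (h : GoodDesign n₀ S x) (hp : 0 < p) (hS : S.PosDef) :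
    Tendsto (fun n => designMinEig x n) atTop (𝓝 (minEig S)) :=
  tendsto_minEig hp (fun n => smul_gram_isHermitian x n _) hS.1 h.tendsto

lemma GoodDesign.tendsto_average_sq (h : GoodDesign n₀ S x) (v : Fin p → ℝ) :
    Tendsto (fun n : ℕ => (n : ℝ)⁻¹ • ∑ i ∈ Finset.range n, (x i ⬝ᵥ v) ^ 2) atTop
      (𝓝 (v ⬝ᵥ S *ᵥ v)) := by
  have hc : Continuous fun A : Matrix (Fin p) (Fin p) ℝ => v ⬝ᵥ A *ᵥ v := by fun_prop
  refine ((hc.tendsto S).comp h.tendsto).congr fun n => ?_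
  simp only [Function.comp_apply]
  rw [Matrix.smul_mulVec, dotProduct_smul, dotProduct_gram_mulVec_self]

/-- The inverse is the adjugate over the determinant; both are continuous in the matrix, and the
limiting determinant is nonzero. -/
lemma tendsto_inv_of_tendsto {ι : Type*} {l : Filter ι} {A : ι → Matrix (Fin p) (Fin p) ℝ}
    {B : Matrix (Fin p) (Fin p) ℝ} (hB : B.PosDef) (h : Tendsto A l (𝓝 B)) :
    Tendsto (fun i => (A i)⁻¹) l (𝓝 B⁻¹) := by
  simp only [Matrix.inv_def, Ring.inverse_eq_inv']
  have hdet : Tendsto (fun i => (A i).det) l (𝓝 B.det) :=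
    ((continuous_id.matrix_det).tendsto B).comp h
  have hadj : Tendsto (fun i => (A i).adjugate) l (𝓝 B.adjugate) :=
    ((continuous_id.matrix_adjugate).tendsto B).comp h
  exact (hdet.inv₀ hB.det_pos.ne').smul hadj

end Design

/-! ### Asymptotics of the stopping time along a sample path -/

section Stopping

/-- Stopping at `N` but not at `N - 1` gives `r N ≤ d² N < r (N - 1) + d²`. Positivity of each `r n`
forces `N → ∞` as `d → 0`, so both outer terms tend to `c`. -/
lemma sInf_stop_tendsto {n₀ : ℕ} {r : ℕ → ℝ} {c : ℝ} (hr : ∀ n, n₀ ≤ n → 0 < r n)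
    (hlim : Tendsto r atTop (𝓝 c)) :
    (∀ d : ℝ, 0 < d → {n | n₀ ≤ n ∧ r n ≤ d ^ 2 * n}.Nonempty) ∧
    Tendsto (fun d : ℝ => d ^ 2 * (sInf {n | n₀ ≤ n ∧ r n ≤ d ^ 2 * n} : ℕ)) (𝓝[>] 0) (𝓝 c) := by
  have hne : ∀ d : ℝ, 0 < d → {n | n₀ ≤ n ∧ r n ≤ d ^ 2 * n}.Nonempty := by
    intro d hd
    have h1 : Tendsto (fun n : ℕ => d ^ 2 * (n : ℝ)) atTop atTop :=
      tendsto_natCast_atTop_atTop.const_mul_atTop (by positivity)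
    obtain ⟨n, hn1, hn2, hn3⟩ := ((hlim.eventually_lt_const (lt_add_one c)).and
      ((h1.eventually_ge_atTop (c + 1)).and (eventually_ge_atTop n₀))).exists
    exact ⟨n, hn3, by linarith⟩
  refine ⟨hne, ?_⟩
  set N : ℝ → ℕ := fun d => sInf {n | n₀ ≤ n ∧ r n ≤ d ^ 2 * n} with hN
  have hd0 : ∀ᶠ d : ℝ in 𝓝[>] 0, 0 < d := eventually_mem_nhdsWithin
  have hsq : Tendsto (fun d : ℝ => d ^ 2) (𝓝[>] 0) (𝓝 0) := by
    simpa using ((continuous_pow 2).tendsto (0 : ℝ)).mono_left nhdsWithin_le_nhds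
  have hmem : ∀ d : ℝ, 0 < d → n₀ ≤ N d ∧ r (N d) ≤ d ^ 2 * N d := fun d hd =>
    Nat.sInf_mem (hne d hd)
  have hNinf : Tendsto N (𝓝[>] 0) atTop := by
    rw [tendsto_atTop]
    intro K
    have hall : ∀ᶠ d : ℝ in 𝓝[>] 0, ∀ n ∈ Finset.Icc n₀ K, d ^ 2 * n < r n := by
      rw [Filter.eventually_all_finset]
      intro n hn
      have : Tendsto (fun d : ℝ => d ^ 2 * n) (𝓝[>] 0) (𝓝 0) := by
        simpa using hsq.mul_const (n : ℝ)
      exact this.eventually_lt_const (hr n (Finset.mem_Icc.1 hn).1)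
    filter_upwards [hall, hd0] with d h1 h2
    by_contra hcon
    have := h1 (N d) (Finset.mem_Icc.2 ⟨(hmem d h2).1, by omega⟩)
    linarith [(hmem d h2).2]
  have hNinf' : Tendsto (fun d => N d - 1) (𝓝[>] 0) atTop := (tendsto_sub_atTop_nat 1).comp hNinf
  have hup : Tendsto (fun d => r (N d - 1) + d ^ 2) (𝓝[>] 0) (𝓝 c) := by
    simpa using (hlim.comp hNinf').add hsq
  refine tendsto_of_tendsto_of_tendsto_of_le_of_le' (hlim.comp hNinf) hup ?_ ?_
  · filter_upwards [hd0] with d hd using (hmem d hd).2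
  -- Since `N > n₀`, stage `N - 1` was admissible and can only have been excluded by the inequality.
  · filter_upwards [hd0, hNinf.eventually_gt_atTop n₀] with d hd hlt
    have hnot : N d - 1 ∉ {n | n₀ ≤ n ∧ r n ≤ d ^ 2 * n} :=
      Nat.notMem_of_lt_sInf (show N d - 1 < N d by omega)
    simp only [Set.mem_ofPred_eq, not_and, not_le] at hnot
    have h1 := hnot (by omega)
    have h2 : ((N d - 1 : ℕ) : ℝ) = (N d : ℝ) - 1 := by
      rw [Nat.cast_sub (by omega)]; simp
    rw [h2] at h1
    linarith

variable {p n₀ : ℕ} {x : ℕ → Fin p → ℝ} {y : ℕ → ℝ}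

lemma stopSet_eq (hpos : ∀ n, n₀ ≤ n → 0 < designMinEig x n) {a : ℝ} (ha : 0 < a) (d : ℝ) :
    stopSet n₀ a d x y = {n | n₀ ≤ n ∧
      a ^ 2 * designMinEig x n * (varEst x y n + 1 / (n : ℝ)) ≤ d ^ 2 * n} := by
  ext n
  simp only [stopSet, Set.mem_ofPred_eq]
  refine and_congr_right fun hn => ?_
  have := hpos n hn
  rw [le_div_iff₀ (by positivity), mul_comm]

/-- Stopping, and the first order asymptotics of the stopping time. -/
theorem stopTime_asymptotics (hp : p < n₀) {a μ v : ℝ} (ha : 0 < a)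
    (hpos : ∀ n, n₀ ≤ n → 0 < designMinEig x n)
    (hμ : Tendsto (fun n => designMinEig x n) atTop (𝓝 μ))
    (hv : Tendsto (fun n => varEst x y n) atTop (𝓝 v)) :
    (∀ d : ℝ, 0 < d → (stopSet n₀ a d x y).Nonempty) ∧
    Tendsto (fun d : ℝ => d ^ 2 * (stopTime n₀ a d x y : ℝ)) (𝓝[>] 0) (𝓝 (a ^ 2 * μ * v)) := by
  simp only [stopTime, stopSet_eq hpos ha]
  refine sInf_stop_tendsto (fun n hn => ?_) ?_
  -- The summand `1 / n` secures positivity even where the residuals vanish.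
  · have h1 := hpos n hn
    have h2 : 0 ≤ varEst x y n := varEst_nonneg (by omega)
    have h3 : (0 : ℝ) < n := by exact_mod_cast (by omega : 0 < n)
    positivity
  · have : Tendsto (fun n : ℕ => varEst x y n + 1 / (n : ℝ)) atTop (𝓝 (v + 0)) :=
      hv.add tendsto_one_div_atTop_nhds_zero_nat
    rw [add_zero] at this
    exact (hμ.const_mul _).mul this

lemma le_stopTime {a d : ℝ} (h : (stopSet n₀ a d x y).Nonempty) : n₀ ≤ stopTime n₀ a d x y :=
  (Nat.sInf_mem h).1

end Stopping

/-! ### Measurability -/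

section Measurability

variable {Ω : Type*} [mΩ : MeasurableSpace Ω] {p : ℕ}

lemma measurable_det {A : Ω → Matrix (Fin p) (Fin p) ℝ} (hA : ∀ i j, Measurable fun ω => A ω i j) :
    Measurable fun ω => (A ω).det := by
  simp only [Matrix.det_apply]
  exact Finset.measurable_sum _ fun τ _ =>
    (Finset.measurable_prod _ fun i _ => hA _ _).const_smul _

lemma measurable_inv_apply {A : Ω → Matrix (Fin p) (Fin p) ℝ}
    (hA : ∀ i j, Measurable fun ω => A ω i j) (i j : Fin p) :
    Measurable fun ω => (A ω)⁻¹ i j := by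
  simp only [Matrix.inv_def, Ring.inverse_eq_inv', Matrix.smul_apply, smul_eq_mul,
    Matrix.adjugate_apply]
  refine (measurable_det hA).inv.mul (measurable_det fun k l => ?_)
  by_cases h : k = j
  · subst h
    simp
  · simpa [Matrix.updateRow_ne h] using hA k l

lemma measurable_mulVec_apply {A : Ω → Matrix (Fin p) (Fin p) ℝ} {v : Ω → Fin p → ℝ}
    (hA : ∀ i j, Measurable fun ω => A ω i j) (hv : ∀ i, Measurable fun ω => v ω i) (i : Fin p) :
    Measurable fun ω => (A ω *ᵥ v ω) i := by
  simp only [Matrix.mulVec, dotProduct]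
  exact Finset.measurable_sum _ fun j _ => (hA i j).mul (hv j)

lemma measurable_dotProduct {v w : Ω → Fin p → ℝ} (hv : ∀ i, Measurable fun ω => v ω i)
    (hw : ∀ i, Measurable fun ω => w ω i) : Measurable fun ω => v ω ⬝ᵥ w ω := by
  simp only [dotProduct]
  exact Finset.measurable_sum _ fun j _ => (hv j).mul (hw j)

/-- The variational condition on a vector is closed in that vector, so a countable dense set of
vectors decides it. -/
lemma measurable_minEig (hp : 0 < p) {A : Ω → Matrix (Fin p) (Fin p) ℝ}
    (hA : ∀ i j, Measurable fun ω => A ω i j) (hH : ∀ ω, (A ω).IsHermitian) :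
    Measurable fun ω => minEig (A ω) := by
  refine measurable_of_Ici fun c => ?_
  have hset : (fun ω => minEig (A ω)) ⁻¹' Set.Ici c = ⋂ k : ℕ, {ω |
      c * (TopologicalSpace.denseSeq (Fin p → ℝ) k ⬝ᵥ TopologicalSpace.denseSeq (Fin p → ℝ) k) ≤
      TopologicalSpace.denseSeq (Fin p → ℝ) k ⬝ᵥ A ω *ᵥ TopologicalSpace.denseSeq (Fin p → ℝ) k} := by
    ext ω
    simp only [Set.mem_preimage, Set.mem_Ici, Set.mem_iInter, Set.mem_ofPred_eq]
    rw [le_minEig_iff hp (hH ω)]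
    refine ⟨fun h k => h _, fun h v => ?_⟩
    refine (TopologicalSpace.denseRange_denseSeq (Fin p → ℝ)).induction_on v ?_ h
    exact isClosed_le (by fun_prop) (by fun_prop)
  rw [hset]
  refine MeasurableSet.iInter fun k => measurableSet_le measurable_const ?_
  exact measurable_dotProduct (fun _ => measurable_const)
    (measurable_mulVec_apply hA fun _ => measurable_const)

lemma measurable_comp_nat {β : Type*} [MeasurableSpace β] {N : Ω → ℕ} (hN : Measurable N)
    {f : ℕ → Ω → β} (hf : ∀ n, Measurable (f n)) : Measurable fun ω => f (N ω) ω := by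
  have : Measurable fun q : ℕ × Ω => f q.1 q.2 := measurable_from_prod_countable_right hf
  exact this.comp (hN.prodMk measurable_id)

/-! ### Measurability for one procedure -/

section Single

variable {x : Ω → ℕ → Fin p → ℝ} {y : Ω → ℕ → ℝ}

lemma measurable_gram_apply {n : ℕ} (hx : ∀ i < n, ∀ k, Measurable fun ω => x ω i k)
    (i j : Fin p) : Measurable fun ω => gram (x ω) n i j := by
  simp only [gram, Matrix.sum_apply, Matrix.vecMulVec_apply]
  exact Finset.measurable_sum _ fun q hq =>
    (hx q (Finset.mem_range.1 hq) i).mul (hx q (Finset.mem_range.1 hq) j)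

lemma measurable_lse_apply {n : ℕ} (hx : ∀ i < n, ∀ k, Measurable fun ω => x ω i k)
    (hy : ∀ i < n, Measurable fun ω => y ω i) (k : Fin p) :
    Measurable fun ω => lse (x ω) (y ω) n k := by
  refine measurable_mulVec_apply (measurable_inv_apply (measurable_gram_apply hx)) (fun k => ?_) k
  simp only [Finset.sum_apply, Pi.smul_apply, smul_eq_mul]
  exact Finset.measurable_sum _ fun q hq =>
    (hy q (Finset.mem_range.1 hq)).mul (hx q (Finset.mem_range.1 hq) k)

lemma measurable_varEst {n : ℕ} (hx : ∀ i < n, ∀ k, Measurable fun ω => x ω i k)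
    (hy : ∀ i < n, Measurable fun ω => y ω i) : Measurable fun ω => varEst (x ω) (y ω) n := by
  refine (Finset.measurable_sum _ fun q hq => ?_).div_const _
  have hq' := Finset.mem_range.1 hq
  exact ((hy q hq').sub (measurable_dotProduct (hx q hq') (measurable_lse_apply hx hy))).pow_const 2

lemma measurable_designMinEig (hp : 0 < p) {n : ℕ}
    (hx : ∀ i < n, ∀ k, Measurable fun ω => x ω i k) :
    Measurable fun ω => designMinEig (x ω) n := by
  refine measurable_minEig hp (fun i j => ?_) fun ω => smul_gram_isHermitian _ _ _
  simp only [Matrix.smul_apply, smul_eq_mul]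
  exact (measurable_gram_apply hx i j).const_mul _

/-- Only data with index below `n` need be measurable, and the σ-algebra is free. For the σ-algebra
of past errors this says that stopping does not look ahead, as Wald's identity requires. -/
lemma measurableSet_mem_stopSet (hp : 0 < p) {n : ℕ} (n₀ : ℕ) (a d : ℝ)
    (hx : ∀ i < n, ∀ k, Measurable fun ω => x ω i k) (hy : ∀ i < n, Measurable fun ω => y ω i) :
    MeasurableSet {ω | n ∈ stopSet n₀ a d (x ω) (y ω)} := by
  have : {ω | n ∈ stopSet n₀ a d (x ω) (y ω)} = {ω | n₀ ≤ n ∧ varEst (x ω) (y ω) n + 1 / (n : ℝ) ≤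
      d ^ 2 * n / (a ^ 2 * designMinEig (x ω) n)} := rfl
  rw [this]
  refine (MeasurableSet.const _).inter (measurableSet_le ((measurable_varEst hx hy).add_const _) ?_)
  exact ((measurable_designMinEig hp hx).const_mul _).const_div _

lemma measurable_stopTime (hp : 0 < p) (n₀ : ℕ) (a d : ℝ)
    (hx : ∀ i k, Measurable fun ω => x ω i k) (hy : ∀ i, Measurable fun ω => y ω i) :
    Measurable fun ω => stopTime n₀ a d (x ω) (y ω) := by
  have hm : ∀ n, MeasurableSet {ω | n ∈ stopSet n₀ a d (x ω) (y ω)} := fun n =>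
    measurableSet_mem_stopSet hp n₀ a d (fun i _ => hx i) (fun i _ => hy i)
  refine measurable_to_countable' fun k => ?_
  -- The second set accounts for `sInf ∅ = 0`: a procedure that never stops is assigned the value
  -- `0`.
  have hset : (fun ω => stopTime n₀ a d (x ω) (y ω)) ⁻¹' {k} =
      ({ω | k ∈ stopSet n₀ a d (x ω) (y ω)} ∩ ⋂ m : ℕ, {ω | m < k → m ∉ stopSet n₀ a d (x ω) (y ω)})
      ∪ ({_ω | k = 0} ∩ ⋂ m : ℕ, {ω | m ∉ stopSet n₀ a d (x ω) (y ω)}) := by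
    ext ω
    simp only [Set.mem_preimage, Set.mem_singleton_iff, Set.mem_union, Set.mem_inter_iff,
      Set.mem_ofPred_eq, Set.mem_iInter, stopTime]
    constructor
    · rintro rfl
      rcases (stopSet n₀ a d (x ω) (y ω)).eq_empty_or_nonempty with h | h
      · right
        simp [h]
      · left
        exact ⟨Nat.sInf_mem h, fun m hm => Nat.notMem_of_lt_sInf hm⟩
    · rintro (⟨h1, h2⟩ | ⟨rfl, h⟩)
      · refine le_antisymm (Nat.sInf_le h1) ?_
        by_contra hcon
        exact h2 _ (not_le.1 hcon) (Nat.sInf_mem ⟨k, h1⟩)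
      · rw [Set.eq_empty_iff_forall_notMem.2 h, Nat.sInf_empty]
  rw [hset]
  refine MeasurableSet.union ((hm k).inter (MeasurableSet.iInter fun m => ?_))
    ((MeasurableSet.const _).inter (MeasurableSet.iInter fun m => (hm m).compl))
  by_cases h : m < k
  · have : {ω | m < k → m ∉ stopSet n₀ a d (x ω) (y ω)} =
        {ω | m ∈ stopSet n₀ a d (x ω) (y ω)}ᶜ := by ext ω; simp [h]
    rw [this]
    exact (hm m).compl
  · simp [h]

end Single

/-! ### Measurability for the combined procedure -/

section Combined

variable {M : ℕ} {x : Ω → Fin M → ℕ → Fin p → ℝ} {y : Ω → Fin M → ℕ → ℝ}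

lemma measurable_totalSize (hp : 0 < p) (n₀ : ℕ) (a : Fin M → ℝ) (d : ℝ)
    (hx : ∀ j i k, Measurable fun ω => x ω j i k) (hy : ∀ j i, Measurable fun ω => y ω j i) :
    Measurable fun ω => totalSize n₀ a d (x ω) (y ω) :=
  Finset.measurable_sum _ fun j _ => measurable_stopTime hp n₀ (a j) d (hx j) (hy j)

lemma measurable_weight (hp : 0 < p) (n₀ : ℕ) (a : Fin M → ℝ) (d : ℝ)
    (hx : ∀ j i k, Measurable fun ω => x ω j i k) (hy : ∀ j i, Measurable fun ω => y ω j i)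
    (j : Fin M) : Measurable fun ω => weight n₀ a d (x ω) (y ω) j :=
  (measurable_from_nat.comp (measurable_stopTime hp n₀ (a j) d (hx j) (hy j))).div
    (measurable_from_nat.comp (measurable_totalSize hp n₀ a d hx hy))

lemma measurable_gram_stopTime_apply (hp : 0 < p) (n₀ : ℕ) (a : Fin M → ℝ) (d : ℝ)
    (hx : ∀ j i k, Measurable fun ω => x ω j i k) (hy : ∀ j i, Measurable fun ω => y ω j i)
    (j : Fin M) (q r : Fin p) :
    Measurable fun ω => gram (x ω j) (stopTime n₀ (a j) d (x ω j) (y ω j)) q r :=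
  measurable_comp_nat (measurable_stopTime hp n₀ (a j) d (hx j) (hy j))
    (f := fun n ω => gram (x ω j) n q r) fun _ => measurable_gram_apply (fun i _ => hx j i) q r

lemma measurable_combinedEst_apply (hp : 0 < p) (n₀ : ℕ) (a : Fin M → ℝ) (d : ℝ)
    (hx : ∀ j i k, Measurable fun ω => x ω j i k) (hy : ∀ j i, Measurable fun ω => y ω j i)
    (q : Fin p) : Measurable fun ω => combinedEst n₀ a d (x ω) (y ω) q := by
  simp only [combinedEst, Finset.sum_apply, Pi.smul_apply, smul_eq_mul]
  refine Finset.measurable_sum _ fun j _ => (measurable_weight hp n₀ a d hx hy j).mul ?_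
  exact measurable_comp_nat (measurable_stopTime hp n₀ (a j) d (hx j) (hy j))
    (f := fun n ω => lse (x ω j) (y ω j) n q)
    fun _ => measurable_lse_apply (fun i _ => hx j i) (fun i _ => hy j i) q

lemma measurable_combinedMinEig (hp : 0 < p) (n₀ : ℕ) (a : Fin M → ℝ) (d : ℝ)
    (hx : ∀ j i k, Measurable fun ω => x ω j i k) (hy : ∀ j i, Measurable fun ω => y ω j i) :
    Measurable fun ω => combinedMinEig n₀ a d (x ω) (y ω) := by
  refine Finset.measurable_sum _ fun j _ => (measurable_weight hp n₀ a d hx hy j).mul ?_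
  exact measurable_comp_nat (measurable_stopTime hp n₀ (a j) d (hx j) (hy j))
    (f := fun n ω => designMinEig (x ω j) n)
    fun _ => measurable_designMinEig hp (fun i _ => hx j i)

lemma measurable_combinedCov_apply (hp : 0 < p) (n₀ : ℕ) (a : Fin M → ℝ) (d : ℝ)
    (hx : ∀ j i k, Measurable fun ω => x ω j i k) (hy : ∀ j i, Measurable fun ω => y ω j i)
    (q r : Fin p) : Measurable fun ω => combinedCov n₀ a d (x ω) (y ω) q r := by
  simp only [combinedCov, Matrix.sum_apply, Matrix.smul_apply, smul_eq_mul]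
  exact Finset.measurable_sum _ fun j _ => ((measurable_weight hp n₀ a d hx hy j).pow_const 2).mul
    (measurable_inv_apply (measurable_gram_stopTime_apply hp n₀ a d hx hy j) q r)

lemma measurableSet_mem_confSet (hp : 0 < p) (n₀ : ℕ) (a : Fin M → ℝ) (d : ℝ)
    (hx : ∀ j i k, Measurable fun ω => x ω j i k) (hy : ∀ j i, Measurable fun ω => y ω j i)
    (z : Fin p → ℝ) : MeasurableSet {ω | z ∈ confSet n₀ a d (x ω) (y ω)} := by
  have hv : ∀ q, Measurable fun ω => (z - combinedEst n₀ a d (x ω) (y ω)) q := fun q =>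
    (measurable_combinedEst_apply hp n₀ a d hx hy q).const_sub (z q)
  refine measurableSet_le (measurable_dotProduct hv (measurable_mulVec_apply
    (measurable_inv_apply (measurable_combinedCov_apply hp n₀ a d hx hy)) hv)) ?_
  exact ((measurable_from_nat.comp (measurable_totalSize hp n₀ a d hx hy)).mul_const _).div
    (measurable_combinedMinEig hp n₀ a d hx hy)

end Combined

end Measurability

/-! ### Strong consistency for a nonrandom design -/

section Consistency

variable {Ω : Type*} [mΩ : MeasurableSpace Ω] {P : Measure Ω} {σ : ℝ}

lemma IsErrorFamily.precomp {ι κ : Type*} {e : ι → Ω → ℝ} (he : IsErrorFamily P σ e) {g : κ → ι}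
    (hg : Function.Injective g) : IsErrorFamily P σ fun k => e (g k) where
  meas _ := he.meas _
  indep := he.indep.precomp hg
  ident _ _ := he.ident _ _
  memLp _ := he.memLp _
  mean _ := he.mean _
  var _ := he.var _

/-! ### Weighted errors and their averages -/

section Weighted

variable {e : ℕ → Ω → ℝ}

lemma IsErrorFamily.measurable_mul (he : IsErrorFamily P σ e) (w : ℕ → ℝ) (i : ℕ) :
    Measurable fun ω => w i * e i ω := (he.meas i).const_mul _

lemma IsErrorFamily.indep_mul (he : IsErrorFamily P σ e) (w : ℕ → ℝ) :
    iIndepFun (fun i ω => w i * e i ω) P :=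
  he.indep.comp (fun i (r : ℝ) => w i * r) fun i => by fun_prop

lemma IsErrorFamily.memLp_mul (he : IsErrorFamily P σ e) (w : ℕ → ℝ) (i : ℕ) :
    MemLp (fun ω => w i * e i ω) 2 P := (he.memLp i).const_mul _

lemma IsErrorFamily.mean_mul (he : IsErrorFamily P σ e) (w : ℕ → ℝ) (i : ℕ) :
    ∫ ω, w i * e i ω ∂P = 0 := by rw [integral_const_mul, he.mean, mul_zero]

lemma IsErrorFamily.var_mul (he : IsErrorFamily P σ e) (w : ℕ → ℝ) (i : ℕ) :
    ∫ ω, (w i * e i ω) ^ 2 ∂P = w i ^ 2 * σ ^ 2 := by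
  simp only [mul_pow]
  rw [integral_const_mul, he.var]

lemma IsErrorFamily.tendsto_average_var (he : IsErrorFamily P σ e) {w : ℕ → ℝ} {s : ℝ}
    (hw : Tendsto (fun n : ℕ => (n : ℝ)⁻¹ • ∑ i ∈ Finset.range n, w i ^ 2) atTop (𝓝 s)) :
    Tendsto (fun n : ℕ => (n : ℝ)⁻¹ • ∑ i ∈ Finset.range n, ∫ ω, (w i * e i ω) ^ 2 ∂P) atTop
      (𝓝 (s * σ ^ 2)) := by
  refine (hw.mul_const (σ ^ 2)).congr fun n => ?_
  simp only [he.var_mul, ← Finset.sum_mul, smul_eq_mul, mul_assoc]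

/-- Convergent averages are bounded, so the accumulated variance grows at most linearly, as the
strong law demands. -/
lemma IsErrorFamily.ae_tendsto_weighted [IsProbabilityMeasure P] (he : IsErrorFamily P σ e) {w : ℕ → ℝ} {s : ℝ}
    (hw : Tendsto (fun n : ℕ => (n : ℝ)⁻¹ • ∑ i ∈ Finset.range n, w i ^ 2) atTop (𝓝 s)) :
    ∀ᵐ ω ∂P, Tendsto (fun n : ℕ => (∑ i ∈ Finset.range n, w i * e i ω) / n) atTop (𝓝 0) := by
  obtain ⟨C, hC⟩ := (he.tendsto_average_var hw).bddAbove_range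
  refine strong_law_of_sum_variance_le (he.measurable_mul w) (he.indep_mul w) (he.memLp_mul w)
    (he.mean_mul w) (C := C) fun n => ?_
  rcases n.eq_zero_or_pos with rfl | hn
  · simp
  have hn' : (0 : ℝ) < n := by exact_mod_cast hn
  have := hC ⟨n, rfl⟩
  simp only [smul_eq_mul] at this
  rw [inv_mul_le_iff₀ hn'] at this
  linarith

lemma IsErrorFamily.ae_tendsto_average_sq (he : IsErrorFamily P σ e) :
    ∀ᵐ ω ∂P, Tendsto (fun n : ℕ => (∑ i ∈ Finset.range n, e i ω ^ 2) / n) atTop (𝓝 (σ ^ 2)) := by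
  have h := strong_law_ae_real (μ := P) (fun i ω => e i ω ^ 2) (he.memLp 0).integrable_sq
    (fun i j hij => (he.indep.indepFun hij).comp (φ := fun r : ℝ => r ^ 2)
      (ψ := fun r : ℝ => r ^ 2) (by fun_prop) (by fun_prop))
    (fun i => (he.ident i 0).comp (u := fun r : ℝ => r ^ 2) (by fun_prop))
  rwa [he.var] at h

end Weighted

variable [IsProbabilityMeasure P] {e : ℕ → Ω → ℝ} {p n₀ : ℕ} {S : Matrix (Fin p) (Fin p) ℝ} {x : ℕ → Fin p → ℝ}

lemma inv_smul_of_isUnit_det {A : Matrix (Fin p) (Fin p) ℝ} (hA : IsUnit A.det) {r : ℝ}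
    (hr : r ≠ 0) : (r • A)⁻¹ = r⁻¹ • A⁻¹ := by
  refine Matrix.inv_eq_right_inv ?_
  rw [Matrix.smul_mul, Matrix.mul_smul, smul_smul, mul_inv_cancel₀ hr, one_smul,
    Matrix.mul_nonsing_inv _ hA]

lemma noise_apply (x : ℕ → Fin p → ℝ) (e : ℕ → ℝ) (n : ℕ) (k : Fin p) :
    noise x e n k = ∑ i ∈ Finset.range n, x i k * e i := by
  simp [noise, mul_comm]

lemma GoodDesign.tendsto_average_sq_apply (h : GoodDesign n₀ S x) (k : Fin p) :
    Tendsto (fun n : ℕ => (n : ℝ)⁻¹ • ∑ i ∈ Finset.range n, (x i k) ^ 2) atTop (𝓝 (S k k)) := by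
  have := h.tendsto_average_sq (Pi.single k 1)
  simpa using this

lemma GoodDesign.ae_tendsto_noise (h : GoodDesign n₀ S x) (he : IsErrorFamily P σ e) :
    ∀ᵐ ω ∂P, Tendsto (fun n : ℕ => (n : ℝ)⁻¹ • noise x (fun i => e i ω) n) atTop (𝓝 0) := by
  have hall : ∀ᵐ ω ∂P, ∀ k : Fin p,
      Tendsto (fun n : ℕ => (∑ i ∈ Finset.range n, x i k * e i ω) / n) atTop (𝓝 0) :=
    ae_all_iff.2 fun k => he.ae_tendsto_weighted (h.tendsto_average_sq_apply k)
  filter_upwards [hall] with ω hω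
  rw [tendsto_pi_nhds]
  intro k
  refine (hω k).congr fun n => ?_
  rw [Pi.smul_apply, noise_apply, smul_eq_mul, div_eq_inv_mul]

/-- Strong consistency of the variance estimate. -/
theorem GoodDesign.ae_tendsto_varEst (h : GoodDesign n₀ S x) (hS : S.PosDef)
    (he : IsErrorFamily P σ e) {y : ℕ → Ω → ℝ} {β₀ : Fin p → ℝ}
    (hy : ∀ i ω, y i ω = x i ⬝ᵥ β₀ + e i ω) :
    ∀ᵐ ω ∂P, Tendsto (fun n => varEst x (fun i => y i ω) n) atTop (𝓝 (σ ^ 2)) := by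
  filter_upwards [h.ae_tendsto_noise he, he.ae_tendsto_average_sq] with ω h1 h2
  have hinv := tendsto_inv_of_tendsto hS h.tendsto
  set S' : ℕ → Fin p → ℝ := fun n => (n : ℝ)⁻¹ • noise x (fun i => e i ω) n with hS'
  -- This is `noise ⬝ᵥ G⁻¹ noise / n`, with the powers of `n` distributed so that every factor
  -- converges, the noise to zero.
  have hquad : Tendsto (fun n : ℕ => S' n ⬝ᵥ ((n : ℝ)⁻¹ • gram x n)⁻¹ *ᵥ S' n) atTop (𝓝 0) := by
    have hc : Continuous fun q : (Fin p → ℝ) × Matrix (Fin p) (Fin p) ℝ =>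
        q.1 ⬝ᵥ q.2 *ᵥ q.1 := by fun_prop
    have := (hc.tendsto (0, S⁻¹)).comp (h1.prodMk_nhds hinv)
    rw [zero_dotProduct] at this
    exact this
  have hratio : Tendsto (fun n : ℕ => (n : ℝ) / ((n : ℝ) - p)) atTop (𝓝 1) := by
    have : Tendsto (fun n : ℕ => (1 - (p : ℝ) / n)⁻¹) atTop (𝓝 ((1 - 0 : ℝ)⁻¹)) :=
      (tendsto_const_nhds.sub (tendsto_const_div_atTop_nhds_zero_nat (p : ℝ))).inv₀ (by simp)
    simp only [sub_zero, inv_one] at this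
    refine this.congr' ?_
    filter_upwards [eventually_gt_atTop p] with n hn
    have hn0 : (n : ℝ) ≠ 0 := by
      have : 0 < n := by omega
      positivity
    have : (n : ℝ) - p ≠ 0 := sub_ne_zero.2 (by exact_mod_cast hn.ne')
    field_simp
  have hlim := hratio.mul (h2.sub hquad)
  simp only [sub_zero, one_mul] at hlim
  refine hlim.congr' ?_
  filter_upwards [eventually_ge_atTop n₀, eventually_gt_atTop p] with n hn hnp
  have hn0 : (n : ℝ) ≠ 0 := by
    have : 0 < n := by omega
    positivity
  have hnp' : (n : ℝ) - p ≠ 0 := sub_ne_zero.2 (by exact_mod_cast hnp.ne')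
  rw [varEst, sum_sq_residual (fun i => hy i ω) (h.isUnit_of_le hn),
    inv_smul_of_isUnit_det (h.isUnit_of_le hn) (inv_ne_zero hn0), hS']
  simp only [Matrix.mulVec_smul, Matrix.smul_mulVec, dotProduct_smul, smul_dotProduct, smul_eq_mul]
  field_simp

/-- Stopping and the first order asymptotics of the stopping time for a nonrandom design. -/
theorem GoodDesign.ae_stopTime (h : GoodDesign n₀ S x) (hp : 0 < p) (hn₀ : p < n₀) (hS : S.PosDef)
    (he : IsErrorFamily P σ e) {y : ℕ → Ω → ℝ} {β₀ : Fin p → ℝ}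
    (hy : ∀ i ω, y i ω = x i ⬝ᵥ β₀ + e i ω) {a : ℝ} (ha : 0 < a) :
    ∀ᵐ ω ∂P, (∀ d : ℝ, 0 < d → (stopSet n₀ a d x (fun i => y i ω)).Nonempty) ∧
      Tendsto (fun d : ℝ => d ^ 2 * (stopTime n₀ a d x (fun i => y i ω) : ℝ)) (𝓝[>] 0)
        (𝓝 (a ^ 2 * minEig S * σ ^ 2)) := by
  filter_upwards [h.ae_tendsto_varEst hS he hy] with ω hω
  exact stopTime_asymptotics hn₀ ha
    (fun n hn => designMinEig_pos hp h.isUnit hn (by omega)) (h.tendsto_designMinEig hp hS) hω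

end Consistency

/-! ### The combined procedure along a sample path -/

section Path

variable {p M n₀ : ℕ} {S : Matrix (Fin p) (Fin p) ℝ} {x : Fin M → ℕ → Fin p → ℝ}
  {y : Fin M → ℕ → ℝ} {a : Fin M → ℝ}

/-- For singular `A` both sides are `0` by the convention for inverses, so scalars can be moved
without checking invertibility. -/
lemma inv_smul_matrix (A : Matrix (Fin p) (Fin p) ℝ) {r : ℝ} (hr : r ≠ 0) :
    (r • A)⁻¹ = r⁻¹ • A⁻¹ := by
  by_cases h : IsUnit A.det
  · exact inv_smul_of_isUnit_det h hr
  · have h0 : A.det = 0 := by simpa using h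
    have h1 : ¬ IsUnit (r • A).det := by simp [h0]
    rw [Matrix.nonsing_inv_apply_not_isUnit _ h, Matrix.nonsing_inv_apply_not_isUnit _ h1,
      smul_zero]

/-- The inverse of `d² X_{j N_j} X_{j N_j}ᵀ`. -/
noncomputable def scaledInvGram (n₀ : ℕ) (a : Fin M → ℝ) (d : ℝ) (x : Fin M → ℕ → Fin p → ℝ)
    (y : Fin M → ℕ → ℝ) (j : Fin M) : Matrix (Fin p) (Fin p) ℝ :=
  (d ^ 2 • gram (x j) (stopTime n₀ (a j) d (x j) (y j)))⁻¹

/-- The combined covariance matrix divided by `d²`. -/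
noncomputable def scaledCov (n₀ : ℕ) (a : Fin M → ℝ) (d : ℝ) (x : Fin M → ℕ → Fin p → ℝ)
    (y : Fin M → ℕ → ℝ) : Matrix (Fin p) (Fin p) ℝ :=
  ∑ j, weight n₀ a d x y j ^ 2 • scaledInvGram n₀ a d x y j

/-- The estimation error of the combined estimate divided by `d`, given the noise at stopping. -/
noncomputable def scaledError (n₀ : ℕ) (a : Fin M → ℝ) (d : ℝ) (x : Fin M → ℕ → Fin p → ℝ)
    (y e : Fin M → ℕ → ℝ) : Fin p → ℝ :=
  ∑ j, (weight n₀ a d x y j • scaledInvGram n₀ a d x y j) *ᵥ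
    (d • noise (x j) (e j) (stopTime n₀ (a j) d (x j) (y j)))

/-- The weights sum to one, so `β₀` can be subtracted inside the weighted sum. The powers of `d` are
then arranged so that the factors of `scaledError` stay of order one. -/
lemma combinedEst_sub (hM : 0 < M) (hn₀ : 0 < n₀)
    (hx : ∀ j, GoodDesign n₀ S (x j)) {e : Fin M → ℕ → ℝ} {β₀ : Fin p → ℝ}
    (hy : ∀ j i, y j i = x j i ⬝ᵥ β₀ + e j i) {d : ℝ} (hd : 0 < d)
    (hfin : ∀ j, (stopSet n₀ (a j) d (x j) (y j)).Nonempty) :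
    combinedEst n₀ a d x y - β₀ = d • scaledError n₀ a d x y e := by
  have hN : ∀ j, n₀ ≤ stopTime n₀ (a j) d (x j) (y j) := fun j => le_stopTime (hfin j)
  have htot : (0 : ℝ) < totalSize n₀ a d x y := by
    have : 0 < totalSize n₀ a d x y :=
      Finset.sum_pos (fun j _ => lt_of_lt_of_le hn₀ (hN j)) ⟨⟨0, hM⟩, Finset.mem_univ _⟩
    exact_mod_cast this
  have hw : ∑ j, weight n₀ a d x y j = 1 := by
    simp only [weight, ← Finset.sum_div]
    rw [div_eq_one_iff_eq htot.ne', totalSize]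
    push_cast
    rfl
  have h1 : combinedEst n₀ a d x y = β₀ + ∑ j, weight n₀ a d x y j •
      (gram (x j) (stopTime n₀ (a j) d (x j) (y j)))⁻¹ *ᵥ
        noise (x j) (e j) (stopTime n₀ (a j) d (x j) (y j)) := by
    have hb : β₀ = ∑ j, weight n₀ a d x y j • β₀ := by rw [← Finset.sum_smul, hw, one_smul]
    conv_rhs => rw [hb, ← Finset.sum_add_distrib]
    refine Finset.sum_congr rfl fun j _ => ?_
    rw [lse_eq (hy j) ((hx j).isUnit_of_le (hN j)), smul_add]
  rw [h1, add_sub_cancel_left, scaledError, Finset.smul_sum]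
  refine Finset.sum_congr rfl fun j _ => ?_
  rw [scaledInvGram, inv_smul_matrix _ (by positivity : d ^ 2 ≠ 0)]
  simp only [Matrix.mulVec_smul, Matrix.smul_mulVec, smul_smul]
  congr 1
  field_simp

/-- The error carries a factor `d` and the covariance a factor `d²`; these cancel in the quadratic
form. -/
lemma mem_confSet_iff (hM : 0 < M) (hn₀ : 0 < n₀)
    (hx : ∀ j, GoodDesign n₀ S (x j)) {e : Fin M → ℕ → ℝ} {β₀ : Fin p → ℝ}
    (hy : ∀ j i, y j i = x j i ⬝ᵥ β₀ + e j i) {d : ℝ} (hd : 0 < d)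
    (hfin : ∀ j, (stopSet n₀ (a j) d (x j) (y j)).Nonempty) :
    β₀ ∈ confSet n₀ a d x y ↔
      scaledError n₀ a d x y e ⬝ᵥ (scaledCov n₀ a d x y)⁻¹ *ᵥ scaledError n₀ a d x y e ≤
        (totalSize n₀ a d x y : ℝ) * d ^ 2 / combinedMinEig n₀ a d x y := by
  have h1 : β₀ - combinedEst n₀ a d x y = -(d • scaledError n₀ a d x y e) := by
    rw [← combinedEst_sub hM hn₀ hx hy hd hfin]; simp
  have h2 : combinedCov n₀ a d x y = d ^ 2 • scaledCov n₀ a d x y := by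
    rw [combinedCov, scaledCov, Finset.smul_sum]
    refine Finset.sum_congr rfl fun j _ => ?_
    rw [scaledInvGram, inv_smul_matrix _ (by positivity : d ^ 2 ≠ 0), smul_smul, smul_smul]
    congr 1
    field_simp
  have h3 : (β₀ - combinedEst n₀ a d x y) ⬝ᵥ
      ((combinedCov n₀ a d x y)⁻¹ *ᵥ (β₀ - combinedEst n₀ a d x y)) =
      scaledError n₀ a d x y e ⬝ᵥ (scaledCov n₀ a d x y)⁻¹ *ᵥ scaledError n₀ a d x y e := by
    rw [h1, h2, inv_smul_matrix _ (by positivity : d ^ 2 ≠ 0)]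
    simp only [Matrix.mulVec_neg, neg_dotProduct, dotProduct_neg, Matrix.mulVec_smul,
      Matrix.smul_mulVec, dotProduct_smul, smul_dotProduct, smul_eq_mul]
    field_simp
  rw [confSet, Set.mem_ofPred_eq, h3]

/-! ### Limits as `d → 0` along a path -/

section Limits

variable {c : Fin M → ℝ}
  (hx : ∀ j, GoodDesign n₀ S (x j)) (hS : S.PosDef) (hc : ∀ j, 0 < c j) (hκ : 0 < ∑ j, c j)
  (hfin : ∀ j, Tendsto (fun d : ℝ => d ^ 2 * (stopTime n₀ (a j) d (x j) (y j) : ℝ)) (𝓝[>] 0)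
    (𝓝 (c j)))

include hfin in
lemma tendsto_totalSize :
    Tendsto (fun d : ℝ => d ^ 2 * (totalSize n₀ a d x y : ℝ)) (𝓝[>] 0) (𝓝 (∑ j, c j)) := by
  refine (tendsto_finsetSum Finset.univ fun j _ => hfin j).congr fun d => ?_
  rw [← Finset.mul_sum, totalSize]
  push_cast
  rfl

include hfin hκ in
lemma tendsto_weight (j : Fin M) :
    Tendsto (fun d : ℝ => weight n₀ a d x y j) (𝓝[>] 0) (𝓝 (c j / ∑ j, c j)) := by
  refine ((hfin j).div (tendsto_totalSize hfin) hκ.ne').congr' ?_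
  filter_upwards [eventually_mem_nhdsWithin] with d hd
  have : d ≠ 0 := ne_of_gt hd
  rw [Pi.div_apply, weight, mul_div_mul_left _ _ (by positivity)]

include hx hS hc hfin in
lemma tendsto_scaledInvGram (j : Fin M) :
    Tendsto (fun d : ℝ => scaledInvGram n₀ a d x y j) (𝓝[>] 0) (𝓝 ((c j)⁻¹ • S⁻¹)) := by
  have h := tendsto_sq_smul_of_average (hx j).tendsto (hc j) (tendsto_id (α := ℝ)) (hfin j)
  have h2 := tendsto_inv_of_tendsto (hS.smul (hc j)) h
  rwa [inv_smul_of_isUnit_det hS.det_pos.ne'.isUnit (hc j).ne'] at h2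

include hx hS hc hκ hfin in
-- The `c j` of the weight cancels the `(c j)⁻¹` of the inverse Gram matrix. The limit is the same
-- for all `j`, which is why the noises may be added before being transformed.
lemma tendsto_weight_smul_scaledInvGram (j : Fin M) :
    Tendsto (fun d : ℝ => weight n₀ a d x y j • scaledInvGram n₀ a d x y j) (𝓝[>] 0)
      (𝓝 ((∑ j, c j)⁻¹ • S⁻¹)) := by
  have h := (tendsto_weight hκ hfin j).smul (tendsto_scaledInvGram hx hS hc hfin j)
  rw [smul_smul] at h
  convert h using 3
  have := (hc j).ne'
  field_simp

include hx hS hc hκ hfin in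
-- With `κ = ∑ c_j` the scalars add up to `∑ (c_j / κ)² c_j⁻¹ = κ⁻¹`.
lemma tendsto_inv_scaledCov :
    Tendsto (fun d : ℝ => (scaledCov n₀ a d x y)⁻¹) (𝓝[>] 0) (𝓝 ((∑ j, c j) • S)) := by
  have h : Tendsto (fun d : ℝ => scaledCov n₀ a d x y) (𝓝[>] 0) (𝓝 ((∑ j, c j)⁻¹ • S⁻¹)) := by
    have := tendsto_finsetSum Finset.univ fun j _ =>
      ((tendsto_weight hκ hfin j).pow 2).smul (tendsto_scaledInvGram hx hS hc hfin j)
    have h1 : ∀ j, (c j / ∑ j, c j) ^ 2 * (c j)⁻¹ = c j * ((∑ j, c j) ^ 2)⁻¹ := by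
      intro j
      have := (hc j).ne'
      field_simp
    have h3 : ∑ j, (c j / ∑ j, c j) ^ 2 • (c j)⁻¹ • S⁻¹ = (∑ j, c j)⁻¹ • S⁻¹ := by
      simp only [smul_smul, h1, ← Finset.sum_smul, ← Finset.sum_mul]
      congr 1
      field_simp
    rw [h3] at this
    exact this
  have h2 := tendsto_inv_of_tendsto (hS.inv.smul (inv_pos.2 hκ)) h
  rwa [inv_smul_of_isUnit_det hS.inv.det_pos.ne'.isUnit (inv_pos.2 hκ).ne', inv_inv,
    Matrix.nonsing_inv_nonsing_inv _ hS.det_pos.ne'.isUnit] at h2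

include hx hS hc hκ hfin in
-- The combined minimum eigenvalue averages quantities that all tend to `minEig S`, because every
-- stopping time tends to infinity.
lemma tendsto_threshold (hp : 0 < p) :
    Tendsto (fun d : ℝ => (totalSize n₀ a d x y : ℝ) * d ^ 2 / combinedMinEig n₀ a d x y)
      (𝓝[>] 0) (𝓝 ((∑ j, c j) / minEig S)) := by
  have h : Tendsto (fun d : ℝ => combinedMinEig n₀ a d x y) (𝓝[>] 0) (𝓝 (minEig S)) := by
    have := tendsto_finsetSum Finset.univ fun j _ => (tendsto_weight hκ hfin j).mul
      (((hx j).tendsto_designMinEig hp hS).comp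
        (tendsto_index_atTop (hc j) (tendsto_id (α := ℝ)) (hfin j)))
    rw [← Finset.sum_mul, ← Finset.sum_div, div_self hκ.ne', one_mul] at this
    exact this
  refine ((tendsto_totalSize hfin).div h (minEig_pos hp hS).ne').congr fun d => ?_
  rw [Pi.div_apply, mul_comm]

end Limits

end Path

/-! ### Deterministic sample sizes -/

section Deterministic

/-- The index set `{(j, i) | i < n j}`. -/
def indexSet {M : ℕ} (n : Fin M → ℕ) : Finset (Fin M × ℕ) :=
  (Finset.univ ×ˢ Finset.range (∑ j, n j)).filter fun q => q.2 < n q.1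

lemma mem_indexSet {M : ℕ} {n : Fin M → ℕ} {q : Fin M × ℕ} : q ∈ indexSet n ↔ q.2 < n q.1 := by
  simp only [indexSet, Finset.mem_filter, Finset.mem_product, Finset.mem_univ, Finset.mem_range,
    true_and, and_iff_right_iff_imp]
  intro h
  exact h.trans_le (Finset.single_le_sum (f := n) (fun _ _ => Nat.zero_le _) (Finset.mem_univ _))

lemma sum_indexSet {M : ℕ} {E : Type*} [AddCommMonoid E] (n : Fin M → ℕ) (f : Fin M × ℕ → E) :
    ∑ q ∈ indexSet n, f q = ∑ j, ∑ i ∈ Finset.range (n j), f (j, i) :=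
  Finset.sum_finset_product _ _ _ fun q => by simp [mem_indexSet]

/-- `b n / n` is the difference of consecutive averages up to a factor tending to one, hence
vanishes; the finitely many early terms are eventually below `δ n`. This supplies the negligibility
of single summands in the central limit theorem. -/
lemma eventually_forall_lt_le_of_average {b : ℕ → ℝ} {s : ℝ} (hb : ∀ i, 0 ≤ b i)
    (h : Tendsto (fun n : ℕ => (n : ℝ)⁻¹ • ∑ i ∈ Finset.range n, b i) atTop (𝓝 s)) {δ : ℝ}
    (hδ : 0 < δ) : ∀ᶠ n : ℕ in atTop, ∀ i < n, b i ≤ δ * n := by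
  have hbn : Tendsto (fun n : ℕ => (n : ℝ)⁻¹ * b n) atTop (𝓝 0) := by
    have h1 := (h.comp (tendsto_add_atTop_nat 1)).mul
      ((tendsto_const_nhds (x := (1 : ℝ))).add tendsto_one_div_atTop_nhds_zero_nat)
    have h2 := h1.sub h
    simp only [add_zero, mul_one, sub_self] at h2
    refine h2.congr' ?_
    filter_upwards [eventually_gt_atTop 0] with n hn
    have : (n : ℝ) ≠ 0 := by positivity
    have : (n : ℝ) + 1 ≠ 0 := by positivity
    simp only [Function.comp_apply, smul_eq_mul, Finset.sum_range_succ]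
    push_cast
    field_simp
    ring
  obtain ⟨I, hI⟩ := eventually_atTop.1 ((hbn.eventually_lt_const hδ).and (eventually_gt_atTop 0))
  have h3 : Tendsto (fun n : ℕ => δ * (n : ℝ)) atTop atTop :=
    tendsto_natCast_atTop_atTop.const_mul_atTop hδ
  filter_upwards [h3.eventually_ge_atTop (∑ i ∈ Finset.range I, b i)] with n hn i hin
  rcases lt_or_ge i I with hlt | hge
  · exact (Finset.single_le_sum (fun i _ => hb i) (Finset.mem_range.2 hlt)).trans hn
  · obtain ⟨h4, h5⟩ := hI i hge
    have h5' : (0 : ℝ) < i := by exact_mod_cast h5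
    rw [inv_mul_lt_iff₀ h5'] at h4
    have : (i : ℝ) ≤ n := by exact_mod_cast hin.le
    nlinarith

end Deterministic

/-! ### The limit law -/

section Sphere

/-- With the other coordinates fixed, the equation allows at most two values of the first, a
Gaussian null set. It makes the boundary of the limiting coverage event null. -/
lemma pi_gaussian_sum_sq_eq (p : ℕ) (hp : 0 < p) (r : ℝ) :
    Measure.pi (fun _ : Fin p => gaussianReal 0 1) {z | ∑ k, z k ^ 2 = r} = 0 := by
  obtain ⟨q, rfl⟩ : ∃ q, p = q + 1 := ⟨p - 1, by omega⟩
  have hmp := measurePreserving_piFinSuccAbove (fun _ : Fin (q + 1) => gaussianReal 0 1) 0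
  set s : Set (ℝ × (Fin q → ℝ)) := {w | w.1 ^ 2 + ∑ k, w.2 k ^ 2 = r} with hs
  have hsm : MeasurableSet s := measurableSet_eq_fun (by fun_prop) (by fun_prop)
  have hpre : {z : Fin (q + 1) → ℝ | ∑ k, z k ^ 2 = r} =
      (MeasurableEquiv.piFinSuccAbove (fun _ => ℝ) 0) ⁻¹' s := by
    ext z
    simp [hs, Fin.sum_univ_succ, MeasurableEquiv.piFinSuccAbove, Fin.insertNthEquiv,
      Fin.tail]
  rw [hpre, hmp.measure_preimage hsm.nullMeasurableSet, Measure.prod_apply_symm hsm]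
  refine (lintegral_eq_zero_iff' ?_).2 ?_
  · exact (measurable_measure_prodMk_right hsm).aemeasurable
  · refine ae_of_all _ fun w => ?_
    have := nullSingletonClass_gaussianReal (μ := 0) (v := 1) one_ne_zero
    have hsub : ((fun z : ℝ => (z, w)) ⁻¹' s) ⊆
        {√(r - ∑ k, w k ^ 2), -√(r - ∑ k, w k ^ 2)} := by
      intro z hz
      simp only [hs, Set.mem_preimage, Set.mem_ofPred_eq] at hz
      have h1 : r - ∑ k, w k ^ 2 = z ^ 2 := by linarith
      rw [h1, Real.sqrt_sq_eq_abs]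
      rcases abs_choice z with h | h <;> simp [h]
    exact measure_mono_null hsub ((Set.toFinite _).measure_zero _)

lemma stdGaussian_norm_sq_eq (p : ℕ) (hp : 0 < p) (r : ℝ) :
    stdGaussian (EuclideanSpace ℝ (Fin p)) {w | ‖w‖ ^ 2 = r} = 0 := by
  rw [← map_pi_eq_stdGaussian, Measure.map_apply (by fun_prop)
    (measurableSet_eq_fun (by fun_prop) (by fun_prop))]
  simpa [EuclideanSpace.real_norm_sq_eq] using pi_gaussian_sum_sq_eq p hp r

lemma stdGaussian_norm_sq_le (p : ℕ) (r : ℝ) :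
    stdGaussian (EuclideanSpace ℝ (Fin p)) {w | ‖w‖ ^ 2 ≤ r} = chiSquare p (Set.Iic r) := by
  rw [← map_pi_eq_stdGaussian, Measure.map_apply (by fun_prop)
    (measurableSet_le (by fun_prop) (by fun_prop)), chiSquare, Measure.map_apply (by fun_prop)
    measurableSet_Iic]
  congr 1
  ext z
  simp [EuclideanSpace.real_norm_sq_eq]

end Sphere

/-! ### Asymptotic coverage for nonrandom designs -/

section Coverage

open scoped MatrixOrder Matrix.Norms.L2Operator in
-- The factor `B` standardizes the noise in the central limit theorem.
lemma exists_eq_transpose_mul_self {p : ℕ} {S : Matrix (Fin p) (Fin p) ℝ} (hS : S.PosDef) :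
    ∃ B : Matrix (Fin p) (Fin p) ℝ, IsUnit B.det ∧ S = Bᵀ * B := by
  obtain ⟨B, hB⟩ := CStarAlgebra.nonneg_iff_eq_star_mul_self.mp hS.posSemidef.nonneg
  rw [Matrix.star_eq_conjTranspose, Matrix.conjTranspose_eq_transpose_of_trivial] at hB
  refine ⟨B, ?_, hB⟩
  have h := hS.det_pos
  rw [hB, Matrix.det_mul, Matrix.det_transpose] at h
  exact (show B.det ≠ 0 from fun h0 => by simp [h0] at h).isUnit

variable {Ω : Type*} [mΩ : MeasurableSpace Ω] {P : Measure Ω} [IsProbabilityMeasure P] {σ : ℝ}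
  {p M n₀ : ℕ} {S : Matrix (Fin p) (Fin p) ℝ} {x : Fin M → ℕ → Fin p → ℝ}
  {e : Fin M × ℕ → Ω → ℝ} {c : Fin M → ℝ}

/-- Asymptotic normality of the standardized total noise at deterministic sample sizes. -/
lemma tendstoInDistribution_total_noise (hσ : 0 < σ) (hx : ∀ j, GoodDesign n₀ S (x j))
    (he : IsErrorFamily P σ e) {B : Matrix (Fin p) (Fin p) ℝ} (hB : IsUnit B.det)
    (hSB : S = Bᵀ * B) (hc : ∀ j, 0 < c j) (hκ : 0 < ∑ j, c j) {τ : ℝ}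
    (hτ : τ ^ 2 = σ ^ 2 * ∑ j, c j) {d : ℕ → ℝ} (hd : Tendsto d atTop (𝓝[>] 0))
    {n : ℕ → Fin M → ℕ} (hn : ∀ j, Tendsto (fun k => d k ^ 2 * (n k j : ℝ)) atTop (𝓝 (c j))) :
    TendstoInDistribution (fun k ω => WithLp.toLp 2 ((τ⁻¹ • (B⁻¹)ᵀ) *ᵥ
        ∑ j, d k • noise (x j) (fun i => e (j, i) ω) (n k j))) atTop
      (id : EuclideanSpace ℝ (Fin p) → EuclideanSpace ℝ (Fin p)) (fun _ => P)
      (stdGaussian (EuclideanSpace ℝ (Fin p))) := by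
  set L : Matrix (Fin p) (Fin p) ℝ := τ⁻¹ • (B⁻¹)ᵀ with hL
  set w : ℕ → Fin M × ℕ → EuclideanSpace ℝ (Fin p) := fun k q =>
    WithLp.toLp 2 (d k • L *ᵥ x q.1 q.2) with hw
  have hinner : ∀ k q (t : EuclideanSpace ℝ (Fin p)), inner ℝ (w k q) t =
      d k * (x q.1 q.2 ⬝ᵥ Lᵀ *ᵥ t.ofLp) := by
    intro k q t
    rw [EuclideanSpace.inner_eq_star_dotProduct]
    simp only [hw, star_trivial]
    rw [dotProduct_smul, smul_eq_mul, dotProduct_comm, Matrix.dotProduct_mulVec,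
      Matrix.vecMul_transpose]
  -- Since `B Lᵀ = τ⁻¹`, the map `L` turns the covariance `τ² S` into the identity; `σ²` is divided
  -- out because the error variance is not part of the weights.
  have hquad : ∀ t : EuclideanSpace ℝ (Fin p),
      (∑ j, c j) * ((Lᵀ *ᵥ t.ofLp) ⬝ᵥ S *ᵥ (Lᵀ *ᵥ t.ofLp)) = ‖t‖ ^ 2 / σ ^ 2 := by
    intro t
    have hBL : B *ᵥ (Lᵀ *ᵥ t.ofLp) = τ⁻¹ • t.ofLp := by
      rw [hL, Matrix.transpose_smul, Matrix.transpose_transpose, Matrix.smul_mulVec,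
        Matrix.mulVec_smul, Matrix.mulVec_mulVec, Matrix.mul_nonsing_inv _ hB, Matrix.one_mulVec]
    have h1 : (Lᵀ *ᵥ t.ofLp) ⬝ᵥ S *ᵥ (Lᵀ *ᵥ t.ofLp) =
        (B *ᵥ (Lᵀ *ᵥ t.ofLp)) ⬝ᵥ (B *ᵥ (Lᵀ *ᵥ t.ofLp)) := by
      rw [hSB, ← Matrix.mulVec_mulVec, Matrix.dotProduct_mulVec, Matrix.vecMul_transpose]
    have h2 : t.ofLp ⬝ᵥ t.ofLp = ‖t‖ ^ 2 := by
      rw [EuclideanSpace.real_norm_sq_eq]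
      simp [dotProduct, pow_two]
    rw [h1, hBL, smul_dotProduct, dotProduct_smul, h2, smul_eq_mul, smul_eq_mul]
    have h3 : τ⁻¹ * τ⁻¹ = (σ ^ 2 * ∑ j, c j)⁻¹ := by rw [← hτ, pow_two, mul_inv]
    rw [← mul_assoc τ⁻¹, h3]
    field_simp
  have hcl := tendstoInDistribution_weighted_sum (P := P) hσ he
    (s := fun k => indexSet (n k)) (w := w) ?_ ?_
  · refine hcl.congr (fun k => ae_of_all _ fun ω => ?_) (ae_eq_refl _)
    simp only [sum_indexSet]
    ext r
    simp only [hw, WithLp.ofLp_sum, WithLp.ofLp_smul, noise, Matrix.mulVec_sum,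
      Matrix.mulVec_smul, Finset.smul_sum, Finset.sum_apply, Pi.smul_apply, smul_eq_mul]
    refine Finset.sum_congr rfl fun j _ => Finset.sum_congr rfl fun i _ => ?_
    ring
  · intro t
    simp only [hinner, sum_indexSet]
    rw [← hquad t]
    have h1 := tendsto_finsetSum Finset.univ fun j _ =>
      tendsto_sq_smul_of_average ((hx j).tendsto_average_sq (Lᵀ *ᵥ t.ofLp)) (hc j) hd (hn j)
    simp only [smul_eq_mul, ← Finset.sum_mul] at h1
    refine h1.congr fun k => ?_
    refine Finset.sum_congr rfl fun j _ => ?_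
    rw [Finset.mul_sum]
    simp only [mul_pow]
  · intro t δ hδ
    have hj : ∀ j, ∀ᶠ k in atTop, ∀ i < n k j, |d k * (x j i ⬝ᵥ Lᵀ *ᵥ t.ofLp)| < δ := by
      intro j
      -- Eventually `d² n_j < c j + 1`, so the bound `η n_j` on the squares becomes less than `δ²`
      -- after scaling by `d²`.
      set η : ℝ := δ ^ 2 / (c j + 1) with hη
      have hcj := hc j
      have h1 := eventually_forall_lt_le_of_average (fun i => sq_nonneg _)
        ((hx j).tendsto_average_sq (Lᵀ *ᵥ t.ofLp)) (by positivity : 0 < η)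
      filter_upwards [(tendsto_index_atTop (hc j) hd (hn j)).eventually h1,
        (hn j).eventually_lt_const (lt_add_one _)] with k h2 h3 i hi
      have h4 := h2 i hi
      refine abs_lt_of_sq_lt_sq ?_ hδ.le
      rw [mul_pow]
      calc d k ^ 2 * (x j i ⬝ᵥ Lᵀ *ᵥ t.ofLp) ^ 2 ≤ d k ^ 2 * (η * n k j) := by gcongr
        _ = η * (d k ^ 2 * n k j) := by ring
        _ < η * (c j + 1) := by gcongr
        _ = δ ^ 2 := by rw [hη]; field_simp
    filter_upwards [eventually_all.2 hj] with k hk q hq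
    rw [hinner]
    exact hk q.1 q.2 (mem_indexSet.1 hq)

/-- The second moments converge, hence are eventually bounded, and Chebyshev's inequality applies.
-/
lemma boundedInProb_noise {x₁ : ℕ → Fin p → ℝ} (hx : GoodDesign n₀ S x₁) {e₁ : ℕ → Ω → ℝ}
    (he : IsErrorFamily P σ e₁) {c₁ : ℝ} (hc : 0 < c₁) {d : ℕ → ℝ}
    (hd : Tendsto d atTop (𝓝[>] 0)) {n : ℕ → ℕ}
    (hn : Tendsto (fun k => d k ^ 2 * (n k : ℝ)) atTop (𝓝 c₁)) (r : Fin p) :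
    BoundedInProb P (fun k ω => d k * noise x₁ (fun i => e₁ i ω) (n k) r) atTop := by
  set w : ℕ → ℝ := fun i => x₁ i r
  have hsq : ∀ k, (fun ω => (d k * noise x₁ (fun i => e₁ i ω) (n k) r) ^ 2) =
      fun ω => d k ^ 2 * (∑ i ∈ Finset.range (n k), w i * e₁ i ω) ^ 2 := by
    intro k
    ext ω
    rw [noise_apply, mul_pow]
  have hlim := tendsto_sq_smul_of_average (he.tendsto_average_var
    (hx.tendsto_average_sq_apply r)) hc hd hn
  refine BoundedInProb.of_integral_sq_le (B := c₁ • (S r r * σ ^ 2) + 1) (fun k => ?_) ?_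
  · rw [hsq]
    exact (memLp_two_sum (he.memLp_mul w) _).integrable_sq.const_mul _
  · filter_upwards [hlim.eventually_lt_const (lt_add_one _)] with k hk
    rw [hsq, integral_const_mul, integral_sq_sum_range (he.indep_mul w) (he.memLp_mul w)
      (he.mean_mul w)]
    exact hk.le

end Coverage

/-! ### From the total noise to the coverage probability -/

section CoverageLimit

variable {Ω : Type*} [mΩ : MeasurableSpace Ω] {P : Measure Ω} [IsProbabilityMeasure P] {σ : ℝ}
  {p M n₀ : ℕ} {S : Matrix (Fin p) (Fin p) ℝ} {x : Fin M → ℕ → Fin p → ℝ}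
  {e : Fin M × ℕ → Ω → ℝ} {y : Fin M → ℕ → Ω → ℝ} {a : Fin M → ℝ} {β₀ : Fin p → ℝ}

omit [IsProbabilityMeasure P] in
lemma IsErrorFamily.procedure (he : IsErrorFamily P σ e) (j : Fin M) :
    IsErrorFamily P σ fun i => e (j, i) :=
  he.precomp (g := fun i => (j, i)) fun i i' h => by simpa using h

omit [IsProbabilityMeasure P] in
lemma measurable_response (he : IsErrorFamily P σ e)
    (hy : ∀ j i ω, y j i ω = x j i ⬝ᵥ β₀ + e (j, i) ω) (j : Fin M) (i : ℕ) :
    Measurable fun ω => y j i ω := by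
  simp only [hy]
  exact (he.meas _).const_add _

/-- A sequence version of: almost sure convergence as `d → 0` gives convergence in probability. -/
lemma tendstoInMeasure_of_ae_nhdsGT {f : ℝ → Ω → ℝ} {c : ℝ} (hf : ∀ d, Measurable (f d))
    (h : ∀ᵐ ω ∂P, Tendsto (fun d => f d ω) (𝓝[>] 0) (𝓝 c)) {d : ℕ → ℝ}
    (hd : Tendsto d atTop (𝓝[>] 0)) :
    TendstoInMeasure P (fun k ω => f (d k) ω) atTop (fun _ => c) :=
  tendstoInMeasure_of_tendsto_ae (fun _ => (hf _).aestronglyMeasurable)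
    (h.mono fun _ hω => hω.comp hd)

omit [IsProbabilityMeasure P] in
lemma tendstoInMeasure_sub_const {f : ℕ → Ω → ℝ} {c : ℝ}
    (h : TendstoInMeasure P f atTop (fun _ => c)) :
    TendstoInMeasure P (fun k ω => f k ω - c) atTop (fun _ => 0) := by
  rw [tendstoInMeasure_iff_norm] at h ⊢
  simpa using h

omit [IsProbabilityMeasure P] in
-- With `C` the random coefficient and `U` the noise at stopping, `C U - A V = (C - A)(V + (U - V))
-- + A (U - V)`. In the application `C - A` and `U - V` are negligible and `V` is bounded in
-- probability.
lemma scaledError_sub_apply (n₀ : ℕ) (a : Fin M → ℝ) (d : ℝ) (x : Fin M → ℕ → Fin p → ℝ)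
    (y e : Fin M → ℕ → ℝ) (A : Matrix (Fin p) (Fin p) ℝ) (V : Fin M → Fin p → ℝ) (q : Fin p) :
    (scaledError n₀ a d x y e - A *ᵥ ∑ j, V j) q = ∑ j, ∑ r,
      (((weight n₀ a d x y j • scaledInvGram n₀ a d x y j) q r - A q r) *
        (V j r + (d * noise (x j) (e j) (stopTime n₀ (a j) d (x j) (y j)) r - V j r)) +
      (d * noise (x j) (e j) (stopTime n₀ (a j) d (x j) (y j)) r - V j r) * A q r) := by
  rw [Matrix.mulVec_sum, scaledError, ← Finset.sum_sub_distrib, Finset.sum_apply]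
  refine Finset.sum_congr rfl fun j _ => ?_
  simp only [Pi.sub_apply, Matrix.mulVec, dotProduct, Pi.smul_apply, smul_eq_mul]
  rw [← Finset.sum_sub_distrib]
  refine Finset.sum_congr rfl fun r _ => ?_
  ring

/-- Asymptotic coverage of the combined confidence set for nonrandom designs. -/
theorem tendsto_coverage (hp : 0 < p) (hM : 0 < M) (hn₀ : p < n₀) (hσ : 0 < σ) (hS : S.PosDef)
    (hx : ∀ j, GoodDesign n₀ S (x j)) (he : IsErrorFamily P σ e)
    (hy : ∀ j i ω, y j i ω = x j i ⬝ᵥ β₀ + e (j, i) ω) (ha : ∀ j, 0 < a j) {d : ℕ → ℝ}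
    (hd : Tendsto d atTop (𝓝[>] 0)) :
    Tendsto (fun k => P {ω | β₀ ∈ confSet n₀ a (d k) x (fun j i => y j i ω)}) atTop
      (𝓝 (chiSquare p (Set.Iic (∑ j, a j ^ 2)))) := by
  have hμ : 0 < minEig S := minEig_pos hp hS
  set c : Fin M → ℝ := fun j => a j ^ 2 * minEig S * σ ^ 2 with hcdef
  have hc : ∀ j, 0 < c j := fun j => by have := ha j; positivity
  have hκ : 0 < ∑ j, c j := Finset.sum_pos (fun j _ => hc j) ⟨⟨0, hM⟩, Finset.mem_univ _⟩
  set κ : ℝ := ∑ j, c j with hκdef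
  have hκeq : κ = (∑ j, a j ^ 2) * minEig S * σ ^ 2 := by
    simp only [hκdef, hcdef, Finset.sum_mul]
  obtain ⟨B, hB, hSB⟩ := exists_eq_transpose_mul_self hS
  -- `τ² S` is the limiting covariance of the total noise.
  set τ : ℝ := σ * √κ with hτdef
  have hτ2 : τ ^ 2 = σ ^ 2 * κ := by rw [hτdef, mul_pow, Real.sq_sqrt hκ.le]
  have hτ0 : τ ≠ 0 := by positivity
  -- almost sure behaviour of the procedures
  have hae : ∀ᵐ ω ∂P, ∀ j, (∀ d : ℝ, 0 < d → (stopSet n₀ (a j) d (x j) (fun i => y j i ω)).Nonempty) ∧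
      Tendsto (fun d : ℝ => d ^ 2 * (stopTime n₀ (a j) d (x j) (fun i => y j i ω) : ℝ)) (𝓝[>] 0)
        (𝓝 (c j)) :=
    ae_all_iff.2 fun j => (hx j).ae_stopTime hp hn₀ hS (he.procedure j) (hy j) (ha j)
  have hym := measurable_response he hy
  have hxm : ∀ j i k, Measurable fun _ : Ω => x j i k := fun _ _ _ => measurable_const
  -- deterministic sample sizes
  set n : ℕ → Fin M → ℕ := fun k j => ⌊c j * (d k ^ 2)⁻¹⌋₊ with hn
  have hnlim : ∀ j, Tendsto (fun k => d k ^ 2 * (n k j : ℝ)) atTop (𝓝 (c j)) := fun j =>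
    tendsto_sq_mul_floor hd (hc j).le
  set V : ℕ → Ω → Fin M → Fin p → ℝ := fun k ω j => d k • noise (x j) (fun i => e (j, i) ω) (n k j)
    with hV
  set W : ℕ → Ω → EuclideanSpace ℝ (Fin p) := fun k ω =>
    WithLp.toLp 2 ((τ⁻¹ • (B⁻¹)ᵀ) *ᵥ ∑ j, V k ω j) with hW
  have hclt : TendstoInDistribution W atTop
      (id : EuclideanSpace ℝ (Fin p) → EuclideanSpace ℝ (Fin p)) (fun _ => P)
      (stdGaussian (EuclideanSpace ℝ (Fin p))) :=
    tendstoInDistribution_total_noise hσ hx he hB hSB hc hκ hτ2 hd hnlim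
  set A : Matrix (Fin p) (Fin p) ℝ := κ⁻¹ • S⁻¹ with hA
  -- The total noise is `τ Bᵀ W`, and `A = κ⁻¹ B⁻¹ (Bᵀ)⁻¹` sends it to `(τ / κ) B⁻¹ W`.
  set D : Matrix (Fin p) (Fin p) ℝ := (τ / κ) • B⁻¹ with hD
  have hAD : ∀ k ω, A *ᵥ ∑ j, V k ω j = D *ᵥ (W k ω).ofLp := by
    intro k ω
    rw [hW, Matrix.mulVec_mulVec, hA, hD, hSB, Matrix.mul_inv_rev, Matrix.smul_mul,
      Matrix.mul_smul, smul_smul, Matrix.transpose_nonsing_inv]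
    congr 2
    field_simp
  -- The scalar is `κ (τ / κ)² = σ²`, so the limiting quadratic form is spherical.
  have hDquad : ∀ w : Fin p → ℝ, (D *ᵥ w) ⬝ᵥ (κ • S) *ᵥ (D *ᵥ w) = σ ^ 2 * (w ⬝ᵥ w) := by
    intro w
    have hBD : B *ᵥ (D *ᵥ w) = (τ / κ) • w := by
      rw [hD, Matrix.smul_mulVec, Matrix.mulVec_smul, Matrix.mulVec_mulVec,
        Matrix.mul_nonsing_inv _ hB, Matrix.one_mulVec]
    have h1 : (D *ᵥ w) ⬝ᵥ S *ᵥ (D *ᵥ w) = (B *ᵥ (D *ᵥ w)) ⬝ᵥ (B *ᵥ (D *ᵥ w)) := by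
      rw [hSB, ← Matrix.mulVec_mulVec, Matrix.dotProduct_mulVec, Matrix.vecMul_transpose]
    have h2 : (κ • S) *ᵥ (D *ᵥ w) = κ • S *ᵥ (D *ᵥ w) := Matrix.smul_mulVec _ _ _
    rw [h2, dotProduct_smul, h1, hBD, smul_dotProduct, dotProduct_smul]
    simp only [smul_eq_mul]
    have : κ * (τ / κ * (τ / κ * w ⬝ᵥ w)) = τ ^ 2 / κ * w ⬝ᵥ w := by field_simp
    rw [this, hτ2]
    field_simp
  -- measurability of the ingredients
  have hmSInv : ∀ d j q r, Measurable fun ω =>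
      scaledInvGram n₀ a d x (fun j i => y j i ω) j q r := fun d j q r =>
    measurable_inv_apply (fun q r => by
      simp only [Matrix.smul_apply, smul_eq_mul]
      exact (measurable_gram_stopTime_apply hp n₀ a d (x := fun _ => x) hxm hym j q r).const_mul _)
      q r
  have hmw : ∀ d j, Measurable fun ω => weight n₀ a d x (fun j i => y j i ω) j := fun d j =>
    measurable_weight hp n₀ a d (x := fun _ => x) hxm hym j
  have hmA : ∀ d j q r, Measurable fun ω => (weight n₀ a d x (fun j i => y j i ω) j •
      scaledInvGram n₀ a d x (fun j i => y j i ω) j) q r := fun d j q r => by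
    simp only [Matrix.smul_apply, smul_eq_mul]
    exact (hmw d j).mul (hmSInv d j q r)
  have hmN : ∀ d j, Measurable fun ω => stopTime n₀ (a j) d (x j) (fun i => y j i ω) := fun d j =>
    measurable_stopTime hp n₀ (a j) d (x := fun _ => x j) (hxm j) (hym j)
  have hmnoise : ∀ j m r, Measurable fun ω => noise (x j) (fun i => e (j, i) ω) m r := by
    intro j m r
    simp only [noise_apply]
    exact Finset.measurable_sum _ fun i _ => (he.meas _).const_mul _
  have hmErr : ∀ d q, Measurable fun ω =>
      scaledError n₀ a d x (fun j i => y j i ω) (fun j i => e (j, i) ω) q := by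
    intro d q
    simp only [scaledError, Finset.sum_apply]
    refine Finset.measurable_sum _ fun j _ => measurable_mulVec_apply (hmA d j) (fun r => ?_) q
    simp only [Pi.smul_apply, smul_eq_mul]
    exact (measurable_comp_nat (hmN d j)
      (f := fun m ω => noise (x j) (fun i => e (j, i) ω) m r) fun m => hmnoise j m r).const_mul _
  have hmCov : ∀ d q r, Measurable fun ω => (scaledCov n₀ a d x (fun j i => y j i ω))⁻¹ q r := by
    intro d q r
    refine measurable_inv_apply (fun q r => ?_) q r
    simp only [scaledCov, Matrix.sum_apply, Matrix.smul_apply, smul_eq_mul]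
    exact Finset.measurable_sum _ fun j _ => ((hmw d j).pow_const 2).mul (hmSInv d j q r)
  have hmThr : ∀ d, Measurable fun ω => (totalSize n₀ a d x (fun j i => y j i ω) : ℝ) * d ^ 2 /
      combinedMinEig n₀ a d x (fun j i => y j i ω) := fun d =>
    ((measurable_from_nat.comp (measurable_totalSize hp n₀ a d (x := fun _ => x) hxm hym)).mul_const
      _).div (measurable_combinedMinEig hp n₀ a d (x := fun _ => x) hxm hym)
  have hmV : ∀ k j r, Measurable fun ω => V k ω j r := fun k j r => (hmnoise j _ r).const_mul _
  have hmW : ∀ k q, Measurable fun ω => (D *ᵥ (W k ω).ofLp) q := by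
    intro k q
    simp only [← hAD]
    refine measurable_mulVec_apply (A := fun _ => A) (fun _ _ => measurable_const) (fun r => ?_) q
    simp only [Finset.sum_apply]
    exact Finset.measurable_sum _ fun j _ => hmV k j r
  -- the remainder terms
  have hrem : ∀ q, TendstoInMeasure P (fun k ω =>
      (scaledError n₀ a (d k) x (fun j i => y j i ω) (fun j i => e (j, i) ω) -
        D *ᵥ (W k ω).ofLp) q) atTop (fun _ => (0 : Fin p → ℝ) q) := by
    intro q
    simp only [← hAD, scaledError_sub_apply, Pi.zero_apply]
    refine tendstoInMeasure_zero_sum _ fun j _ => tendstoInMeasure_zero_sum _ fun r _ => ?_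
    have hej := he.procedure j
    have hAns : TendstoInMeasure P (fun k ω => d k * noise (x j) (fun i => e (j, i) ω)
        (stopTime n₀ (a j) (d k) (x j) (fun i => y j i ω)) r - V k ω j r) atTop (fun _ => 0) := by
      have h := tendstoInMeasure_sum_random_index (hej.measurable_mul fun i => x j i r)
        (hej.indep_mul fun i => x j i r) (hej.memLp_mul fun i => x j i r)
        (hej.mean_mul fun i => x j i r)
        (hej.tendsto_average_var ((hx j).tendsto_average_sq_apply r)) hd (hc j)
        (N := fun k ω => stopTime n₀ (a j) (d k) (x j) (fun i => y j i ω)) (n := fun k => n k j)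
        (tendstoInMeasure_of_ae_nhdsGT
          (f := fun d ω => d ^ 2 * (stopTime n₀ (a j) d (x j) (fun i => y j i ω) : ℝ))
          (fun d => (measurable_from_nat.comp (hmN d j)).const_mul _)
          (hae.mono fun ω h => (h j).2) hd) (hnlim j)
      refine TendstoInMeasure.congr_left (fun k => ae_of_all _ fun ω => ?_) h
      simp only [hV, Pi.smul_apply, noise_apply, smul_eq_mul]
      ring
    refine tendstoInMeasure_zero_add (tendstoInMeasure_zero_mul ?_ (BoundedInProb.add ?_ ?_))
      (tendstoInMeasure_zero_mul hAns (BoundedInProb.const _))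
    · refine tendstoInMeasure_sub_const (tendstoInMeasure_of_ae_nhdsGT
        (f := fun d ω => (weight n₀ a d x (fun j i => y j i ω) j •
          scaledInvGram n₀ a d x (fun j i => y j i ω) j) q r) (fun d => hmA d j q r) ?_ hd)
      filter_upwards [hae] with ω hω
      exact ((continuous_apply_apply q r).tendsto _).comp
        (tendsto_weight_smul_scaledInvGram hx hS hc hκ (fun j => (hω j).2) j)
    · exact boundedInProb_noise (hx j) hej (hc j) hd (hnlim j) r
    · exact BoundedInProb.of_tendstoInMeasure_zero hAns
  set thr : ℝ := (∑ j, a j ^ 2) * σ ^ 2 with hthr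
  have hthr' : κ / minEig S = thr := by rw [hκeq, hthr]; field_simp
  -- Everything that converges in probability to a constant is bundled, so that Slutsky's theorem is
  -- applied once, to the pair `(W, Y)`.
  set Y : ℕ → Ω → (Fin p → ℝ) × ((Fin p → Fin p → ℝ) × ℝ) := fun k ω =>
    (scaledError n₀ a (d k) x (fun j i => y j i ω) (fun j i => e (j, i) ω) - D *ᵥ (W k ω).ofLp,
      (fun q r => (scaledCov n₀ a (d k) x (fun j i => y j i ω))⁻¹ q r,
        (totalSize n₀ a (d k) x (fun j i => y j i ω) : ℝ) * d k ^ 2 /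
          combinedMinEig n₀ a (d k) x (fun j i => y j i ω))) with hY
  have hYlim : TendstoInMeasure P Y atTop (fun _ => (0, (fun q r => (κ • S) q r, thr))) := by
    refine tendstoInMeasure_prodMk (tendstoInMeasure_pi hrem) (tendstoInMeasure_prodMk ?_ ?_)
    · refine tendstoInMeasure_of_tendsto_ae (fun k => Measurable.aestronglyMeasurable <|
        measurable_pi_lambda _ fun q => measurable_pi_lambda _ fun r => hmCov _ q r) ?_
      filter_upwards [hae] with ω hω
      exact (tendsto_inv_scaledCov hx hS hc hκ fun j => (hω j).2).comp hd
    · refine tendstoInMeasure_of_ae_nhdsGT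
        (f := fun d ω => (totalSize n₀ a d x (fun j i => y j i ω) : ℝ) * d ^ 2 /
          combinedMinEig n₀ a d x (fun j i => y j i ω)) hmThr ?_ hd
      filter_upwards [hae] with ω hω
      rw [← hthr']
      exact tendsto_threshold hx hS hc hκ (fun j => (hω j).2) hp
  have hYm : ∀ k, AEMeasurable (Y k) P := fun k => by
    refine Measurable.aemeasurable (Measurable.prodMk ?_ (Measurable.prodMk ?_ (hmThr _)))
    · exact measurable_pi_lambda _ fun q => (hmErr _ q).sub (hmW k q)
    · exact measurable_pi_lambda _ fun q => measurable_pi_lambda _ fun r => hmCov _ q r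
  -- For `d > 0`, the event `g (W, Y) ≤ 0` is almost surely the coverage event.
  set g : EuclideanSpace ℝ (Fin p) × ((Fin p → ℝ) × ((Fin p → Fin p → ℝ) × ℝ)) → ℝ := fun z =>
    (z.2.1 + D *ᵥ z.1.ofLp) ⬝ᵥ (Matrix.of z.2.2.1) *ᵥ (z.2.1 + D *ᵥ z.1.ofLp) - z.2.2.2 with hg
  have hgc : Continuous g := by
    simp only [hg, Matrix.mulVec, dotProduct, Matrix.of_apply, Pi.add_apply]
    fun_prop
  have hT := hclt.continuous_comp_prodMk_of_tendstoInMeasure_const hgc hYlim hYm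
  have hglim : ∀ w : EuclideanSpace ℝ (Fin p), g (id w, (0, (fun q r => (κ • S) q r, thr))) =
      σ ^ 2 * ‖w‖ ^ 2 - thr := by
    intro w
    have h2 : w.ofLp ⬝ᵥ w.ofLp = ‖w‖ ^ 2 := by
      rw [EuclideanSpace.real_norm_sq_eq]
      simp [dotProduct, pow_two]
    have := hDquad w.ofLp
    simp only [hg, id, zero_add]
    rw [← h2, ← this]
    rfl
  -- Portmanteau theorem: the boundary point of the half-line pulls back to a sphere, a null set of
  -- the Gaussian.
  have hmap := ProbabilityMeasure.tendsto_measure_of_null_frontier_of_tendsto' hT.tendsto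
    (E := Set.Iic 0) (by
      rw [frontier_Iic]
      simp only [ProbabilityMeasure.coe_mk]
      rw [Measure.map_apply_of_aemeasurable hT.aemeasurable_limit (measurableSet_singleton _)]
      have hset : (fun ω : EuclideanSpace ℝ (Fin p) =>
          g (id ω, (0, (fun q r => (κ • S) q r, thr)))) ⁻¹' {0} = {w | ‖w‖ ^ 2 = ∑ j, a j ^ 2} := by
        ext w
        change g (id w, (0, (fun q r => (κ • S) q r, thr))) = 0 ↔ ‖w‖ ^ 2 = _
        rw [hglim w, hthr, mul_comm _ (σ ^ 2), ← mul_sub, mul_eq_zero, sub_eq_zero]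
        simp [hσ.ne']
      rw [hset]
      exact stdGaussian_norm_sq_eq p hp _)
  simp only [ProbabilityMeasure.coe_mk] at hmap
  rw [Measure.map_apply_of_aemeasurable hT.aemeasurable_limit measurableSet_Iic] at hmap
  have hset : (fun ω : EuclideanSpace ℝ (Fin p) =>
      g (id ω, (0, (fun q r => (κ • S) q r, thr)))) ⁻¹' Set.Iic 0 = {w | ‖w‖ ^ 2 ≤ ∑ j, a j ^ 2} := by
    ext w
    change g (id w, (0, (fun q r => (κ • S) q r, thr))) ≤ 0 ↔ ‖w‖ ^ 2 ≤ _
    rw [hglim w, hthr, mul_comm _ (σ ^ 2), sub_nonpos, mul_le_mul_iff_right₀ (by positivity)]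
  rw [hset, stdGaussian_norm_sq_le] at hmap
  refine hmap.congr' ?_
  have hd0 : ∀ᶠ k in atTop, 0 < d k := (tendsto_nhdsWithin_iff.1 hd).2
  filter_upwards [hd0] with k hk
  rw [Measure.map_apply_of_aemeasurable (hT.forall_aemeasurable k) measurableSet_Iic]
  refine measure_congr ?_
  filter_upwards [hae] with ω hω
  refine propext ?_
  change g (W k ω, Y k ω) ≤ 0 ↔ β₀ ∈ confSet n₀ a (d k) x (fun j i => y j i ω)
  rw [mem_confSet_iff hM (by omega) hx (e := fun j i => e (j, i) ω) (fun j i => hy j i ω) hk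
    (fun j => (hω j).1 _ hk)]
  simp only [hg, hY, sub_add_cancel, sub_nonpos]
  rfl

end CoverageLimit

/-! ### Moments of the stopping time for a nonrandom design -/

section Moments

variable {Ω : Type*} [mΩ : MeasurableSpace Ω] {P : Measure Ω} [IsProbabilityMeasure P]

/-- Almost sure convergence to a constant together with bounded second moments gives convergence
of the means. -/
lemma tendsto_integral_of_ae_of_sq_le {ι : Type*} {l : Filter ι} [l.IsCountablyGenerated]
    {f : ι → Ω → ℝ} {c B : ℝ} (hm : ∀ i, Measurable (f i)) (h0 : ∀ i ω, 0 ≤ f i ω)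
    (hi : ∀ᶠ i in l, Integrable (fun ω => f i ω ^ 2) P)
    (hB : ∀ᶠ i in l, ∫ ω, f i ω ^ 2 ∂P ≤ B)
    (h : ∀ᵐ ω ∂P, Tendsto (fun i => f i ω) l (𝓝 c)) :
    Tendsto (fun i => ∫ ω, f i ω ∂P) l (𝓝 c) := by
  rw [Metric.tendsto_nhds]
  intro ε hε
  -- Truncating at `K` costs at most `B / K` in the mean, as `f - K ≤ f² / K` where `f ≥ K`; the
  -- condition `c ≤ K` leaves the limit untouched.
  obtain ⟨K, hKc, hK0, hKB⟩ : ∃ K : ℝ, c ≤ K ∧ 0 < K ∧ B / K < ε / 2 := by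
    have h1 : Tendsto (fun K : ℝ => B / K) atTop (𝓝 0) := tendsto_const_nhds.div_atTop tendsto_id
    obtain ⟨K, h2, h3, h4⟩ := ((h1.eventually_lt_const (half_pos hε)).and
      ((eventually_ge_atTop c).and (eventually_gt_atTop 0))).exists
    exact ⟨K, h3, h4, h2⟩
  have htrunc : Tendsto (fun i => ∫ ω, min (f i ω) K ∂P) l (𝓝 c) := by
    have hd := tendsto_integral_filter_of_dominated_convergence (μ := P) (l := l)
      (F := fun i ω => min (f i ω) K) (f := fun _ => c) (fun _ => K)
      (Eventually.of_forall fun i => ((hm i).min measurable_const).aestronglyMeasurable)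
      (Eventually.of_forall fun i => ae_of_all _ fun ω => by
        rw [Real.norm_eq_abs, abs_of_nonneg (le_min (h0 i ω) hK0.le)]
        exact min_le_right _ _)
      (integrable_const _)
      (h.mono fun ω hω => by simpa [min_eq_left hKc] using hω.min (tendsto_const_nhds (x := K)))
    simpa using hd
  filter_upwards [Metric.tendsto_nhds.1 htrunc (ε / 2) (half_pos hε), hi, hB] with i h1 h2 h3
  have hfL : MemLp (f i) 2 P := (memLp_two_iff_integrable_sq (hm i).aestronglyMeasurable).2 h2
  have hfi : Integrable (f i) P := hfL.integrable one_le_two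
  have hmi : Integrable (fun ω => min (f i ω) K) P := hfi.inf (integrable_const K)
  have h4 : ∫ ω, f i ω ∂P - ∫ ω, min (f i ω) K ∂P ≤ B / K := by
    rw [← integral_sub hfi hmi]
    calc ∫ ω, (f i ω - min (f i ω) K) ∂P ≤ ∫ ω, f i ω ^ 2 / K ∂P := by
          refine integral_mono (hfi.sub hmi) (h2.div_const K) fun ω => ?_
          have hf0 := h0 i ω
          rcases le_total (f i ω) K with hle | hle
          · simp only [min_eq_left hle, sub_self]
            positivity
          · simp only [min_eq_right hle]
            rw [le_div_iff₀ hK0]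
            nlinarith
      _ = (∫ ω, f i ω ^ 2 ∂P) / K := integral_div _ _
      _ ≤ B / K := by gcongr
  have h5 : ∫ ω, min (f i ω) K ∂P ≤ ∫ ω, f i ω ∂P :=
    integral_mono hmi hfi fun ω => min_le_left _ _
  rw [Real.dist_eq, abs_lt] at h1 ⊢
  constructor <;> linarith [h1.1, h1.2]

variable {σ : ℝ} {p n₀ : ℕ} {S : Matrix (Fin p) (Fin p) ℝ} {x : ℕ → Fin p → ℝ} {e y : ℕ → Ω → ℝ}
  {β₀ : Fin p → ℝ} {a d T : ℝ}

omit [IsProbabilityMeasure P] in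
/-- The event that the procedure has not stopped by stage `i` does not depend on the error `i`. -/
lemma indepFun_not_stopped (hp : 0 < p) (he : IsErrorFamily P σ e)
    (hy : ∀ i ω, y i ω = x i ⬝ᵥ β₀ + e i ω) (n₀ : ℕ) (a d : ℝ) (i : ℕ) :
    IndepFun (Set.indicator {ω | ∀ n ≤ i, n ∉ stopSet n₀ a d x (fun i => y i ω)}
      (fun _ => (1 : ℝ))) (fun ω => e i ω ^ 2) P := by
  have hind : Indep (⨆ k ∈ {k | k < i}, MeasurableSpace.comap (e k) inferInstance)
      (⨆ k ∈ ({i} : Set ℕ), MeasurableSpace.comap (e k) inferInstance) P :=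
    indep_iSup_of_disjoint (fun k => (he.meas k).comap_le) he.indep (by simp)
  rw [iSup_singleton] at hind
  have hpast : Measurable[⨆ k ∈ {k | k < i}, MeasurableSpace.comap (e k) inferInstance]
      (Set.indicator {ω | ∀ n ≤ i, n ∉ stopSet n₀ a d x (fun i => y i ω)} (fun _ => (1 : ℝ))) := by
    refine measurable_const.indicator ?_
    have hset : {ω | ∀ n ≤ i, n ∉ stopSet n₀ a d x (fun i => y i ω)} =
        ⋂ n ∈ Finset.range (i + 1), {ω | n ∈ stopSet n₀ a d x (fun i => y i ω)}ᶜ := by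
      ext ω
      simp
    rw [hset]
    refine Finset.measurableSet_biInter _ fun n hn => MeasurableSet.compl ?_
    refine @measurableSet_mem_stopSet Ω (⨆ k ∈ {k | k < i}, MeasurableSpace.comap (e k) inferInstance)
      p (fun _ => x) (fun ω i => y i ω) hp n n₀ a d (fun _ _ _ => measurable_const) fun k hk => ?_
    simp only [hy]
    refine Measurable.const_add ?_ _
    -- A stage `n ≤ i` uses only errors with index below `n`, hence below `i`.
    have hki : k < i := by simp at hn; omega
    exact (comap_measurable (e k)).mono (le_iSup₂ (f := fun k (_ : k ∈ {k | k < i}) =>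
      MeasurableSpace.comap (e k) inferInstance) k hki) le_rfl
  have h1 : IndepFun (Set.indicator {ω | ∀ n ≤ i, n ∉ stopSet n₀ a d x (fun i => y i ω)}
      (fun _ => (1 : ℝ))) (e i) P := by
    rw [IndepFun_iff_Indep]
    exact indep_of_indep_of_le_left hind hpast.comap_le
  exact h1.comp (φ := id) (ψ := fun r : ℝ => r ^ 2) measurable_id (by fun_prop)

/-- **Wald's identity** for the truncated stopping time. -/
lemma integral_sum_sq_stopTime (hp : 0 < p) (he : IsErrorFamily P σ e)
    (hy : ∀ i ω, y i ω = x i ⬝ᵥ β₀ + e i ω)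
    (hfin : ∀ᵐ ω ∂P, (stopSet n₀ a d x (fun i => y i ω)).Nonempty) (K : ℕ) :
    Integrable (fun ω => ∑ i ∈ Finset.range (min (stopTime n₀ a d x (fun i => y i ω)) K),
      e i ω ^ 2) P ∧
    ∫ ω, ∑ i ∈ Finset.range (min (stopTime n₀ a d x (fun i => y i ω)) K), e i ω ^ 2 ∂P =
      σ ^ 2 * ∫ ω, ((min (stopTime n₀ a d x (fun i => y i ω)) K : ℕ) : ℝ) ∂P := by
  -- `I i` indicates `i < N`, so the random sum becomes a fixed sum of `I i * e i ^ 2` whose means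
  -- factor. On paths that never stop `I i` is `1` although the default stopping time is `0`; these
  -- paths are null.
  set I : ℕ → Ω → ℝ := fun i => Set.indicator
    {ω | ∀ n ≤ i, n ∉ stopSet n₀ a d x (fun i => y i ω)} (fun _ => (1 : ℝ)) with hI
  have hIeq : ∀ᵐ ω ∂P, ∀ i, I i ω = if i < stopTime n₀ a d x (fun i => y i ω) then 1 else 0 := by
    filter_upwards [hfin] with ω hω i
    by_cases h : i < stopTime n₀ a d x (fun i => y i ω)
    · rw [if_pos h]
      exact Set.indicator_of_mem
        (s := {ω | ∀ n ≤ i, n ∉ stopSet n₀ a d x (fun i => y i ω)})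
        (fun n hn => Nat.notMem_of_lt_sInf (lt_of_le_of_lt hn h)) _
    · rw [if_neg h]
      exact Set.indicator_of_notMem
        (s := {ω | ∀ n ≤ i, n ∉ stopSet n₀ a d x (fun i => y i ω)})
        (fun hcon => hcon _ (not_lt.1 h) (Nat.sInf_mem hω)) _
  have hfilter : ∀ m : ℕ, (Finset.range K).filter (fun i => i < m) = Finset.range (min m K) := by
    intro m
    ext i
    simp [and_comm]
  have hsum : ∀ᵐ ω ∂P, ∑ i ∈ Finset.range (min (stopTime n₀ a d x (fun i => y i ω)) K), e i ω ^ 2 =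
      ∑ i ∈ Finset.range K, I i ω * e i ω ^ 2 := by
    filter_upwards [hIeq] with ω hω
    rw [← hfilter, Finset.sum_filter]
    simp [hω]
  have hcard : ∀ᵐ ω ∂P, ((min (stopTime n₀ a d x (fun i => y i ω)) K : ℕ) : ℝ) =
      ∑ i ∈ Finset.range K, I i ω := by
    filter_upwards [hIeq] with ω hω
    simp only [hω]
    rw [← Finset.sum_filter, hfilter]
    simp
  have hind := indepFun_not_stopped hp he hy n₀ a d
  have hym : ∀ i, Measurable fun ω => y i ω := fun i => by
    simp only [hy]
    exact (he.meas i).const_add _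
  have hIm : ∀ i, Measurable (I i) := fun i => by
    refine measurable_const.indicator ?_
    have hset : {ω | ∀ n ≤ i, n ∉ stopSet n₀ a d x (fun i => y i ω)} =
        ⋂ n ∈ Finset.range (i + 1), {ω | n ∈ stopSet n₀ a d x (fun i => y i ω)}ᶜ := by
      ext ω
      simp
    rw [hset]
    exact Finset.measurableSet_biInter _ fun n hn => (measurableSet_mem_stopSet (x := fun _ => x)
      (y := fun ω i => y i ω) hp n₀ a d (fun _ _ _ => measurable_const) fun k _ => hym k).compl
  have hIi : ∀ i, Integrable (I i) P := fun i => by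
    refine Integrable.of_bound (hIm i).aestronglyMeasurable 1 (ae_of_all _ fun ω => ?_)
    exact (norm_indicator_le_norm_self _ _).trans (by simp)
  have hmul : ∀ i, Integrable (fun ω => I i ω * e i ω ^ 2) P := fun i =>
    (hind i).integrable_mul (hIi i) (he.memLp i).integrable_sq
  refine ⟨(integrable_finsetSum _ fun i _ => hmul i).congr (hsum.mono fun ω h => h.symm), ?_⟩
  rw [integral_congr_ae hsum, integral_congr_ae hcard, integral_finsetSum _ fun i _ => hmul i,
    integral_finsetSum _ fun i _ => hIi i, Finset.mul_sum]
  refine Finset.sum_congr rfl fun i _ => ?_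
  rw [(hind i).integral_fun_mul_eq_mul_integral (hIm i).aestronglyMeasurable
    (he.memLp i).integrable_sq.aestronglyMeasurable, he.var, mul_comm]

/-- Pathwise bound on the truncated stopping time. -/
lemma sq_min_stopTime_le {y e : ℕ → ℝ} (hp : 0 < p) (hn₀ : p < n₀) (hx : GoodDesign n₀ S x)
    (hy : ∀ i, y i = x i ⬝ᵥ β₀ + e i) (ha : 0 < a)
    (hT : ∀ n, n₀ ≤ n → designMinEig x n ≤ T) (K : ℕ) :
    d ^ 2 * ((min (stopTime n₀ a d x y) K : ℕ) : ℝ) ^ 2 ≤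
      2 * a ^ 2 * T * (p + 1) * ∑ i ∈ Finset.range (min (stopTime n₀ a d x y) K), e i ^ 2 +
        (2 * a ^ 2 * T + 2 * d ^ 2 * n₀ ^ 2 + 2 * d ^ 2) := by
  set m := min (stopTime n₀ a d x y) K with hm
  have hpos : ∀ n, n₀ ≤ n → 0 < designMinEig x n := fun n hn =>
    designMinEig_pos hp hx.isUnit hn (by omega)
  have hT0 : 0 < T := (hpos n₀ le_rfl).trans_le (hT n₀ le_rfl)
  have hQ : 0 ≤ ∑ i ∈ Finset.range m, e i ^ 2 := Finset.sum_nonneg fun _ _ => sq_nonneg _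
  rcases le_or_gt m n₀ with hle | hlt
  -- Stopping by `n₀` is absorbed in the summand `2 d² n₀²`. Otherwise the inequality of the rule
  -- fails at stage `m - 1`.
  · have h1 : (m : ℝ) ≤ n₀ := by exact_mod_cast hle
    have h2 : d ^ 2 * (m : ℝ) ^ 2 ≤ d ^ 2 * (n₀ : ℝ) ^ 2 := by gcongr
    have h3 : 0 ≤ d ^ 2 * (n₀ : ℝ) ^ 2 := by positivity
    have h4 : 0 ≤ 2 * a ^ 2 * T * (p + 1) * ∑ i ∈ Finset.range m, e i ^ 2 := by positivity
    have h5 : 0 ≤ 2 * a ^ 2 * T := by positivity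
    nlinarith [sq_nonneg d]
  · obtain ⟨n, hn⟩ : ∃ n, m = n + 1 := ⟨m - 1, by omega⟩
    have hn1 : n₀ ≤ n := by omega
    have hnN : n < stopTime n₀ a d x y := by omega
    have hnot : n ∉ stopSet n₀ a d x y := Nat.notMem_of_lt_sInf hnN
    rw [stopSet_eq hpos ha] at hnot
    simp only [Set.mem_ofPred_eq, not_and, not_le] at hnot
    have h1 := hnot hn1
    have hn0 : (0 : ℝ) < n := by exact_mod_cast (by omega : 0 < n)
    have hpn : (p : ℝ) + 1 ≤ n := by exact_mod_cast (by omega : p + 1 ≤ n)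
    have hp0 : (0 : ℝ) ≤ p := by positivity
    set Q := ∑ i ∈ Finset.range n, e i ^ 2 with hQdef
    have hQ0 : 0 ≤ Q := Finset.sum_nonneg fun _ _ => sq_nonneg _
    have hQle : Q ≤ ∑ i ∈ Finset.range m, e i ^ 2 :=
      Finset.sum_le_sum_of_subset_of_nonneg (Finset.range_mono (by omega))
        fun _ _ _ => sq_nonneg _
    -- `n / (n - p) ≤ p + 1` because `n ≥ p + 1`.
    have hv : n * varEst x y n ≤ (p + 1) * Q := by
      have h2 := varEst_le hy (hx.isUnit_of_le hn1) (by omega : p < n)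
      have hnp : (0 : ℝ) < n - p := by linarith
      calc n * varEst x y n ≤ n * (Q / (n - p)) := by gcongr
        _ = n / (n - p) * Q := by ring
        _ ≤ (p + 1) * Q := by
            gcongr
            rw [div_le_iff₀ hnp]
            nlinarith
    have h3 : d ^ 2 * (n : ℝ) ^ 2 ≤ a ^ 2 * T * ((p + 1) * Q + 1) := by
      have hμ := hT n hn1
      have hμ0 := hpos n hn1
      have hv0 : 0 ≤ varEst x y n := varEst_nonneg (by omega)
      calc d ^ 2 * (n : ℝ) ^ 2 = (d ^ 2 * n) * n := by ring
        _ ≤ (a ^ 2 * designMinEig x n * (varEst x y n + 1 / n)) * n := by gcongr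
        _ = a ^ 2 * designMinEig x n * (n * varEst x y n + 1) := by field_simp
        _ ≤ a ^ 2 * T * ((p + 1) * Q + 1) := by gcongr
    have h4 : a ^ 2 * T * ((p + 1) * Q + 1) ≤
        a ^ 2 * T * ((p + 1) * ∑ i ∈ Finset.range m, e i ^ 2 + 1) := by gcongr
    have h5 : (m : ℝ) = n + 1 := by rw [hn]; push_cast; ring
    have h6 : ((n : ℝ) + 1) ^ 2 ≤ 2 * (n : ℝ) ^ 2 + 2 := by nlinarith [sq_nonneg ((n : ℝ) - 1)]
    have h7 : 0 ≤ d ^ 2 * (n₀ : ℝ) ^ 2 := by positivity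
    rw [h5]
    nlinarith [mul_le_mul_of_nonneg_left h6 (sq_nonneg d)]

/-- The slope in the second moment bound for the stopping time. -/
noncomputable def momentSlope (p : ℕ) (σ a T : ℝ) : ℝ := 2 * a ^ 2 * T * (p + 1) * σ ^ 2

/-- The offset in the second moment bound for the stopping time. -/
noncomputable def momentOffset (n₀ : ℕ) (a d T : ℝ) : ℝ :=
  (2 * a ^ 2 * T + 2 * d ^ 2 * n₀ ^ 2 + 2 * d ^ 2) * d ^ 2

/-- Let `U` be this second moment, `m` the mean of the same variable and `A` the slope. The pathwise
bound and Wald's identity give `U ≤ A m + offset`, while `m² ≤ U`; from `A m ≤ (A² + m²) / 2`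
follows `U ≤ A² + 2 · offset`. Truncation keeps `U` finite, so that it can be absorbed, and the
bound is free of `K`. -/
lemma integral_sq_min_stopTime_le (hp : 0 < p) (hn₀ : p < n₀)
    (hx : GoodDesign n₀ S x) (he : IsErrorFamily P σ e) (hy : ∀ i ω, y i ω = x i ⬝ᵥ β₀ + e i ω)
    (ha : 0 < a) (hT : ∀ n, n₀ ≤ n → designMinEig x n ≤ T)
    (hfin : ∀ᵐ ω ∂P, (stopSet n₀ a d x (fun i => y i ω)).Nonempty) (K : ℕ) :
    ∫ ω, (d ^ 2 * ((min (stopTime n₀ a d x (fun i => y i ω)) K : ℕ) : ℝ)) ^ 2 ∂P ≤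
      momentSlope p σ a T ^ 2 + 2 * momentOffset n₀ a d T := by
  set N : Ω → ℝ := fun ω => ((min (stopTime n₀ a d x (fun i => y i ω)) K : ℕ) : ℝ) with hN
  have hym : ∀ i, Measurable fun ω => y i ω := fun i => by
    simp only [hy]
    exact (he.meas i).const_add _
  have hNm : Measurable N := measurable_from_nat.comp ((measurable_stopTime (x := fun _ => x)
    (y := fun ω i => y i ω) hp n₀ a d (fun _ _ => measurable_const) hym).min measurable_const)
  have hNL : MemLp N 2 P := MemLp.of_bound hNm.aestronglyMeasurable K (ae_of_all _ fun ω => by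
    simp only [hN, Real.norm_natCast]
    exact_mod_cast min_le_right _ _)
  obtain ⟨hwi, hw⟩ := integral_sum_sq_stopTime hp he hy hfin K
  have h1 : d ^ 2 * ∫ ω, N ω ^ 2 ∂P ≤ momentSlope p σ a T * ∫ ω, N ω ∂P +
      (2 * a ^ 2 * T + 2 * d ^ 2 * n₀ ^ 2 + 2 * d ^ 2) := by
    have h2 := integral_mono (μ := P) (hNL.integrable_sq.const_mul (d ^ 2))
      ((hwi.const_mul (2 * a ^ 2 * T * (p + 1))).add (integrable_const
        (2 * a ^ 2 * T + 2 * d ^ 2 * n₀ ^ 2 + 2 * d ^ 2)))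
      (fun ω => sq_min_stopTime_le (e := fun i => e i ω) hp hn₀ hx (fun i => hy i ω) ha hT K)
    simp only [Pi.add_apply] at h2
    rw [integral_const_mul, integral_add (hwi.const_mul _) (integrable_const _),
      integral_const_mul, hw] at h2
    simp only [integral_const, probReal_univ, one_smul] at h2
    rw [momentSlope]
    linarith
  have h3 : (∫ ω, N ω ∂P) ^ 2 ≤ ∫ ω, N ω ^ 2 ∂P := by
    have := variance_nonneg N P
    rw [variance_eq_sub hNL] at this
    simp only [Pi.pow_apply] at this
    linarith
  have h4 : ∫ ω, (d ^ 2 * N ω) ^ 2 ∂P = d ^ 2 * (d ^ 2 * ∫ ω, N ω ^ 2 ∂P) := by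
    simp only [mul_pow]
    rw [integral_const_mul]
    ring
  rw [h4]
  set u := ∫ ω, N ω ^ 2 ∂P
  set m := ∫ ω, N ω ∂P
  set A := momentSlope p σ a T
  have h5 := mul_le_mul_of_nonneg_left h1 (sq_nonneg d)
  have h6 : (d ^ 2 * m) ^ 2 ≤ d ^ 2 * (d ^ 2 * u) := by
    have := mul_le_mul_of_nonneg_left h3 (by positivity : 0 ≤ d ^ 2 * d ^ 2)
    nlinarith
  rw [momentOffset]
  nlinarith [sq_nonneg (A - d ^ 2 * m)]

/-- Second moment bound for the stopping time. -/
theorem integral_sq_stopTime_le (hp : 0 < p) (hn₀ : p < n₀)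
    (hx : GoodDesign n₀ S x) (he : IsErrorFamily P σ e) (hy : ∀ i ω, y i ω = x i ⬝ᵥ β₀ + e i ω)
    (ha : 0 < a) (hT : ∀ n, n₀ ≤ n → designMinEig x n ≤ T)
    (hfin : ∀ᵐ ω ∂P, (stopSet n₀ a d x (fun i => y i ω)).Nonempty) :
    Integrable (fun ω => (d ^ 2 * (stopTime n₀ a d x (fun i => y i ω) : ℝ)) ^ 2) P ∧
    ∫ ω, (d ^ 2 * (stopTime n₀ a d x (fun i => y i ω) : ℝ)) ^ 2 ∂P ≤
      momentSlope p σ a T ^ 2 + 2 * momentOffset n₀ a d T := by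
  set N : Ω → ℕ := fun ω => stopTime n₀ a d x (fun i => y i ω) with hN
  have hym : ∀ i, Measurable fun ω => y i ω := fun i => by
    simp only [hy]
    exact (he.meas i).const_add _
  have hNm : Measurable N := measurable_stopTime (x := fun _ => x)
    (y := fun ω i => y i ω) hp n₀ a d (fun _ _ => measurable_const) hym
  set B := momentSlope p σ a T ^ 2 + 2 * momentOffset n₀ a d T with hB
  have hK := integral_sq_min_stopTime_le hp hn₀ hx he hy ha hT hfin
  have hB0 : 0 ≤ B := (integral_nonneg fun ω => sq_nonneg _).trans (hK 0)
  have hmK : ∀ K : ℕ, Measurable fun ω => (d ^ 2 * ((min (N ω) K : ℕ) : ℝ)) ^ 2 := fun K =>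
    ((measurable_from_nat.comp (hNm.min measurable_const)).const_mul _).pow_const 2
  have hintK : ∀ K : ℕ, Integrable (fun ω => (d ^ 2 * ((min (N ω) K : ℕ) : ℝ)) ^ 2) P := fun K => by
    refine Integrable.of_bound (hmK K).aestronglyMeasurable ((d ^ 2 * K) ^ 2)
      (ae_of_all _ fun ω => ?_)
    rw [Real.norm_eq_abs, abs_of_nonneg (sq_nonneg _)]
    have : ((min (N ω) K : ℕ) : ℝ) ≤ K := by exact_mod_cast min_le_right _ _
    gcongr
  -- Fatou's lemma removes the truncation.
  have hle : ∫⁻ ω, ENNReal.ofReal ((d ^ 2 * (N ω : ℝ)) ^ 2) ∂P ≤ ENNReal.ofReal B := by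
    have hlim : ∀ ω, ENNReal.ofReal ((d ^ 2 * (N ω : ℝ)) ^ 2) = liminf (fun K : ℕ =>
        ENNReal.ofReal ((d ^ 2 * ((min (N ω) K : ℕ) : ℝ)) ^ 2)) atTop := by
      intro ω
      refine (Tendsto.liminf_eq (tendsto_const_nhds.congr' ?_)).symm
      filter_upwards [eventually_ge_atTop (N ω)] with K hK
      rw [min_eq_left hK]
    simp only [hlim]
    refine (lintegral_liminf_le fun K => (hmK K).ennreal_ofReal).trans ?_
    refine liminf_le_of_le (by isBoundedDefault) fun b hb => ?_
    obtain ⟨K, hbK⟩ := hb.exists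
    refine hbK.trans ?_
    rw [← ofReal_integral_eq_lintegral_ofReal (hintK K) (ae_of_all _ fun ω => sq_nonneg _)]
    exact ENNReal.ofReal_le_ofReal (hK K)
  have hm : Measurable fun ω => (d ^ 2 * (N ω : ℝ)) ^ 2 :=
    ((measurable_from_nat.comp hNm).const_mul _).pow_const 2
  have hint : Integrable (fun ω => (d ^ 2 * (N ω : ℝ)) ^ 2) P := by
    refine ⟨hm.aestronglyMeasurable, ?_⟩
    rw [hasFiniteIntegral_iff_ofReal (ae_of_all _ fun ω => sq_nonneg _)]
    exact hle.trans_lt ENNReal.ofReal_lt_top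
  refine ⟨hint, ?_⟩
  rw [← ofReal_integral_eq_lintegral_ofReal hint (ae_of_all _ fun ω => sq_nonneg _)] at hle
  exact (ENNReal.ofReal_le_ofReal_iff hB0).1 hle

end Moments

/-! ### Random designs: conditioning on the covariates -/

section Conditioning

variable {Ω : Type*} [mΩ : MeasurableSpace Ω] {P : Measure Ω} [IsProbabilityMeasure P]

/-- Independence makes the joint law a product, and Tonelli's theorem applies. -/
lemma lintegral_of_indepFun {α β : Type*} [MeasurableSpace α] [MeasurableSpace β] {X : Ω → α}
    {E : Ω → β} (hX : Measurable X) (hE : Measurable E) (h : IndepFun X E P) {f : α × β → ENNReal}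
    (hf : Measurable f) :
    ∫⁻ ω, f (X ω, E ω) ∂P = ∫⁻ ω', ∫⁻ ω, f (X ω', E ω) ∂P ∂P := by
  have hmap := (indepFun_iff_map_prod_eq_prod_map_map hX.aemeasurable hE.aemeasurable).1 h
  have := Measure.isProbabilityMeasure_map (μ := P) hX.aemeasurable
  have := Measure.isProbabilityMeasure_map (μ := P) hE.aemeasurable
  rw [← lintegral_map hf (hX.prodMk hE), hmap, lintegral_prod _ hf.aemeasurable,
    lintegral_map hf.lintegral_prod_right' hX]
  exact lintegral_congr fun ω' => lintegral_map (hf.comp measurable_prodMk_left) hE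

variable {p M n₀ : ℕ} {σ : ℝ} {S : Matrix (Fin p) (Fin p) ℝ} {β₀ : Fin p → ℝ}
  {x : Fin M → ℕ → Ω → Fin p → ℝ} {y ε : Fin M → ℕ → Ω → ℝ}

/-- The covariates and responses of all procedures. -/
abbrev Data (p M : ℕ) : Type := (Fin M → ℕ → Fin p → ℝ) × (Fin M → ℕ → ℝ)

/-- The data of the linear model, with covariates from the outcome `ω'` and errors from `ω`. -/
def mixedData (β₀ : Fin p → ℝ) (x : Fin M → ℕ → Ω → Fin p → ℝ) (ε : Fin M → ℕ → Ω → ℝ)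
    (ω' ω : Ω) : Data p M :=
  (fun j i => x j i ω', fun j i => x j i ω' ⬝ᵥ β₀ + ε j i ω)

omit [IsProbabilityMeasure P] in
lemma measurable_mixedData (hx : ∀ j i, Measurable (x j i)) (hε : ∀ j i, Measurable (ε j i)) :
    Measurable fun q : Ω × Ω => mixedData β₀ x ε q.1 q.2 := by
  refine Measurable.prodMk ?_ ?_
  · exact measurable_pi_lambda _ fun j => measurable_pi_lambda _ fun i =>
      (hx j i).comp measurable_fst
  · refine measurable_pi_lambda _ fun j => measurable_pi_lambda _ fun i => ?_
    refine Measurable.add ?_ ((hε j i).comp measurable_snd)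
    simp only [dotProduct]
    exact Finset.measurable_sum _ fun k _ =>
      ((measurable_pi_apply k).comp ((hx j i).comp measurable_fst)).mul_const _

lemma measurable_lintegral_mixedData (hx : ∀ j i, Measurable (x j i))
    (hε : ∀ j i, Measurable (ε j i)) {F : Data p M → ENNReal} (hF : Measurable F) :
    Measurable fun ω' => ∫⁻ ω, F (mixedData β₀ x ε ω' ω) ∂P :=
  (hF.comp (measurable_mixedData hx hε)).lintegral_prod_right'

lemma lintegral_mixedData (hx : ∀ j i, Measurable (x j i)) (hε : ∀ j i, Measurable (ε j i))
    (hind : IndepFun (fun ω (k : Fin M × ℕ) => x k.1 k.2 ω)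
      (fun ω (k : Fin M × ℕ) => ε k.1 k.2 ω) P)
    {F : Data p M → ENNReal} (hF : Measurable F) :
    ∫⁻ ω, F (mixedData β₀ x ε ω ω) ∂P = ∫⁻ ω', ∫⁻ ω, F (mixedData β₀ x ε ω' ω) ∂P ∂P := by
  set g : (Fin M × ℕ → Fin p → ℝ) × (Fin M × ℕ → ℝ) → Data p M := fun q =>
    (fun j i => q.1 (j, i), fun j i => q.1 (j, i) ⬝ᵥ β₀ + q.2 (j, i)) with hg
  have hgm : Measurable g := by
    refine Measurable.prodMk ?_ ?_
    · exact measurable_pi_lambda _ fun j => measurable_pi_lambda _ fun i =>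
        (measurable_pi_apply (j, i)).comp measurable_fst
    · refine measurable_pi_lambda _ fun j => measurable_pi_lambda _ fun i => ?_
      refine Measurable.add ?_ ((measurable_pi_apply (j, i)).comp measurable_snd)
      simp only [dotProduct]
      exact Finset.measurable_sum _ fun k _ => ((measurable_pi_apply k).comp
        ((measurable_pi_apply (j, i)).comp measurable_fst)).mul_const _
  exact lintegral_of_indepFun (f := F ∘ g) (measurable_pi_lambda _ fun k => hx k.1 k.2)
    (measurable_pi_lambda _ fun k => hε k.1 k.2) hind (hF.comp hgm)

/-- This is `lintegral_mixedData` for the indicator of the complement. -/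
lemma ae_mixedData (hx : ∀ j i, Measurable (x j i)) (hε : ∀ j i, Measurable (ε j i))
    (hind : IndepFun (fun ω (k : Fin M × ℕ) => x k.1 k.2 ω)
      (fun ω (k : Fin M × ℕ) => ε k.1 k.2 ω) P)
    {s : Set (Data p M)} (hs : MeasurableSet s)
    (h : ∀ᵐ ω' ∂P, ∀ᵐ ω ∂P, mixedData β₀ x ε ω' ω ∈ s) :
    ∀ᵐ ω ∂P, mixedData β₀ x ε ω ω ∈ s := by
  have hdiag : Measurable fun ω => mixedData β₀ x ε ω ω :=
    (measurable_mixedData hx hε).comp (measurable_id.prodMk measurable_id)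
  have hF : Measurable (sᶜ.indicator fun _ => (1 : ENNReal)) := measurable_const.indicator hs.compl
  have h1 := lintegral_mixedData (β₀ := β₀) hx hε hind hF
  have h2 : ∫⁻ ω', ∫⁻ ω, sᶜ.indicator (fun _ => (1 : ENNReal)) (mixedData β₀ x ε ω' ω) ∂P ∂P = 0 := by
    rw [lintegral_eq_zero_iff (measurable_lintegral_mixedData hx hε hF)]
    filter_upwards [h] with ω' hω'
    rw [Pi.zero_apply, lintegral_eq_zero_iff (by
      exact hF.comp ((measurable_mixedData hx hε).comp measurable_prodMk_left))]
    filter_upwards [hω'] with ω hω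
    exact Set.indicator_of_notMem (not_not_intro hω) _
  rw [h2, lintegral_eq_zero_iff (by exact hF.comp hdiag)] at h1
  filter_upwards [h1] with ω hω
  by_contra hcon
  have h3 : sᶜ.indicator (fun _ => (1 : ENNReal)) (mixedData β₀ x ε ω ω) = 1 :=
    Set.indicator_of_mem hcon _
  rw [h3] at hω
  simp at hω

end Conditioning

/-! ### Properties of the procedure for random designs -/

section RandomDesign

variable {Ω : Type*} [mΩ : MeasurableSpace Ω] {P : Measure Ω} [IsProbabilityMeasure P]
  {p M n₀ : ℕ} {σ : ℝ} {S : Matrix (Fin p) (Fin p) ℝ} {β₀ : Fin p → ℝ}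
  {x : Fin M → ℕ → Ω → Fin p → ℝ} {ε : Fin M → ℕ → Ω → ℝ} {a : Fin M → ℝ}

lemma measurable_data_covariate (j : Fin M) (i : ℕ) (k : Fin p) :
    Measurable fun q : Data p M => q.1 j i k :=
  (measurable_pi_apply k).comp ((measurable_pi_apply i).comp
    ((measurable_pi_apply j).comp measurable_fst))

lemma measurable_data_response (j : Fin M) (i : ℕ) :
    Measurable fun q : Data p M => q.2 j i :=
  (measurable_pi_apply i).comp ((measurable_pi_apply j).comp measurable_snd)

theorem ae_tendsto_varEst (hS : S.PosDef)
    (hx : ∀ j i, Measurable (x j i)) (he : IsErrorFamily P σ fun k : Fin M × ℕ => ε k.1 k.2)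
    (hind : IndepFun (fun ω (k : Fin M × ℕ) => x k.1 k.2 ω)
      (fun ω (k : Fin M × ℕ) => ε k.1 k.2 ω) P)
    (hgood : ∀ᵐ ω ∂P, ∀ j, GoodDesign n₀ S fun i => x j i ω) :
    ∀ᵐ ω ∂P, ∀ j, Tendsto (fun n => varEst (fun i => x j i ω)
      (fun i => x j i ω ⬝ᵥ β₀ + ε j i ω) n) atTop (𝓝 (σ ^ 2)) := by
  refine ae_all_iff.2 fun j => ?_
  refine ae_mixedData (β₀ := β₀) (s := {q | Tendsto (fun n => varEst (q.1 j) (q.2 j) n) atTop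
    (𝓝 (σ ^ 2))}) hx (fun j i => he.meas (j, i)) hind ?_ ?_
  · exact measurableSet_tendsto _ fun n => measurable_varEst
      (fun i _ k => measurable_data_covariate j i k) fun i _ => measurable_data_response j i
  · filter_upwards [hgood] with ω' hω'
    exact (hω' j).ae_tendsto_varEst hS (he.procedure j) (fun i ω => rfl)

/-- Only the convergence of the variance estimates, a measurable event, is transferred from frozen
covariates. The assertions about all `d` then follow path by path, with no measurability question
for uncountably many `d`. -/
theorem ae_stopTime (hp : 0 < p) (hn₀ : p < n₀) (hS : S.PosDef)
    (hx : ∀ j i, Measurable (x j i)) (he : IsErrorFamily P σ fun k : Fin M × ℕ => ε k.1 k.2)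
    (hind : IndepFun (fun ω (k : Fin M × ℕ) => x k.1 k.2 ω)
      (fun ω (k : Fin M × ℕ) => ε k.1 k.2 ω) P)
    (hgood : ∀ᵐ ω ∂P, ∀ j, GoodDesign n₀ S fun i => x j i ω) (ha : ∀ j, 0 < a j) :
    ∀ᵐ ω ∂P, ∀ j, (∀ d : ℝ, 0 < d → (stopSet n₀ (a j) d (fun i => x j i ω)
        (fun i => x j i ω ⬝ᵥ β₀ + ε j i ω)).Nonempty) ∧
      Tendsto (fun d : ℝ => d ^ 2 * (stopTime n₀ (a j) d (fun i => x j i ω)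
        (fun i => x j i ω ⬝ᵥ β₀ + ε j i ω) : ℝ)) (𝓝[>] 0) (𝓝 (a j ^ 2 * minEig S * σ ^ 2)) := by
  filter_upwards [ae_tendsto_varEst (β₀ := β₀) hS hx he hind hgood, hgood] with ω hω hg j
  exact stopTime_asymptotics hn₀ (ha j)
    (fun n hn => designMinEig_pos hp (hg j).isUnit hn (by omega))
    ((hg j).tendsto_designMinEig hp hS) (hω j)

/-- The conditional coverage converges for almost every design and is at most one, so dominated
convergence applies along sequences. -/
theorem tendsto_coverage_random (hp : 0 < p) (hM : 0 < M) (hn₀ : p < n₀) (hσ : 0 < σ)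
    (hS : S.PosDef) (hx : ∀ j i, Measurable (x j i))
    (he : IsErrorFamily P σ fun k : Fin M × ℕ => ε k.1 k.2)
    (hind : IndepFun (fun ω (k : Fin M × ℕ) => x k.1 k.2 ω)
      (fun ω (k : Fin M × ℕ) => ε k.1 k.2 ω) P)
    (hgood : ∀ᵐ ω ∂P, ∀ j, GoodDesign n₀ S fun i => x j i ω) (ha : ∀ j, 0 < a j) :
    Tendsto (fun d : ℝ => P {ω | β₀ ∈ confSet n₀ a d (fun j i => x j i ω)
      (fun j i => x j i ω ⬝ᵥ β₀ + ε j i ω)}) (𝓝[>] 0)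
      (𝓝 (chiSquare p (Set.Iic (∑ j, a j ^ 2)))) := by
  have hε : ∀ j i, Measurable (ε j i) := fun j i => he.meas (j, i)
  have hset : ∀ d, MeasurableSet {q : Data p M | β₀ ∈ confSet n₀ a d q.1 q.2} := fun d =>
    measurableSet_mem_confSet hp n₀ a d measurable_data_covariate measurable_data_response β₀
  have hF : ∀ d, Measurable ({q : Data p M | β₀ ∈ confSet n₀ a d q.1 q.2}.indicator
      fun _ => (1 : ENNReal)) := fun d => measurable_const.indicator (hset d)
  have hmix : ∀ ω', Measurable (mixedData β₀ x ε ω') := fun ω' =>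
    (measurable_mixedData hx hε).comp measurable_prodMk_left
  have hdiag : Measurable fun ω => mixedData β₀ x ε ω ω :=
    (measurable_mixedData hx hε).comp (measurable_id.prodMk measurable_id)
  have hinner : ∀ d ω', ∫⁻ ω, {q : Data p M | β₀ ∈ confSet n₀ a d q.1 q.2}.indicator
      (fun _ => (1 : ENNReal)) (mixedData β₀ x ε ω' ω) ∂P = P {ω | β₀ ∈ confSet n₀ a d
        (fun j i => x j i ω') (fun j i => x j i ω' ⬝ᵥ β₀ + ε j i ω)} := fun d ω' =>
    lintegral_indicator_one (hmix ω' (hset d))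
  have houter : ∀ d, P {ω | β₀ ∈ confSet n₀ a d (fun j i => x j i ω)
      (fun j i => x j i ω ⬝ᵥ β₀ + ε j i ω)} = ∫⁻ ω', P {ω | β₀ ∈ confSet n₀ a d
        (fun j i => x j i ω') (fun j i => x j i ω' ⬝ᵥ β₀ + ε j i ω)} ∂P := by
    intro d
    simp only [← hinner]
    rw [← lintegral_mixedData hx hε hind (hF d)]
    exact (lintegral_indicator_one (hdiag (hset d))).symm
  simp only [houter]
  refine tendsto_of_seq_tendsto fun u hu => ?_
  have hlim := tendsto_lintegral_of_dominated_convergence (μ := P) (F := fun k ω' =>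
    P {ω | β₀ ∈ confSet n₀ a (u k) (fun j i => x j i ω') (fun j i => x j i ω' ⬝ᵥ β₀ + ε j i ω)})
    (f := fun _ => chiSquare p (Set.Iic (∑ j, a j ^ 2))) (fun _ => 1)
    (fun k => by
      simp only [← hinner]
      exact measurable_lintegral_mixedData hx hε (hF _))
    (fun k => ae_of_all _ fun ω' => prob_le_one) (by simp)
    (by
      filter_upwards [hgood] with ω' hω'
      exact tendsto_coverage hp hM hn₀ hσ hS hω' he (fun _ _ _ => rfl) ha hu)
  simpa [Function.comp_def] using hlim

/-- Bound on the mean of the scaled stopping time for a nonrandom design. -/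
lemma lintegral_stopTime_le {x : ℕ → Fin p → ℝ} {e y : ℕ → Ω → ℝ} {a d T : ℝ} (hp : 0 < p)
    (hn₀ : p < n₀) (hS : S.PosDef) (hx : GoodDesign n₀ S x) (he : IsErrorFamily P σ e)
    (hy : ∀ i ω, y i ω = x i ⬝ᵥ β₀ + e i ω) (ha : 0 < a) (hd : 0 < d)
    (hT : ∀ n, n₀ ≤ n → designMinEig x n ≤ T) :
    ∫⁻ ω, ENNReal.ofReal (d ^ 2 * (stopTime n₀ a d x (fun i => y i ω) : ℝ)) ∂P ≤
      ENNReal.ofReal (momentSlope p σ a T + 1 + 2 * momentOffset n₀ a d T) := by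
  have hym : ∀ i, Measurable fun ω => y i ω := fun i => by
    simp only [hy]
    exact (he.meas i).const_add _
  have hm : Measurable fun ω => d ^ 2 * (stopTime n₀ a d x (fun i => y i ω) : ℝ) :=
    (measurable_from_nat.comp (measurable_stopTime (x := fun _ => x) (y := fun ω i => y i ω) hp
      n₀ a d (fun _ _ => measurable_const) hym)).const_mul _
  have hT0 : 0 < T := (designMinEig_pos hp hx.isUnit le_rfl (by omega)).trans_le (hT n₀ le_rfl)
  obtain ⟨hi, hle⟩ := integral_sq_stopTime_le hp hn₀ hx he hy ha hT
    ((hx.ae_stopTime hp hn₀ hS he hy ha).mono fun ω h => h.1 d hd)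
  have hL : MemLp (fun ω => d ^ 2 * (stopTime n₀ a d x (fun i => y i ω) : ℝ)) 2 P :=
    (memLp_two_iff_integrable_sq hm.aestronglyMeasurable).2 hi
  rw [← ofReal_integral_eq_lintegral_ofReal (hL.integrable one_le_two)
    (ae_of_all _ fun ω => by positivity)]
  refine ENNReal.ofReal_le_ofReal ?_
  have h1 := variance_nonneg (fun ω => d ^ 2 * (stopTime n₀ a d x (fun i => y i ω) : ℝ)) P
  rw [variance_eq_sub hL] at h1
  simp only [Pi.pow_apply] at h1
  have hA : 0 ≤ momentSlope p σ a T := by unfold momentSlope; positivity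
  have hB : 0 ≤ momentOffset n₀ a d T := by unfold momentOffset; positivity
  -- The bound is to be affine in `T`, hence integrable along with it: for slope `A` and offset `B`,
  -- `A² + 2 B ≤ (A + 1 + 2 B)²`.
  refine le_of_sq_le_sq ?_ (by positivity)
  nlinarith

/-- Makes the moment bound uniform in `d ≤ 1`, hence a dominating function as `d → 0`. -/
lemma momentOffset_mono {a d T : ℝ} (hT : 0 ≤ T) (hd : 0 ≤ d) (hd' : d ≤ 1) :
    momentOffset n₀ a d T ≤ momentOffset n₀ a 1 T := by
  unfold momentOffset
  gcongr

/-- Limit of the mean of the scaled stopping time for a nonrandom design. -/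
lemma tendsto_lintegral_stopTime {x : ℕ → Fin p → ℝ} {e y : ℕ → Ω → ℝ} {a T : ℝ} (hp : 0 < p)
    (hn₀ : p < n₀) (hS : S.PosDef) (hx : GoodDesign n₀ S x) (he : IsErrorFamily P σ e)
    (hy : ∀ i ω, y i ω = x i ⬝ᵥ β₀ + e i ω) (ha : 0 < a)
    (hT : ∀ n, n₀ ≤ n → designMinEig x n ≤ T) :
    Tendsto (fun d : ℝ =>
      ∫⁻ ω, ENNReal.ofReal (d ^ 2 * (stopTime n₀ a d x (fun i => y i ω) : ℝ)) ∂P) (𝓝[>] 0)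
      (𝓝 (ENNReal.ofReal (a ^ 2 * minEig S * σ ^ 2))) := by
  have hym : ∀ i, Measurable fun ω => y i ω := fun i => by
    simp only [hy]
    exact (he.meas i).const_add _
  have hm : ∀ d, Measurable fun ω => d ^ 2 * (stopTime n₀ a d x (fun i => y i ω) : ℝ) := fun d =>
    (measurable_from_nat.comp (measurable_stopTime (x := fun _ => x) (y := fun ω i => y i ω) hp
      n₀ a d (fun _ _ => measurable_const) hym)).const_mul _
  have hT0 : 0 < T := (designMinEig_pos hp hx.isUnit le_rfl (by omega)).trans_le (hT n₀ le_rfl)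
  have hst := hx.ae_stopTime hp hn₀ hS he hy ha
  have h1 : ∀ᶠ d : ℝ in 𝓝[>] 0, 0 < d ∧ d ≤ 1 := Ioc_mem_nhdsGT (zero_lt_one' ℝ)
  have hsq : ∀ d : ℝ, 0 < d →
      Integrable (fun ω => (d ^ 2 * (stopTime n₀ a d x (fun i => y i ω) : ℝ)) ^ 2) P ∧
      ∫ ω, (d ^ 2 * (stopTime n₀ a d x (fun i => y i ω) : ℝ)) ^ 2 ∂P ≤
        momentSlope p σ a T ^ 2 + 2 * momentOffset n₀ a d T := fun d hd =>
    integral_sq_stopTime_le hp hn₀ hx he hy ha hT (hst.mono fun ω h => h.1 d hd)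
  have h3 := tendsto_integral_of_ae_of_sq_le (P := P) (l := 𝓝[>] (0 : ℝ))
    (B := momentSlope p σ a T ^ 2 + 2 * momentOffset n₀ a 1 T) hm
    (fun d ω => by positivity) (h1.mono fun d hd => (hsq d hd.1).1)
    (h1.mono fun d hd => (hsq d hd.1).2.trans
      (by gcongr; exact momentOffset_mono hT0.le hd.1.le hd.2))
    (hst.mono fun ω h => h.2)
  refine (ENNReal.tendsto_ofReal h3).congr' ?_
  filter_upwards [h1] with d hd
  exact ofReal_integral_eq_lintegral_ofReal
    (((memLp_two_iff_integrable_sq (hm d).aestronglyMeasurable).2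
      (hsq d hd.1).1).integrable one_le_two) (ae_of_all _ fun ω => by positivity)

/-- Mean of one stopping time for a random design. -/
theorem integral_stopTime_random {T : Ω → ℝ} (hp : 0 < p) (hn₀ : p < n₀)
    (hS : S.PosDef) (hx : ∀ j i, Measurable (x j i))
    (he : IsErrorFamily P σ fun k : Fin M × ℕ => ε k.1 k.2)
    (hind : IndepFun (fun ω (k : Fin M × ℕ) => x k.1 k.2 ω)
      (fun ω (k : Fin M × ℕ) => ε k.1 k.2 ω) P)
    (hgood : ∀ᵐ ω ∂P, ∀ j, GoodDesign n₀ S fun i => x j i ω) (ha : ∀ j, 0 < a j)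
    (hTi : Integrable T P) (j : Fin M)
    (hT : ∀ᵐ ω ∂P, ∀ n, n₀ ≤ n → designMinEig (fun i => x j i ω) n ≤ T ω) :
    (∀ d : ℝ, 0 < d → Integrable (fun ω => d ^ 2 * (stopTime n₀ (a j) d (fun i => x j i ω)
      (fun i => x j i ω ⬝ᵥ β₀ + ε j i ω) : ℝ)) P) ∧
    Tendsto (fun d : ℝ => ∫ ω, d ^ 2 * (stopTime n₀ (a j) d (fun i => x j i ω)
      (fun i => x j i ω ⬝ᵥ β₀ + ε j i ω) : ℝ) ∂P) (𝓝[>] 0)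
      (𝓝 (a j ^ 2 * minEig S * σ ^ 2)) := by
  have hε : ∀ j i, Measurable (ε j i) := fun j i => he.meas (j, i)
  have hdata : ∀ d, Measurable fun q : Data p M =>
      d ^ 2 * (stopTime n₀ (a j) d (q.1 j) (q.2 j) : ℝ) := fun d =>
    (measurable_from_nat.comp (measurable_stopTime hp n₀ (a j) d (measurable_data_covariate j)
      (measurable_data_response j))).const_mul _
  have hmix : ∀ ω', Measurable (mixedData β₀ x ε ω') := fun ω' =>
    (measurable_mixedData hx hε).comp measurable_prodMk_left
  have hdiag : Measurable fun ω => mixedData β₀ x ε ω ω :=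
    (measurable_mixedData hx hε).comp (measurable_id.prodMk measurable_id)
  have hcond : ∀ d : ℝ, ∫⁻ ω, ENNReal.ofReal (d ^ 2 * (stopTime n₀ (a j) d (fun i => x j i ω)
      (fun i => x j i ω ⬝ᵥ β₀ + ε j i ω) : ℝ)) ∂P = ∫⁻ ω', ∫⁻ ω, ENNReal.ofReal (d ^ 2 *
        (stopTime n₀ (a j) d (fun i => x j i ω') (fun i => x j i ω' ⬝ᵥ β₀ + ε j i ω) : ℝ)) ∂P ∂P :=
    fun d => lintegral_mixedData hx hε hind (hdata d).ennreal_ofReal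
  have hbound : ∀ᵐ ω' ∂P, ∀ d : ℝ, 0 < d → ∫⁻ ω, ENNReal.ofReal (d ^ 2 *
        (stopTime n₀ (a j) d (fun i => x j i ω') (fun i => x j i ω' ⬝ᵥ β₀ + ε j i ω) : ℝ)) ∂P ≤
      ENNReal.ofReal (momentSlope p σ (a j) (T ω') + 1 + 2 * momentOffset n₀ (a j) d (T ω')) := by
    filter_upwards [hgood, hT] with ω' hg hω' d hd
    exact lintegral_stopTime_le hp hn₀ hS (hg j) (he.procedure j) (fun i ω => rfl) (ha j) hd hω'
  have hboundi : ∀ d : ℝ, Integrable (fun ω' => momentSlope p σ (a j) (T ω') + 1 +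
      2 * momentOffset n₀ (a j) d (T ω')) P := fun d => by
    simp only [momentSlope, momentOffset]
    exact ((((hTi.const_mul _).mul_const _).mul_const _).add (integrable_const _)).add
      ((((((hTi.const_mul _).add (integrable_const _)).add (integrable_const _))).mul_const
        _).const_mul _)
  have hboundfin : ∀ d : ℝ, ∫⁻ ω', ENNReal.ofReal (momentSlope p σ (a j) (T ω') + 1 +
      2 * momentOffset n₀ (a j) d (T ω')) ∂P ≠ ⊤ := fun d =>
    (hboundi d).lintegral_lt_top.ne
  have hint : ∀ d : ℝ, 0 < d → Integrable (fun ω => d ^ 2 * (stopTime n₀ (a j) d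
      (fun i => x j i ω) (fun i => x j i ω ⬝ᵥ β₀ + ε j i ω) : ℝ)) P := by
    intro d hd
    refine ⟨((hdata d).comp hdiag).aestronglyMeasurable, ?_⟩
    rw [hasFiniteIntegral_iff_ofReal (ae_of_all _ fun ω => by positivity), hcond]
    exact (lintegral_mono_ae (hbound.mono fun ω' h => h d hd)).trans_lt (hboundfin d).lt_top
  refine ⟨hint, ?_⟩
  set c := a j ^ 2 * minEig S * σ ^ 2 with hc
  have hc0 : 0 ≤ c := by
    have := minEig_pos hp hS
    positivity
  have hlim : Tendsto (fun d : ℝ => ∫⁻ ω, ENNReal.ofReal (d ^ 2 * (stopTime n₀ (a j) d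
      (fun i => x j i ω) (fun i => x j i ω ⬝ᵥ β₀ + ε j i ω) : ℝ)) ∂P) (𝓝[>] 0)
      (𝓝 (ENNReal.ofReal c)) := by
    simp only [hcond]
    have h1 : ∀ᶠ d : ℝ in 𝓝[>] 0, 0 < d ∧ d ≤ 1 := Ioc_mem_nhdsGT (zero_lt_one' ℝ)
    have h2 := tendsto_lintegral_filter_of_dominated_convergence (μ := P) (l := 𝓝[>] (0 : ℝ))
      (F := fun d ω' => ∫⁻ ω, ENNReal.ofReal (d ^ 2 * (stopTime n₀ (a j) d (fun i => x j i ω')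
        (fun i => x j i ω' ⬝ᵥ β₀ + ε j i ω) : ℝ)) ∂P) (f := fun _ => ENNReal.ofReal c)
      (fun ω' => ENNReal.ofReal (momentSlope p σ (a j) (T ω') + 1 +
        2 * momentOffset n₀ (a j) 1 (T ω')))
      (Eventually.of_forall fun d =>
        measurable_lintegral_mixedData hx hε (hdata d).ennreal_ofReal)
      (by
        filter_upwards [h1] with d hd
        filter_upwards [hbound, hgood, hT] with ω' hω' hg hTω'
        have hT0 : 0 < T ω' := (designMinEig_pos hp (hg j).isUnit le_rfl (by omega)).trans_le
          (hTω' n₀ le_rfl)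
        refine (hω' d hd.1).trans (ENNReal.ofReal_le_ofReal ?_)
        gcongr
        exact momentOffset_mono hT0.le hd.1.le hd.2)
      (hboundfin 1)
      (by
        filter_upwards [hgood, hT] with ω' hg hω'
        exact tendsto_lintegral_stopTime hp hn₀ hS (hg j) (he.procedure j) (fun i ω => rfl) (ha j)
          hω')
    simpa using h2
  rw [← ENNReal.toReal_ofReal hc0]
  refine ((ENNReal.tendsto_toReal ENNReal.ofReal_ne_top).comp hlim).congr' ?_
  filter_upwards [eventually_mem_nhdsWithin] with d hd
  rw [Function.comp_apply, ← ofReal_integral_eq_lintegral_ofReal (hint d hd)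
    (ae_of_all _ fun ω => by positivity), ENNReal.toReal_ofReal
    (integral_nonneg fun ω => by positivity)]

end RandomDesign

/-- As `1 - α > 0`, this excludes `a = 0` in the main theorem. -/
lemma chiSquare_Iic_zero (p : ℕ) (hp : 0 < p) : chiSquare p (Set.Iic 0) = 0 := by
  rw [← stdGaussian_norm_sq_le, ← stdGaussian_norm_sq_eq p hp 0]
  congr 1
  ext w
  exact ⟨fun h => le_antisymm h (sq_nonneg _), fun h => le_of_eq h⟩

end DistSeq

/-! ### The main theorem -/

theorem theorem1 {Ω : Type*} [MeasurableSpace Ω] (P : Measure Ω) [IsProbabilityMeasure P]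
    (p M n₀ : ℕ) (hp : 0 < p) (hn₀ : p < n₀)
    -- observations `(x j i, y j i)` of procedure `j`, errors `ε j i`
    (x : Fin M → ℕ → Ω → Fin p → ℝ) (y ε : Fin M → ℕ → Ω → ℝ)
    (β₀ : Fin p → ℝ) (σ : ℝ) (hσ : 0 < σ)
    (S : Matrix (Fin p) (Fin p) ℝ) (hS : S.PosDef)
    (α a : ℝ) (ã : Fin M → ℝ)
    -- the linear regression model
    (hx_meas : ∀ j i, Measurable (x j i))
    (hε_meas : ∀ j i, Measurable (ε j i))
    (hmodel : ∀ j i ω, y j i ω = x j i ω ⬝ᵥ β₀ + ε j i ω)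
    (hε_indep : iIndepFun (fun (k : Fin M × ℕ) => ε k.1 k.2) P)
    (hε_ident : ∀ j i j' i', IdentDistrib (ε j i) (ε j' i') P P)
    (hε_sq : ∀ j i, MemLp (ε j i) 2 P)
    (hε_mean : ∀ j i, ∫ ω, ε j i ω ∂P = 0)
    (hε_var : ∀ j i, variance (ε j i) P = σ ^ 2)
    (hxε_indep : IndepFun (fun ω (k : Fin M × ℕ) => x k.1 k.2 ω)
      (fun ω (k : Fin M × ℕ) => ε k.1 k.2 ω) P)
    -- (A1)
    (hA1 : ∀ j, ∀ᵐ ω ∂P,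
      Tendsto (fun n : ℕ => (n : ℝ)⁻¹ • DistSeq.gram (fun i => x j i ω) n) atTop (𝓝 S))
    -- the initial data sets determine the least squares estimates
    (hinit : ∀ j, ∀ᵐ ω ∂P, IsUnit (DistSeq.gram (fun i => x j i ω) n₀).det)
    -- `a ^ 2` is the `1 - α` quantile of the chi-square distribution
    (hα : 0 < α) (hα' : α < 1)
    (ha : DistSeq.chiSquare p (Set.Iic (a ^ 2)) = ENNReal.ofReal (1 - α))
    (hã : ∀ j, 0 < ã j) (hã_sum : ∑ j, ã j ^ 2 = a ^ 2) :
    -- all procedures stop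
    (∀ᵐ ω ∂P, ∀ d : ℝ, 0 < d → ∀ j,
      (DistSeq.stopSet n₀ (ã j) d (fun i => x j i ω) (fun i => y j i ω)).Nonempty) ∧
    -- (1)
    (∀ᵐ ω ∂P, Tendsto
      (fun d : ℝ => d ^ 2 *
        (DistSeq.totalSize n₀ ã d (fun j i => x j i ω) (fun j i => y j i ω) : ℝ) /
          (a ^ 2 * σ ^ 2 * DistSeq.minEig S))
      (𝓝[>] 0) (𝓝 1)) ∧
    -- (2)
    (Tendsto
      (fun d : ℝ => P {ω | β₀ ∈
        DistSeq.confSet n₀ ã d (fun j i => x j i ω) (fun j i => y j i ω)})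
      (𝓝[>] 0) (𝓝 (ENNReal.ofReal (1 - α)))) ∧
    -- (3); the integrable bound exists automatically for nonrandom covariates
    ((∃ T : Ω → ℝ, Integrable T P ∧ ∀ j, ∀ᵐ ω ∂P, ∀ n, n₀ ≤ n →
        DistSeq.designMinEig (fun i => x j i ω) n ≤ T ω) →
      (∀ d : ℝ, 0 < d → Integrable (fun ω =>
        (DistSeq.totalSize n₀ ã d (fun j i => x j i ω) (fun j i => y j i ω) : ℝ)) P) ∧
      Tendsto
        (fun d : ℝ => d ^ 2 *
          (∫ ω, (DistSeq.totalSize n₀ ã d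
            (fun j i => x j i ω) (fun j i => y j i ω) : ℝ) ∂P) /
            (a ^ 2 * σ ^ 2 * DistSeq.minEig S))
        (𝓝[>] 0) (𝓝 1)) := by
  have hmodel' : y = fun j i ω => x j i ω ⬝ᵥ β₀ + ε j i ω :=
    funext fun j => funext fun i => funext fun ω => hmodel j i ω
  subst hmodel'
  have he : DistSeq.IsErrorFamily P σ fun k : Fin M × ℕ => ε k.1 k.2 :=
    { meas := fun k => hε_meas _ _
      indep := hε_indep
      ident := fun k k' => hε_ident _ _ _ _
      memLp := fun k => hε_sq _ _
      mean := fun k => hε_mean _ _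
      var := fun k => by
        rw [← hε_var k.1 k.2]
        exact (variance_of_integral_eq_zero (hε_meas _ _).aemeasurable (hε_mean _ _)).symm }
  have hgood : ∀ᵐ ω ∂P, ∀ j, DistSeq.GoodDesign n₀ S fun i => x j i ω := by
    filter_upwards [ae_all_iff.2 hA1, ae_all_iff.2 hinit] with ω h1 h2 j
    exact ⟨h1 j, h2 j⟩
  have ha0 : 0 < a ^ 2 := by
    refine lt_of_le_of_ne (sq_nonneg a) fun h => ?_
    rw [← h, DistSeq.chiSquare_Iic_zero p hp] at ha
    exact (ENNReal.ofReal_pos.2 (sub_pos.2 hα')).ne ha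
  -- At least one procedure exists, as an empty sum would give `a² = 0`.
  have hM : 0 < M := by
    rcases Nat.eq_zero_or_pos M with rfl | h
    · simp only [Finset.univ_eq_empty, Finset.sum_empty] at hã_sum
      exact absurd hã_sum ha0.ne
    · exact h
  have hμ : 0 < DistSeq.minEig S := DistSeq.minEig_pos hp hS
  have hc : 0 < a ^ 2 * σ ^ 2 * DistSeq.minEig S := by positivity
  have hsum : ∑ j, ã j ^ 2 * DistSeq.minEig S * σ ^ 2 = a ^ 2 * σ ^ 2 * DistSeq.minEig S := by
    rw [← Finset.sum_mul, ← Finset.sum_mul, hã_sum]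
    ring
  have hfin := DistSeq.ae_stopTime (β₀ := β₀) hp hn₀ hS hx_meas he hxε_indep hgood hã
  refine ⟨hfin.mono fun ω h d hd j => (h j).1 d hd, hfin.mono fun ω h => ?_, ?_, ?_⟩
  · have h1 := DistSeq.tendsto_totalSize fun j => (h j).2
    rw [hsum] at h1
    have h2 := h1.div_const (a ^ 2 * σ ^ 2 * DistSeq.minEig S)
    rwa [div_self hc.ne'] at h2
  · have h1 := DistSeq.tendsto_coverage_random (β₀ := β₀) hp hM hn₀ hσ hS hx_meas he hxε_indep
      hgood hã
    rwa [hã_sum, ha] at h1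
  · rintro ⟨T, hTi, hT⟩
    have hj := fun j => DistSeq.integral_stopTime_random (β₀ := β₀) hp hn₀ hS hx_meas he hxε_indep
      hgood hã hTi j (hT j)
    have hint : ∀ d : ℝ, 0 < d → ∀ j, Integrable (fun ω => (DistSeq.stopTime n₀ (ã j) d
        (fun i => x j i ω) (fun i => x j i ω ⬝ᵥ β₀ + ε j i ω) : ℝ)) P := fun d hd j =>
      (integrable_const_mul_iff (IsUnit.mk0 _ (by positivity)) _).1 ((hj j).1 d hd)
    refine ⟨fun d hd => ?_, ?_⟩
    · simp only [DistSeq.totalSize, Nat.cast_sum]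
      exact integrable_finsetSum _ fun j _ => hint d hd j
    · have h1 := tendsto_finsetSum Finset.univ fun j _ => (hj j).2
      rw [hsum] at h1
      have h2 := h1.div_const (a ^ 2 * σ ^ 2 * DistSeq.minEig S)
      rw [div_self hc.ne'] at h2
      refine h2.congr' ?_
      filter_upwards [eventually_mem_nhdsWithin] with d hd
      simp only [DistSeq.totalSize, Nat.cast_sum, integral_const_mul]
      rw [integral_finsetSum _ fun j _ => hint d hd j, Finset.mul_sum]
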